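/- Let $R$ be a commutative ring with $1$. Let $\mathbf{Sh}$ be the category whose objects are pairs $(P,F)$ of a small category $P$ and a contravariant functor $F:P\to {}_R\mathrm{Mod}$, and whose morphisms $(P,F)\to(Q,G)$ are pairs $(\gamma_1,\gamma_2)$ of a functor $\gamma_1:Q\to P$ and a natural transformation $\gamma_2:F\gamma_1\to G$. The complex $\mathcal S^*(P,F)$ has $\mathcal S^n(P,F)=\prod_{x_0\to\cdots\to x_n}F(x_0)$ (product over all $n$-simplices of the nerve of $P$) and differential $du|_\sigma=\sum_j(-1)^jF(\sigma_j\subseteq\sigma)(u|_{\sigma_j})$, where $\sigma_j$ omits the $j$-th vertex and $F(\sigma_j\subseteq\sigma)$ is $F(x_0\to x_1)$ for $j=0$ and the identity for $j>0$; $H^n(P,F)=H^n(\mathcal S^*(P,F))$. Both are covariant functors on $\mathbf{Sh}$. A *bundle of sheaves* with base a small category $B$ is a contravariant functor $\xi:B\to\mathbf{Sh}$, $\xi(x)=(E_x,F_x)$, with $\xi(x_1\to x_2)=(\xi_1,\xi_2)$. Composing with $\mathcal S^q$ and $H^q$ gives contravariant functors $\mathcal S^q$ and $\mathcal H^q_{fib}(\xi):x\mapsto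 H^q(E_x,F_x)$ on $B$. The *total sheaf* $(E,F)$ has as objects of $E$ the disjoint union of the objects of the $E_x$; $E$ is generated by (a) the arrows of each $E_x$ and (b) an arrow $y\to\xi_1(f)(y)$ for each $f:x_1\to x_2$ in $B$ and $y\in E_{x_1}$, subject to the composition laws (and identities) of the $E_x$ for (a) and of $B$ for (b), and to commutativity of the squares formed by $y_1\to y_2$ in $E_{x_1}$, the arrows (b) over $f$ at $y_1,y_2$, and $\xi_1(f)(y_1)\to\xi_1(f)(y_2)$. $F$ sends $y\in E_x$ to $F_x(y)$, arrows (a) to their images under $F_x$, and the arrow (b) to $\xi_2(f)_y$. A poset $B$ with a unique minimal element $0$ is *admissible for* a cover $x\succ 0$ if for each $y\in\overline B(x)$ the set $\{z\in B(x)\mid y\le z\}$ has a minimum, where $B(x)=\{z\mid x\le z\}$ and $\overline B(x)=B\setminus B(x)$. *Recursively admissible* finite posets are defined recursively: $B$ is boolean of rank $1$, or $B$ is admissible for some $x\succ0$ with both $B(x)$ and $\overline B(x)$ recursively admissible. **Theorem.** Let $\xi:B\to\mathbf{Sh}$ be a bundle of sheaves whose base $B$ is a recursively admissible finite poset, with total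 sheaf $(E,F)$. Then: 1. There is a first quadrant cohomological spectral sequence $$E_2^{p,q}\cong H^p(B,\mathcal H^q_{fib}(\xi))\Longrightarrow H^{p+q}(E,F).$$ 2. Let $\mathcal K^{p,q}=\mathcal S^p(B,\mathcal S^q)$ and let $\mathcal T^n(E,F)=\bigoplus_{p+q=n}\mathcal K^{p,q}$ be the total complex whose differential has as component in $\mathcal K^{p,q}$ the sum of the differential of $\mathcal S^*(B,\mathcal S^q)$ and of $(-1)^{p+q}$ times the map induced by the differentials $\mathcal S^{q-1}(E_x,F_x)\to\mathcal S^q(E_x,F_x)$. For $\sigma=x_0\to\cdots\to x_p$ in $B$ and $\tau=y_0\to\cdots\to y_q$ in $E_{x_0}$ put $y_{i,j}=\xi_1(x_0\to x_i)(y_j)$; a traversal $z$ of the grid of $(\sigma,\tau)$ is a chain of $p+q$ arrows of $E$ from $y_{0,0}$ to $y_{p,q}$, each of the form $y_{i,j}\to y_{i+1,j}$ or $y_{i,j}\to y_{i,j+1}$, and $m(z)$ is the sum of $p-i$ over the arrows $y_{i,j}\to y_{i,j+1}$ of $z$. Then $$\varphi(u)|_{\sigma,\tau}=(-1)^{\lceil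 q/2\rceil}\sum_z(-1)^{m(z)}u|_z$$ (sum over all traversals, as paths in the $p\times q$ grid) defines a chain map $\varphi:\mathcal S^*(E,F)\to\mathcal T^*(E,F)$, and $\varphi$ is a quasi-isomorphism. -/

import Mathlib

open CategoryTheory Opposite

universe u

/-! ### The category `Sh` of (pre)sheaves of modules on small categories -/

/-- An object `(P, F)` of `Sh`: a small category `P` with a contravariant functor `F` from `P` to
`R`-modules. -/
structure Sh (R : Type u) [CommRing R] where
  cat : Type u
  [small : SmallCategory cat]
  sheaf : catᵒᵖ ⥤ ModuleCat.{u} R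

attribute [instance] Sh.small

namespace Sh

variable {R : Type u} [CommRing R]

/-- A morphism `(P, F) ⟶ (Q, G)`: a functor `γ₁ : Q ⥤ P` and a natural transformation
`γ₂ : F γ₁ ⟶ G`. -/
@[ext]
structure Hom (X Y : Sh R) where
  base : Y.cat ⥤ X.cat
  map : base.op ⋙ X.sheaf ⟶ Y.sheaf

instance : Category (Sh R) where
  Hom := Hom
  id X := { base := 𝟭 _, map := { app := fun _ => 𝟙 _ } }
  comp {X Y Z} f g :=
    { base := g.base ⋙ f.base
      map :=
        { app := fun x => f.map.app (op (g.base.obj x.unop)) ≫ g.map.app x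
          naturality := fun x y h => by
            have h1 := f.map.naturality (g.base.map h.unop).op
            have h2 := g.map.naturality h
            dsimp at h1 h2 ⊢
            rw [reassoc_of% h1, h2, Category.assoc] } }

lemma sheaf_map_comp (X : Sh R) {a b c : X.cat} (k : a ⟶ c) (f : a ⟶ b) (g : b ⟶ c)
    (h : k = f ≫ g) (v : X.sheaf.obj (op c)) :
    X.sheaf.map k.op v = X.sheaf.map f.op (X.sheaf.map g.op v) := by
  subst h
  simp

/-- The component `F(γ₁ y) ⟶ G(y)` of `γ₂`, with source `F(y')` where `γ₁ y = y'`. -/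
def Hom.comp' {X Y : Sh R} (γ : X ⟶ Y) (y : Y.cat) (y' : X.cat) (h : γ.base.obj y = y') :
    X.sheaf.obj (op y') ⟶ Y.sheaf.obj (op y) :=
  X.sheaf.map (eqToHom h).op ≫ γ.map.app (op y)

lemma Hom.comp'_id {X : Sh R} (γ : X ⟶ X) (hγ : γ = 𝟙 X) (y : X.cat) (h : γ.base.obj y = y) :
    Hom.comp' γ y y h = 𝟙 _ := by
  subst hγ
  change X.sheaf.map (𝟙 _) ≫ 𝟙 _ = _
  simp

lemma Hom.comp'_comp {X Y Z : Sh R} (γ : X ⟶ Y) (δ : Y ⟶ Z) (ε : X ⟶ Z) (hε : ε = γ ≫ δ)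
    (z : Z.cat) (y : Y.cat) (x : X.cat) (h₁ : δ.base.obj z = y) (h₂ : γ.base.obj y = x)
    (h₃ : ε.base.obj z = x) :
    Hom.comp' ε z x h₃ = Hom.comp' γ y x h₂ ≫ Hom.comp' δ z y h₁ := by
  subst hε h₁ h₂
  change X.sheaf.map (𝟙 _) ≫ (γ.map.app _ ≫ δ.map.app _) =
    (X.sheaf.map (𝟙 _) ≫ _) ≫ (Y.sheaf.map (𝟙 _) ≫ _)
  simp

/-! ### Cochains of a sheaf -/

/-- The cosimplicial module of cochains: in degree `n` the product over all chains
`σ = x₀ ⟶ ⋯ ⟶ xₙ` of `P` of the modules `F(x₀)`; a monotone map `θ : [m] → [n]` sends `u` to the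
cochain whose value at `σ` is `F(x₀ ⟶ x_{θ(0)})` of the value of `u` at the chain `σ ∘ θ`. -/
def cosimplicial (X : Sh R) : CosimplicialObject (ModuleCat.{u} R) where
  obj n := ModuleCat.of R (∀ σ : ComposableArrows X.cat n.len, X.sheaf.obj (op (σ.obj 0)))
  map {m n} θ := ModuleCat.ofHom
    { toFun := fun u σ =>
        X.sheaf.map (σ.map (homOfLE (Fin.zero_le (θ.toOrderHom 0)))).op
          (u (θ.toOrderHom.monotone.functor ⋙ σ))
      map_add' := fun u v => funext fun σ => map_add (X.sheaf.map _).hom _ _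
      map_smul' := fun r u => funext fun σ => map_smul (X.sheaf.map _).hom _ _ }
  map_id n := by
    ext u σ
    change X.sheaf.map (σ.map (𝟙 _)).op (u σ) = u σ
    simp
  map_comp {l m n} θ θ' := by
    ext u σ
    exact X.sheaf_map_comp _ (σ.map (homOfLE (Fin.zero_le (θ'.toOrderHom 0))))
      (σ.map (homOfLE (θ'.toOrderHom.monotone (Fin.zero_le (θ.toOrderHom 0)))))
      (σ.map_comp _ _) (u ((θ ≫ θ').toOrderHom.monotone.functor ⋙ σ))

/-- The map of cochains induced by a morphism `γ` of `Sh`: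
`(γ^* u)(σ) = γ₂ (u (γ₁ σ))`. -/
def cosimplicialMap {X Y : Sh R} (γ : X ⟶ Y) : X.cosimplicial ⟶ Y.cosimplicial where
  app n := ModuleCat.ofHom
    { toFun := fun u σ => γ.map.app (op (σ.obj 0)) (u (σ ⋙ γ.base))
      map_add' := fun u v => funext fun σ => map_add (γ.map.app _).hom _ _
      map_smul' := fun r u => funext fun σ => map_smul (γ.map.app _).hom _ _ }
  naturality m n θ := by
    ext u
    funext σ
    exact ConcreteCategory.congr_hom (γ.map.naturality
      (σ.map (homOfLE (Fin.zero_le (θ.toOrderHom 0)))).op)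
      (u (θ.toOrderHom.monotone.functor ⋙ σ ⋙ γ.base))

/-- Cochains as a covariant functor `S^* : Sh ⥤ Ch_R`. The degree `n` part of `S^*(P, F)` is the
product of the modules `F(x₀)` over all `n`-simplices `x₀ ⟶ ⋯ ⟶ xₙ` of the nerve of `P`, and the
differential is the alternating sum of the coface maps. -/
def cochainComplex : Sh R ⥤ CochainComplex (ModuleCat.{u} R) ℕ :=
  { obj := cosimplicial
    map := cosimplicialMap } ⋙ AlgebraicTopology.alternatingCofaceMapComplex _

/-- The cohomology `H^n(P, F)`, as a functor on `Sh`. -/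
noncomputable def cohomology (R : Type u) [CommRing R] (n : ℕ) : Sh R ⥤ ModuleCat.{u} R :=
  cochainComplex ⋙ HomologicalComplex.homologyFunctor _ _ n

end Sh

/-- A bundle of sheaves with base `B`: a contravariant functor from `B` to `Sh`. -/
abbrev SheafBundle (R : Type u) [CommRing R] (B : Type u) [SmallCategory B] :=
  Bᵒᵖ ⥤ Sh R

namespace SheafBundle

variable {R : Type u} [CommRing R] {B : Type u} [SmallCategory B] (ξ : SheafBundle R B)

/-- The fibre category `E_x`. -/
abbrev Fib (x : B) : Type u := (ξ.obj (op x)).cat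

/-- The functor `ξ₁(x₁ ⟶ x₂) : E_{x₁} ⥤ E_{x₂}`. -/
abbrev push {x₁ x₂ : B} (f : x₁ ⟶ x₂) : ξ.Fib x₁ ⥤ ξ.Fib x₂ := (ξ.map f.op).base

/-! ### The total sheaf -/

/-- Objects of the total category: the disjoint union of the objects of the fibres. -/
structure Obj where
  pt : B
  val : ξ.Fib pt

/-- The simple arrows: those of the fibres (type a), and an arrow `y₁ ⟶ y₂` over `f : x₁ ⟶ x₂`
whenever `ξ₁(f)(y₁) = y₂` (type b). The arrows of type b over identities are identified with
identity arrows below. -/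
inductive Simple : ξ.Obj → ξ.Obj → Type u
  | fib {x : B} {y₁ y₂ : ξ.Fib x} (k : y₁ ⟶ y₂) : Simple ⟨x, y₁⟩ ⟨x, y₂⟩
  | lift {x₁ x₂ : B} (f : x₁ ⟶ x₂) (y₁ : ξ.Fib x₁) (y₂ : ξ.Fib x₂)
      (h : (ξ.push f).obj y₁ = y₂) : Simple ⟨x₁, y₁⟩ ⟨x₂, y₂⟩

instance : Quiver ξ.Obj := ⟨ξ.Simple⟩

/-- An arrow of type a, as a path of length one. -/
def fibPath {x : B} {y₁ y₂ : ξ.Fib x} (k : y₁ ⟶ y₂) :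
    (Paths.of ξ.Obj).obj ⟨x, y₁⟩ ⟶ (Paths.of ξ.Obj).obj ⟨x, y₂⟩ :=
  (Paths.of ξ.Obj).map (Simple.fib k)

/-- An arrow of type b, as a path of length one. -/
def liftPath {x₁ x₂ : B} (f : x₁ ⟶ x₂) (y₁ : ξ.Fib x₁) (y₂ : ξ.Fib x₂)
      (h : (ξ.push f).obj y₁ = y₂) :
    (Paths.of ξ.Obj).obj ⟨x₁, y₁⟩ ⟶ (Paths.of ξ.Obj).obj ⟨x₂, y₂⟩ :=
  (Paths.of ξ.Obj).map (Simple.lift f y₁ y₂ h)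

/-- The relations of the total category: arrows of type a compose as in the fibres, arrows of type b
compose as in the base, and the squares with sides `y₁ ⟶ y₂`, `y_i ⟶ ξ₁(f)(y_i)` and
`ξ₁(f)(y₁) ⟶ ξ₁(f)(y₂)` commute. -/
inductive Rel : HomRel (Paths ξ.Obj)
  | fib_id {x : B} (y : ξ.Fib x) : Rel (ξ.fibPath (𝟙 y)) (𝟙 _)
  | fib_comp {x : B} {y₁ y₂ y₃ : ξ.Fib x} (k : y₁ ⟶ y₂) (l : y₂ ⟶ y₃) :
      Rel (ξ.fibPath k ≫ ξ.fibPath l) (ξ.fibPath (k ≫ l))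
  | lift_id {x : B} (y : ξ.Fib x) (h : (ξ.push (𝟙 x)).obj y = y) :
      Rel (ξ.liftPath (𝟙 x) y y h) (𝟙 _)
  | lift_comp {x₁ x₂ x₃ : B} (f : x₁ ⟶ x₂) (g : x₂ ⟶ x₃) (y₁ : ξ.Fib x₁) (y₂ : ξ.Fib x₂)
      (y₃ : ξ.Fib x₃) (h₁ : (ξ.push f).obj y₁ = y₂) (h₂ : (ξ.push g).obj y₂ = y₃)
      (h₃ : (ξ.push (f ≫ g)).obj y₁ = y₃) :
      Rel (ξ.liftPath f y₁ y₂ h₁ ≫ ξ.liftPath g y₂ y₃ h₂) (ξ.liftPath (f ≫ g) y₁ y₃ h₃)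
  | square {x₁ x₂ : B} (f : x₁ ⟶ x₂) {y₁ y₂ : ξ.Fib x₁} (k : y₁ ⟶ y₂) :
      Rel (ξ.fibPath k ≫ ξ.liftPath f y₂ _ rfl)
        (ξ.liftPath f y₁ _ rfl ≫ ξ.fibPath ((ξ.push f).map k))

/-- The total category `E`: generated by the simple arrows, subject to the relations `Rel`. -/
abbrev Total := CategoryTheory.Quotient ξ.Rel

/-- The value of the total sheaf on objects and simple arrows. -/
def sheafOnSimple : ξ.Obj ⥤q (ModuleCat.{u} R)ᵒᵖ where
  obj a := op ((ξ.obj (op a.pt)).sheaf.obj (op a.val))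
  map {a b} s := match a, b, s with
    | _, _, .fib (x := x) k => ((ξ.obj (op x)).sheaf.map k.op).op
    | _, _, .lift f y₁ y₂ h => (Sh.Hom.comp' (ξ.map f.op) y₁ y₂ h).op

lemma lift_fibPath {x : B} {y₁ y₂ : ξ.Fib x} (k : y₁ ⟶ y₂) :
    (Paths.lift ξ.sheafOnSimple).map (ξ.fibPath k) = ((ξ.obj (op x)).sheaf.map k.op).op :=
  Category.id_comp _

lemma lift_liftPath {x₁ x₂ : B} (f : x₁ ⟶ x₂) (y₁ : ξ.Fib x₁) (y₂ : ξ.Fib x₂)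
    (h : (ξ.push f).obj y₁ = y₂) :
    (Paths.lift ξ.sheafOnSimple).map (ξ.liftPath f y₁ y₂ h) =
      (Sh.Hom.comp' (ξ.map f.op) y₁ y₂ h).op :=
  Category.id_comp _

lemma sheafOnSimple_rel {a b : Paths ξ.Obj} (p q : a ⟶ b) (h : ξ.Rel p q) :
    (Paths.lift ξ.sheafOnSimple).map p = (Paths.lift ξ.sheafOnSimple).map q := by
  cases h with
  | @fib_id x y =>
    rw [lift_fibPath]
    exact congrArg Quiver.Hom.op ((ξ.obj (op x)).sheaf.map_id (op y))
  | @fib_comp x y₁ y₂ y₃ k l =>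
    rw [Functor.map_comp, lift_fibPath, lift_fibPath, lift_fibPath]
    exact congrArg Quiver.Hom.op ((ξ.obj (op x)).sheaf.map_comp l.op k.op).symm
  | @lift_id x y h =>
    rw [lift_liftPath]
    exact congrArg Quiver.Hom.op (Sh.Hom.comp'_id _ (ξ.map_id (op x)) y h)
  | @lift_comp x₁ x₂ x₃ f g y₁ y₂ y₃ h₁ h₂ h₃ =>
    rw [Functor.map_comp, lift_liftPath, lift_liftPath, lift_liftPath]
    exact congrArg Quiver.Hom.op
      (Sh.Hom.comp'_comp _ _ _ (ξ.map_comp g.op f.op) _ _ _ h₁ h₂ h₃).symm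
  | @square x₁ x₂ f y₁ y₂ k =>
    rw [Functor.map_comp, Functor.map_comp, lift_liftPath, lift_liftPath, lift_fibPath,
      lift_fibPath]
    refine congrArg Quiver.Hom.op ?_
    change ((ξ.obj (op x₂)).sheaf.map (𝟙 _) ≫ (ξ.map f.op).map.app (op y₂)) ≫ _ =
      _ ≫ ((ξ.obj (op x₂)).sheaf.map (𝟙 _) ≫ (ξ.map f.op).map.app (op y₁))
    rw [CategoryTheory.Functor.map_id, CategoryTheory.Functor.map_id, Category.id_comp,
      Category.id_comp]
    exact ((ξ.map f.op).map.naturality k.op).symm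

/-- The total sheaf `(E, F)` of a bundle, as an object of `Sh`. -/
def totalSheaf : Sh R where
  cat := ξ.Total
  sheaf := (CategoryTheory.Quotient.lift ξ.Rel (Paths.lift ξ.sheafOnSimple)
    (fun _ _ p q h => ξ.sheafOnSimple_rel p q h)).leftOp

/-! ### The two sheaves on the base -/

/-- The `q`-cochain sheaf `S^q` on `B`. -/
def cochainSheaf (q : ℕ) : Bᵒᵖ ⥤ ModuleCat.{u} R :=
  ξ ⋙ Sh.cochainComplex ⋙ HomologicalComplex.eval _ _ q

/-- The cohomology of the fibres sheaf `H^q_fib(ξ)` on `B`, `x ↦ H^q(E_x, F_x)`. -/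
noncomputable def fibreCohomology (q : ℕ) : Bᵒᵖ ⥤ ModuleCat.{u} R :=
  ξ ⋙ Sh.cohomology R q

/-! ### The bicomplex and its total complex -/

/-- The pair `(B, S^q)`. -/
def row (q : ℕ) : Sh R where
  cat := B
  sheaf := ξ.cochainSheaf q

/-- The morphism `(B, S^q) ⟶ (B, S^{q+1})` given by the identity functor of `B` and the
differentials of the complexes `S^*(E_x, F_x)`. -/
def rowHom (q : ℕ) : ξ.row q ⟶ ξ.row (q + 1) where
  base := 𝟭 B
  map :=
    { app := fun x => (Sh.cochainComplex.obj (ξ.obj x)).d q (q + 1)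
      naturality := fun _ _ f => (Sh.cochainComplex.map (ξ.map f)).comm q (q + 1) }

/-- `K^{p,q} = S^p(B, S^q)`. -/
def bicomplex (p q : ℕ) : ModuleCat.{u} R :=
  (Sh.cochainComplex.obj (ξ.row q)).X p

/-- The horizontal differential, without sign. -/
def dHor (p q : ℕ) : ξ.bicomplex p q ⟶ ξ.bicomplex (p + 1) q :=
  (Sh.cochainComplex.obj (ξ.row q)).d p (p + 1)

/-- The vertical differential, without sign. -/
def dVert (p q : ℕ) : ξ.bicomplex p q ⟶ ξ.bicomplex p (q + 1) :=
  (Sh.cochainComplex.map (ξ.rowHom q)).f p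

lemma dHor_dHor (p q : ℕ) : ξ.dHor p q ≫ ξ.dHor (p + 1) q = 0 :=
  (Sh.cochainComplex.obj (ξ.row q)).d_comp_d _ _ _

lemma dVert_dVert (p q : ℕ) : ξ.dVert p q ≫ ξ.dVert p (q + 1) = 0 := by
  ext u
  funext σ
  exact ConcreteCategory.congr_hom
    ((Sh.cochainComplex.obj (ξ.obj (op (σ.obj 0)))).d_comp_d q (q + 1) (q + 2)) (u σ)

lemma dHor_dVert (p q : ℕ) :
    ξ.dHor p q ≫ ξ.dVert (p + 1) q = ξ.dVert p q ≫ ξ.dHor p (q + 1) :=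
  ((Sh.cochainComplex.map (ξ.rowHom q)).comm p (p + 1)).symm

/-- `T^n`, the sum of the `K^{p,q}` with `p + q = n`. -/
abbrev TotObj (n : ℕ) : Type u :=
  ∀ a : {a : ℕ × ℕ // a.1 + a.2 = n}, ξ.bicomplex a.1.1 a.1.2

/-- The component of an element of `T^n` in `K^{p,q}`. -/
def totProj (n p q : ℕ) (h : p + q = n) : ξ.TotObj n →ₗ[R] ξ.bicomplex p q where
  toFun u := u ⟨(p, q), h⟩
  map_add' _ _ := rfl
  map_smul' _ _ := rfl

/-- The component of the horizontal differential `T^n ⟶ T^{n+1}` in `K^{p,q}`. -/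
def totHor (n : ℕ) : ∀ p q : ℕ, p + q = n + 1 → (ξ.TotObj n →ₗ[R] ξ.bicomplex p q)
  | 0, _, _ => 0
  | p + 1, q, h => LinearMap.comp (ξ.dHor p q).hom (ξ.totProj n p q (by lia))

/-- The component of the vertical differential `T^n ⟶ T^{n+1}` in `K^{p,q}`, without sign. -/
def totVert (n : ℕ) : ∀ p q : ℕ, p + q = n + 1 → (ξ.TotObj n →ₗ[R] ξ.bicomplex p q)
  | _, 0, _ => 0
  | p, q + 1, h => LinearMap.comp (ξ.dVert p q).hom (ξ.totProj n p q (by lia))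

/-- The differential of the total complex; its component in `K^{p,q}` is the sum of the horizontal
differential and of `(-1)^(p+q)` times the vertical one. -/
def totD (n : ℕ) : ξ.TotObj n →ₗ[R] ξ.TotObj (n + 1) :=
  LinearMap.pi fun a =>
    ξ.totHor n a.1.1 a.1.2 a.2 + (-1 : R) ^ (a.1.1 + a.1.2) • ξ.totVert n a.1.1 a.1.2 a.2

lemma dHor_totHor (n p q : ℕ) (h : p + q = n + 1) (u : ξ.TotObj n) :
    ξ.dHor p q (ξ.totHor n p q h u) = 0 := by
  cases p with
  | zero => exact map_zero (ξ.dHor 0 q).hom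
  | succ p => exact ConcreteCategory.congr_hom (ξ.dHor_dHor p q) _

lemma dVert_totVert (n p q : ℕ) (h : p + q = n + 1) (u : ξ.TotObj n) :
    ξ.dVert p q (ξ.totVert n p q h u) = 0 := by
  cases q with
  | zero => exact map_zero (ξ.dVert p 0).hom
  | succ q => exact ConcreteCategory.congr_hom (ξ.dVert_dVert p q) _

lemma totHor_totD (n p q : ℕ) (h : p + 1 + q = n + 1 + 1) (u : ξ.TotObj n) :
    ξ.totHor (n + 1) (p + 1) q h (ξ.totD n u) =
      (-1 : R) ^ (p + q) • ξ.dHor p q (ξ.totVert n p q (by lia) u) := by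
  have h1 : p + q = n + 1 := by lia
  change (ξ.dHor p q).hom (ξ.totHor n p q h1 u + (-1 : R) ^ (p + q) • ξ.totVert n p q h1 u) = _
  rw [map_add, map_smul]
  exact (congrArg (· + _) (ξ.dHor_totHor n p q h1 u)).trans (zero_add _)

lemma totVert_totD (n p q : ℕ) (h : p + (q + 1) = n + 1 + 1) (u : ξ.TotObj n) :
    ξ.totVert (n + 1) p (q + 1) h (ξ.totD n u) =
      ξ.dVert p q (ξ.totHor n p q (by lia) u) := by
  have h1 : p + q = n + 1 := by lia
  change (ξ.dVert p q).hom (ξ.totHor n p q h1 u + (-1 : R) ^ (p + q) • ξ.totVert n p q h1 u) = _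
  rw [map_add, map_smul]
  refine (congrArg (fun v => _ + (-1 : R) ^ (p + q) • v) (ξ.dVert_totVert n p q h1 u)).trans ?_
  rw [smul_zero, add_zero]

lemma totD_totD (n : ℕ) (u : ξ.TotObj n) : ξ.totD (n + 1) (ξ.totD n u) = 0 := by
  funext ⟨⟨p, q⟩, h⟩
  change ξ.totHor (n + 1) p q h (ξ.totD n u) +
    (-1 : R) ^ (p + q) • ξ.totVert (n + 1) p q h (ξ.totD n u) = 0
  cases p with
  | zero =>
    cases q with
    | zero => simp at h
    | succ q =>
      rw [totVert_totD]
      change 0 + _ • (ξ.dVert 0 q).hom 0 = _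
      rw [map_zero, smul_zero, add_zero]
  | succ p =>
    rw [totHor_totD]
    cases q with
    | zero =>
      change _ • (ξ.dHor p 0).hom 0 + _ • 0 = _
      rw [map_zero, smul_zero, smul_zero, add_zero]
    | succ q =>
      rw [totVert_totD]
      have hc : ξ.dVert (p + 1) q (ξ.dHor p q (u ⟨(p, q), by lia⟩)) =
          ξ.dHor p (q + 1) (ξ.dVert p q (u ⟨(p, q), by lia⟩)) :=
        ConcreteCategory.congr_hom (ξ.dHor_dVert p q) _
      change _ • ξ.dHor p (q + 1) (ξ.dVert p q (u ⟨(p, q), by lia⟩)) +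
        _ • ξ.dVert (p + 1) q (ξ.dHor p q (u ⟨(p, q), by lia⟩)) = _
      rw [hc, ← add_smul, show p + 1 + (q + 1) = p + (q + 1) + 1 by ring, pow_succ, mul_neg,
        mul_one, add_neg_cancel, zero_smul]

/-- The total complex `T^*(E, F)`. -/
def totalComplex : CochainComplex (ModuleCat.{u} R) ℕ :=
  CochainComplex.of (fun n => ModuleCat.of R (ξ.TotObj n)) (fun n => ModuleCat.ofHom (ξ.totD n))
    (fun n => by
      ext1
      exact LinearMap.ext (ξ.totD_totD n))

/-! ### Grid traversals -/

/-- The arrow of `E` (of type a) given by an arrow of a fibre. -/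
def fibArrow {x : B} {y₁ y₂ : ξ.Fib x} (k : y₁ ⟶ y₂) :
    (⟨⟨x, y₁⟩⟩ : ξ.Total) ⟶ ⟨⟨x, y₂⟩⟩ :=
  (CategoryTheory.Quotient.functor ξ.Rel).map (ξ.fibPath k)

/-- The arrow of `E` (of type b) over an arrow of the base. -/
def liftArrow {x₁ x₂ : B} (f : x₁ ⟶ x₂) (y₁ : ξ.Fib x₁) (y₂ : ξ.Fib x₂)
    (h : (ξ.push f).obj y₁ = y₂) :
    (⟨⟨x₁, y₁⟩⟩ : ξ.Total) ⟶ ⟨⟨x₂, y₂⟩⟩ :=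
  (CategoryTheory.Quotient.functor ξ.Rel).map (ξ.liftPath f y₁ y₂ h)

lemma push_comp {x₁ x₂ x₃ : B} (f : x₁ ⟶ x₂) (g : x₂ ⟶ x₃) (k : x₁ ⟶ x₃) (h : f ≫ g = k) :
    ξ.push f ⋙ ξ.push g = ξ.push k := by
  subst h
  exact congrArg Sh.Hom.base (ξ.map_comp g.op f.op).symm

lemma push_id (x : B) : ξ.push (𝟙 x) = 𝟭 _ :=
  congrArg Sh.Hom.base (ξ.map_id (op x))

lemma fibArrow_id {x : B} (y : ξ.Fib x) : ξ.fibArrow (𝟙 y) = 𝟙 _ :=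
  CategoryTheory.Quotient.sound _ (Rel.fib_id y)

lemma fibArrow_comp {x : B} {y₁ y₂ y₃ : ξ.Fib x} (k : y₁ ⟶ y₂) (l : y₂ ⟶ y₃) :
    ξ.fibArrow (k ≫ l) = ξ.fibArrow k ≫ ξ.fibArrow l :=
  (CategoryTheory.Quotient.sound _ (Rel.fib_comp k l)).symm

lemma liftArrow_id {x : B} (y : ξ.Fib x) (h : (ξ.push (𝟙 x)).obj y = y) :
    ξ.liftArrow (𝟙 x) y y h = 𝟙 _ :=
  CategoryTheory.Quotient.sound _ (Rel.lift_id y h)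

lemma liftArrow_comp {x₁ x₂ x₃ : B} (f : x₁ ⟶ x₂) (g : x₂ ⟶ x₃) (y₁ : ξ.Fib x₁)
    (y₂ : ξ.Fib x₂) (y₃ : ξ.Fib x₃) (h₁ : (ξ.push f).obj y₁ = y₂)
    (h₂ : (ξ.push g).obj y₂ = y₃) (h₃ : (ξ.push (f ≫ g)).obj y₁ = y₃) :
    ξ.liftArrow (f ≫ g) y₁ y₃ h₃ = ξ.liftArrow f y₁ y₂ h₁ ≫ ξ.liftArrow g y₂ y₃ h₂ :=
  (CategoryTheory.Quotient.sound _ (Rel.lift_comp f g y₁ y₂ y₃ h₁ h₂ h₃)).symm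

lemma fibArrow_liftArrow {D : Type u} [SmallCategory D] {x₁ x₂ : B} (f : x₁ ⟶ x₂)
    (G₁ : D ⥤ ξ.Fib x₁) (G₂ : D ⥤ ξ.Fib x₂) (hG : G₁ ⋙ ξ.push f = G₂) {d d' : D} (k : d ⟶ d') :
    ξ.fibArrow (G₁.map k) ≫ ξ.liftArrow f (G₁.obj d') (G₂.obj d') (by subst hG; rfl) =
      ξ.liftArrow f (G₁.obj d) (G₂.obj d) (by subst hG; rfl) ≫ ξ.fibArrow (G₂.map k) := by
  subst hG
  exact CategoryTheory.Quotient.sound _ (Rel.square f (G₁.map k))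

section Grid

variable {p q : ℕ} (σ : ComposableArrows B p) (τ : ComposableArrows (ξ.Fib (σ.obj 0)) q)

/-- The functor `ξ₁(x₀ ⟶ x_i)` for a chain `σ = x₀ ⟶ ⋯ ⟶ x_p`. -/
abbrev pushTo (i : Fin (p + 1)) : ξ.Fib (σ.obj 0) ⥤ ξ.Fib (σ.obj i) :=
  ξ.push (σ.map (homOfLE (Fin.zero_le i)))

lemma pushTo_push {i i' : Fin (p + 1)} (h : i ≤ i') :
    ξ.pushTo σ i ⋙ ξ.push (σ.map (homOfLE h)) = ξ.pushTo σ i' :=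
  ξ.push_comp _ _ _ (σ.map_comp _ _).symm

/-- The vertex `y_{i,j} = ξ₁(x₀ ⟶ x_i)(y_j)` of the grid of `(σ, τ)`. -/
abbrev gridObj (i : Fin (p + 1)) (j : Fin (q + 1)) : ξ.Total :=
  ⟨⟨σ.obj i, (ξ.pushTo σ i).obj (τ.obj j)⟩⟩

/-- The arrow `y_{i,j} ⟶ y_{i,j'}` of the grid. -/
def gridVert (i : Fin (p + 1)) {j j' : Fin (q + 1)} (h : j ≤ j') :
    ξ.gridObj σ τ i j ⟶ ξ.gridObj σ τ i j' :=
  ξ.fibArrow ((ξ.pushTo σ i).map (τ.map (homOfLE h)))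

/-- The arrow `y_{i,j} ⟶ y_{i',j}` of the grid. -/
def gridHor {i i' : Fin (p + 1)} (h : i ≤ i') (j : Fin (q + 1)) :
    ξ.gridObj σ τ i j ⟶ ξ.gridObj σ τ i' j :=
  ξ.liftArrow (σ.map (homOfLE h)) _ _ (Functor.congr_obj (ξ.pushTo_push σ h) (τ.obj j))

lemma gridVert_refl (i : Fin (p + 1)) (j : Fin (q + 1)) : ξ.gridVert σ τ i (le_refl j) = 𝟙 _ := by
  refine Eq.trans ?_ (ξ.fibArrow_id _)
  refine congrArg ξ.fibArrow ?_
  change (ξ.pushTo σ i).map (τ.map (𝟙 _)) = _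
  simp

lemma gridVert_trans (i : Fin (p + 1)) {j j' j'' : Fin (q + 1)} (h : j ≤ j') (h' : j' ≤ j'') :
    ξ.gridVert σ τ i (h.trans h') = ξ.gridVert σ τ i h ≫ ξ.gridVert σ τ i h' := by
  refine Eq.trans ?_ (ξ.fibArrow_comp _ _)
  refine congrArg ξ.fibArrow ?_
  rw [← Functor.map_comp, ← Functor.map_comp]
  rfl

lemma liftArrow_congr {x₁ x₂ : B} {f g : x₁ ⟶ x₂} (e : f = g) (y₁ : ξ.Fib x₁) (y₂ : ξ.Fib x₂)
    (h : (ξ.push f).obj y₁ = y₂) :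
    ξ.liftArrow f y₁ y₂ h = ξ.liftArrow g y₁ y₂ (e ▸ h) := by
  subst e
  rfl

lemma gridHor_refl (i : Fin (p + 1)) (j : Fin (q + 1)) : ξ.gridHor σ τ (le_refl i) j = 𝟙 _ :=
  (ξ.liftArrow_congr (σ.map_id i) _ _ _).trans (ξ.liftArrow_id _ _)

lemma gridHor_trans {i i' i'' : Fin (p + 1)} (h : i ≤ i') (h' : i' ≤ i'') (j : Fin (q + 1)) :
    ξ.gridHor σ τ (h.trans h') j = ξ.gridHor σ τ h j ≫ ξ.gridHor σ τ h' j :=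
  (ξ.liftArrow_congr (σ.map_comp (homOfLE h) (homOfLE h')) _ _ _).trans
    (ξ.liftArrow_comp _ _ _ _ _ _ _ _)

lemma grid_comm {i i' : Fin (p + 1)} {j j' : Fin (q + 1)} (h : i ≤ i') (h' : j ≤ j') :
    ξ.gridVert σ τ i h' ≫ ξ.gridHor σ τ h j' = ξ.gridHor σ τ h j ≫ ξ.gridVert σ τ i' h' :=
  ξ.fibArrow_liftArrow _ _ _ (ξ.pushTo_push σ h) _

/-- The chain `y_{i(0),j(0)} ⟶ ⋯ ⟶ y_{i(n),j(n)}` in the grid of `(σ, τ)`. -/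
def gridChain {n : ℕ} (i : Fin (n + 1) →o Fin (p + 1)) (j : Fin (n + 1) →o Fin (q + 1)) :
    ComposableArrows ξ.Total n where
  obj k := ξ.gridObj σ τ (i k) (j k)
  map {k l} f := ξ.gridVert σ τ (i k) (j.monotone f.le) ≫ ξ.gridHor σ τ (i.monotone f.le) (j l)
  map_id k := by
    rw [gridVert_refl, gridHor_refl, Category.id_comp]
  map_comp {k l m} f g := by
    rw [Category.assoc, ← Category.assoc (ξ.gridHor _ _ _ _), ← grid_comm, Category.assoc,
      ← gridHor_trans, ← Category.assoc, ← gridVert_trans]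

end Grid

end SheafBundle

/-- A traversal of the `(p, q)` grid: a path of `n = p + q` arrows from `(0, 0)` to `(p, q)`, each
of which is either horizontal, `(i, j) ⟶ (i + 1, j)`, or vertical, `(i, j) ⟶ (i, j + 1)`. -/
@[ext]
structure GridTraversal (n p q : ℕ) where
  i : Fin (n + 1) →o Fin (p + 1)
  j : Fin (n + 1) →o Fin (q + 1)
  start : i 0 = 0 ∧ j 0 = 0
  finish : i (Fin.last n) = Fin.last p ∧ j (Fin.last n) = Fin.last q
  step : ∀ k : Fin n,
    ((i k.succ : ℕ) = i k.castSucc + 1 ∧ j k.succ = j k.castSucc) ∨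
      (i k.succ = i k.castSucc ∧ (j k.succ : ℕ) = j k.castSucc + 1)

namespace GridTraversal

instance (n p q : ℕ) : Finite (GridTraversal n p q) :=
  Finite.of_injective
    (fun z : GridTraversal n p q => ((z.i : Fin (n + 1) → Fin (p + 1)),
      (z.j : Fin (n + 1) → Fin (q + 1))))
    (fun z z' h => by
      rw [Prod.mk.injEq] at h
      exact GridTraversal.ext (DFunLike.coe_injective h.1) (DFunLike.coe_injective h.2))

noncomputable instance (n p q : ℕ) : Fintype (GridTraversal n p q) := Fintype.ofFinite _

/-- `m(z)`, the sum of `p - i` over the vertical arrows `(i, j) ⟶ (i, j + 1)` of `z`. -/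
def weight {n p q : ℕ} (z : GridTraversal n p q) : ℕ :=
  ∑ k : Fin n, if z.j k.castSucc < z.j k.succ then p - (z.i k.castSucc : ℕ) else 0

end GridTraversal

namespace SheafBundle

variable {R : Type u} [CommRing R] {B : Type u} [SmallCategory B] (ξ : SheafBundle R B)

/-- The arrow `y₀ ⟶ y_{i,j}` in the grid of `(σ, τ)`; for `i = j = 0` it is the identity arrow. -/
def fromOrigin {p q : ℕ} (σ : ComposableArrows B p) (τ : ComposableArrows (ξ.Fib (σ.obj 0)) q)
    (i : Fin (p + 1)) (j : Fin (q + 1)) :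
    (⟨⟨σ.obj 0, τ.obj 0⟩⟩ : ξ.Total) ⟶ ξ.gridObj σ τ i j :=
  ξ.fibArrow (τ.map (homOfLE (Fin.zero_le j))) ≫
    ξ.liftArrow (σ.map (homOfLE (Fin.zero_le i))) _ _ rfl

/-- The value `u|_z` of a cochain `u` of the total sheaf at a traversal `z` of the grid of
`(σ, τ)`. It lies in the value of `F` at `y_{0,0} = ξ₁(id)(y₀) = y₀`, and is carried to
`F_{x₀}(y₀)` along the identity arrow `y₀ ⟶ y_{0,0}`. -/
def valueAt {n p q : ℕ} (z : GridTraversal n p q) (σ : ComposableArrows B p)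
    (τ : ComposableArrows (ξ.Fib (σ.obj 0)) q) :
    (∀ ρ : ComposableArrows ξ.totalSheaf.cat n, ξ.totalSheaf.sheaf.obj (op (ρ.obj 0))) →ₗ[R]
      (ξ.obj (op (σ.obj 0))).sheaf.obj (op (τ.obj 0)) :=
  LinearMap.comp (ξ.totalSheaf.sheaf.map (ξ.fromOrigin σ τ (z.i 0) (z.j 0)).op).hom
    (LinearMap.proj (ξ.gridChain σ τ z.i z.j))

/-- The grid traversal map `φ`, in degree `n`: the value of `φ(u)` at `(σ, τ)`, where
`σ = x₀ ⟶ ⋯ ⟶ x_p` is a chain of `B` and `τ = y₀ ⟶ ⋯ ⟶ y_q` a chain of `E_{x₀}`, is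
`(-1)^⌈q/2⌉ ∑_z (-1)^{m(z)} u|_z`, the sum being over all traversals of the grid of `(σ, τ)`. -/
noncomputable def traversalMap (n : ℕ) :
    (Sh.cochainComplex.obj ξ.totalSheaf).X n ⟶ ξ.totalComplex.X n :=
  ModuleCat.ofHom (LinearMap.pi fun a => LinearMap.pi fun σ => LinearMap.pi fun τ =>
    (-1 : R) ^ ((a.1.2 + 1) / 2) •
      ∑ z : GridTraversal n a.1.1 a.1.2, (-1 : R) ^ z.weight • ξ.valueAt z σ τ)

end SheafBundle

/-! ### Recursively admissible posets -/

/-- `B` is admissible for the cover `x` of its `0` (here called `o`): for each `y` with `¬ x ≤ y`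
the set `B(x, y) = {w ∣ x ≤ w, y ≤ w}` has a minimum. -/
structure AdmissibleFor {B : Type u} [PartialOrder B] (o x : B) : Prop where
  isBot : IsBot o
  covers : o ⋖ x
  exists_min : ∀ y : B, ¬ x ≤ y → ∃ m, IsLeast {w : B | x ≤ w ∧ y ≤ w} m

/-- Recursively admissible posets: `B` is boolean of rank `1`, or `B` is admissible for some
`x ≻ 0` and both `B(x) = {y ∣ x ≤ y}` and its complement are recursively admissible. (In both cases
`B` has a `0`.) -/
inductive RecursivelyAdmissible : (B : Type u) → [PartialOrder B] → Prop
  | boolean (B : Type u) [PartialOrder B] (h : Nonempty (B ≃o Bool)) : RecursivelyAdmissible B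
  | step (B : Type u) [PartialOrder B] (o x : B) (h : AdmissibleFor o x)
      (h₁ : RecursivelyAdmissible {y : B // x ≤ y})
      (h₂ : RecursivelyAdmissible {y : B // ¬ x ≤ y}) : RecursivelyAdmissible B

/-! ### Convergence of spectral sequences -/

/-- A first quadrant `E₂` cohomological spectral sequence converges to `H^*`: each `H^n` has a
decreasing filtration `H^n = Fil^0 ⊇ ⋯ ⊇ Fil^{n+1} = 0` such that, for all `p` and `q`, the
differentials into and out of `E_r^{p,q}` vanish for large `r`, and the stable value
`E_∞^{p,q} = E_r^{p,q}` is isomorphic to `Fil^p H^{p+q} / Fil^{p+1} H^{p+q}`. -/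
def ConvergesTo {R : Type u} [CommRing R]
    (E : E₂CohomologicalSpectralSequenceNat (ModuleCat.{u} R)) (H : ℕ → ModuleCat.{u} R) : Prop :=
  ∃ Fil : ∀ n : ℕ, ℕ → Submodule R (H n),
    (∀ n, Antitone (Fil n) ∧ Fil n 0 = ⊤ ∧ Fil n (n + 1) = ⊥) ∧
    ∀ p q : ℕ, ∃ r₀ : ℤ, ∀ (r : ℤ) (hr : 2 ≤ r), r₀ ≤ r →
      (∀ a : ℕ × ℕ, (E.page r hr).d (p, q) a = 0 ∧ (E.page r hr).d a (p, q) = 0) ∧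
      Nonempty ((E.page r hr).X (p, q) ≃ₗ[R]
        Fil (p + q) p ⧸ (Fil (p + q) (p + 1)).submoduleOf (Fil (p + q) p))

/-!
*Spectral sequence.* The total complex `T` of the bicomplex `K^{p,q} = S^p(B, S^q)` is filtered by
the degree `p` in the base. The spectral sequence of this filtration is constructed in terms of
elements (`CanonicallyBoundedFiltration.spectralSequence`), it converges to the cohomology of `T`
(`CanonicallyBoundedFiltration.convergesTo`), and its second page is the cohomology of `B` with
coefficients in the fibre cohomology (`SheafBundle.nonempty_page_two_equiv`). The first assertion
therefore follows from the second one, which identifies the cohomology of `T` with that of the total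
sheaf.

*The map `φ`.* That `φ` commutes with the differentials is an identity for signed sums over grid
paths (`GridPath.signedSum_boundary`): the faces of a path that omit a turning point cancel in
pairs, and the remaining faces make up the faces of the two sides of the grid.

*Quasi-isomorphism.* The map `φ` is defined for any sheaf `G` on the total category `E`, with the
bundle `ξ.restrict G` of the restrictions of `G` to the fibres in place of `ξ`, and is natural
in `G`. In degree zero both cohomologies consist of the families of elements compatible with all
arrows of `E`. For higher degrees embed `G` in the coinduced sheaf `I(y) = ∏_{z ⟶ y} G(z)` and shift
dimensions along `0 ⟶ G ⟶ I ⟶ I / G ⟶ 0`; this needs that both cohomologies of `I` vanish in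
positive degrees. Each arrow of `E` is in a unique way an arrow over the base followed by an arrow
of a fibre (`SheafBundle.arrow_normalForm`, `SheafBundle.normalForm_arrow`). Hence `I` is
coinduced not only on `E` but also on each fibre, and its sections over the fibres form a
coinduced sheaf on `B`. As coinduced sheaves are acyclic (`Sh.Coinduced.exists_diff_eq`), the
second page for `I` vanishes outside the origin, and with it the cohomology of the total complex
in positive degrees (`SheafBundle.homologyMap_traversalHom_bijective`). For the total sheaf of `ξ`
the bundle `ξ.restrict G` is `ξ` up to isomorphism (`SheafBundle.quasiIso_totalTraversalHom`).
-/

/-! ### Homology of complexes of modules, in terms of elements -/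

namespace HomologicalComplex

variable {R : Type u} [CommRing R] {κ : Type*} {c : ComplexShape κ}
  (K : HomologicalComplex (ModuleCat.{u} R) c)

/-- The submodule of cycles in degree `i`. -/
noncomputable def cycleSubmodule (i : κ) : Submodule R (K.X i) :=
  LinearMap.ker (K.d i (c.next i)).hom

variable {K} in
lemma mem_cycleSubmodule {i : κ} {x : K.X i} : x ∈ K.cycleSubmodule i ↔ ∀ j, K.d i j x = 0 := by
  refine ⟨fun h j => ?_, fun h => h _⟩
  by_cases hj : c.Rel i j
  · obtain rfl := c.next_eq' hj
    exact h
  · rw [K.shape _ _ hj]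
    rfl

lemma d_d_apply {i j k : κ} (x : K.X i) : K.d j k (K.d i j x) = 0 :=
  ConcreteCategory.congr_hom (K.d_comp_d i j k) x

/-- The homology class of a cycle. -/
noncomputable def homologyClass (i : κ) : K.cycleSubmodule i →ₗ[R] K.homology i :=
  (K.homologyπ i).hom ∘ₗ (K.sc i).moduleCatCyclesIso.inv.hom

lemma homologyClass_surjective (i : κ) : Function.Surjective (K.homologyClass i) := by
  have h1 : Function.Surjective (K.homologyπ i) :=
    (ModuleCat.epi_iff_surjective _).1 inferInstance
  have h2 : Function.Surjective (K.sc i).moduleCatCyclesIso.inv :=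
    (ModuleCat.epi_iff_surjective _).1 inferInstance
  exact h1.comp h2

variable {K} in
lemma homologyClass_eq_zero_iff {i : κ} (x : K.cycleSubmodule i) :
    K.homologyClass i x = 0 ↔ ∃ j y, K.d j i y = x := by
  have h0 : K.homologyClass i x =
      (K.sc i).moduleCatHomologyIso.inv ((K.sc i).moduleCatLeftHomologyData.π x) :=
    ConcreteCategory.congr_hom (K.sc i).moduleCatCyclesIso_inv_π x
  have h1 : Function.Injective (K.sc i).moduleCatHomologyIso.inv :=
    (ModuleCat.mono_iff_injective _).1 inferInstance
  have h2 : K.homologyClass i x = 0 ↔ (K.sc i).moduleCatLeftHomologyData.π x = 0 := by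
    rw [h0]
    exact map_eq_zero_iff (K.sc i).moduleCatHomologyIso.inv.hom h1
  rw [h2]
  refine (Submodule.Quotient.mk_eq_zero _).trans ⟨?_, ?_⟩
  · rintro ⟨y, rfl⟩
    exact ⟨_, y, rfl⟩
  · rintro ⟨j, y, hy⟩
    by_cases hj : c.Rel j i
    · obtain rfl := c.prev_eq' hj
      exact ⟨y, Subtype.ext hy⟩
    · rw [K.shape _ _ hj] at hy
      have hx : x = 0 := Subtype.ext hy.symm
      rw [hx]
      exact zero_mem _

variable {K} in
lemma map_mem_cycleSubmodule {L : HomologicalComplex (ModuleCat.{u} R) c} (φ : K ⟶ L) {i : κ}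
    {x : K.X i} (hx : x ∈ K.cycleSubmodule i) : φ.f i x ∈ L.cycleSubmodule i :=
  mem_cycleSubmodule.2 fun j => by
    have h := ConcreteCategory.congr_hom (φ.comm i j) x
    refine h.trans ?_
    change φ.f j (K.d i j x) = 0
    rw [mem_cycleSubmodule.1 hx j]
    exact map_zero (φ.f j).hom

lemma homologyMap_homologyClass {L : HomologicalComplex (ModuleCat.{u} R) c} (φ : K ⟶ L) (i : κ)
    (x : K.cycleSubmodule i) :
    homologyMap φ i (K.homologyClass i x) =
      L.homologyClass i ⟨φ.f i x, map_mem_cycleSubmodule φ x.2⟩ := by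
  have h1 := ConcreteCategory.congr_hom (homologyπ_naturality φ i)
    ((K.sc i).moduleCatCyclesIso.inv x)
  refine h1.trans ?_
  change L.homologyπ i _ = L.homologyπ i _
  congr 1
  have h2 : Function.Injective (L.iCycles i) := (ModuleCat.mono_iff_injective _).1 inferInstance
  apply h2
  have h3 := ConcreteCategory.congr_hom (cyclesMap_i φ i) ((K.sc i).moduleCatCyclesIso.inv x)
  refine h3.trans ?_
  have h4 := ConcreteCategory.congr_hom ((K.sc i).moduleCatCyclesIso_inv_iCycles) x
  have h5 := ConcreteCategory.congr_hom ((L.sc i).moduleCatCyclesIso_inv_iCycles)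
    (⟨φ.f i x, map_mem_cycleSubmodule φ x.2⟩ : L.cycleSubmodule i)
  exact (congrArg (φ.f i) h4).trans h5.symm

/-- A module of representatives `M`, mapped to a complex by `f`, whose elements go to cycles and
represent all cycles up to boundaries, has the homology of the complex as its quotient by the
submodule of the elements that go to boundaries. -/
lemma nonempty_quotient_equiv_homology {i : κ} {M : Type u} [AddCommGroup M] [Module R M]
    (f : M →ₗ[R] K.X i) (N : Submodule R M) (h₁ : ∀ m j, K.d i j (f m) = 0)
    (h₂ : ∀ x, (∀ j, K.d i j x = 0) → ∃ m j y, x = f m + K.d j i y)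
    (h₃ : ∀ m, m ∈ N ↔ ∃ j y, K.d j i y = f m) :
    Nonempty ((M ⧸ N) ≃ₗ[R] K.homology i) := by
  let g : M →ₗ[R] K.homology i :=
    K.homologyClass i ∘ₗ f.codRestrict _ fun m => mem_cycleSubmodule.2 (h₁ m)
  have hg : LinearMap.ker g = N := by
    ext m
    rw [h₃]
    exact homologyClass_eq_zero_iff _
  have hs : Function.Surjective g := fun y => by
    obtain ⟨x, rfl⟩ := K.homologyClass_surjective i y
    obtain ⟨m, j, y, hy⟩ := h₂ x (mem_cycleSubmodule.1 x.2)
    refine ⟨m, ?_⟩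
    rw [← sub_eq_zero]
    refine (map_sub (K.homologyClass i) _ _).symm.trans
      ((homologyClass_eq_zero_iff _).2 ⟨j, -y, ?_⟩)
    change (K.d j i).hom (-y) = f m - x
    rw [map_neg, hy]
    change _ = f m - (f m + (K.d j i).hom y)
    abel
  exact ⟨(Submodule.quotEquivOfEq _ _ hg.symm).trans (g.quotKerEquivOfSurjective hs)⟩

end HomologicalComplex

namespace CochainComplex

variable {R : Type u} [CommRing R] {K : CochainComplex (ModuleCat.{u} R) ℕ}

lemma mem_cycleSubmodule_iff {n : ℕ} {x : K.X n} :
    x ∈ K.cycleSubmodule n ↔ K.d n (n + 1) x = 0 := by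
  refine HomologicalComplex.mem_cycleSubmodule.trans ⟨fun h => h _, fun h j => ?_⟩
  by_cases hj : n + 1 = j
  · subst hj
    exact h
  · rw [K.shape _ _ hj]
    rfl

lemma homologyClass_succ_eq_zero_iff {n : ℕ} (x : K.cycleSubmodule (n + 1)) :
    K.homologyClass (n + 1) x = 0 ↔ ∃ y, K.d n (n + 1) y = x := by
  refine (HomologicalComplex.homologyClass_eq_zero_iff x).trans
    ⟨?_, fun ⟨y, hy⟩ => ⟨n, y, hy⟩⟩
  rintro ⟨j, y, hy⟩
  by_cases hj : j + 1 = n + 1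
  · obtain rfl : j = n := by lia
    exact ⟨y, hy⟩
  · rw [K.shape _ _ hj] at hy
    exact ⟨0, (map_zero (K.d n (n + 1)).hom).trans hy⟩

lemma homologyClass_zero_injective : Function.Injective (K.homologyClass 0) := by
  rw [injective_iff_map_eq_zero]
  intro x hx
  obtain ⟨j, y, hy⟩ := (HomologicalComplex.homologyClass_eq_zero_iff x).1 hx
  rw [K.shape _ _ (by simp)] at hy
  exact Subtype.ext hy.symm

lemma subsingleton_homology_of_exactAt {n : ℕ} (h : K.ExactAt n) : Subsingleton (K.homology n) := by
  rwa [HomologicalComplex.exactAt_iff_isZero_homology, ModuleCat.isZero_iff_subsingleton] at h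

end CochainComplex

/-! ### The spectral sequence of a filtered complex -/

/-- A decreasing filtration of a cochain complex of modules by subcomplexes `fil p`, which is all of
the complex for `p = 0` and vanishes in degree `n` for `p > n`. -/
structure CanonicallyBoundedFiltration {R : Type u} [CommRing R]
    (K : CochainComplex (ModuleCat.{u} R) ℕ) where
  fil (p n : ℕ) : Submodule R (K.X n)
  anti (n : ℕ) : Antitone fun p => fil p n
  fil_zero (n : ℕ) : fil 0 n = ⊤
  fil_eq_bot (p n : ℕ) (h : n < p) : fil p n = ⊥
  d_mem (p n m : ℕ) (x : K.X n) (hx : x ∈ fil p n) : K.d n m x ∈ fil p m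

namespace CanonicallyBoundedFiltration

variable {R : Type u} [CommRing R] {K : CochainComplex (ModuleCat.{u} R) ℕ}
  (F : CanonicallyBoundedFiltration K)

/-- The elements of filtration `p` in degree `n` whose differential has filtration `p + r`. -/
def approxCycles (r p n : ℕ) : Submodule R (K.X n) :=
  F.fil p n ⊓ (F.fil (p + r) (n + 1)).comap (K.d n (n + 1)).hom

/-- The elements of filtration `p` in degree `n` that are differentials of elements of filtration
`p + 1 - r`. The truncated subtraction is harmless, as `fil 0` is the whole complex. -/
def approxBoundaries (r p n : ℕ) : Submodule R (K.X n) :=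
  F.fil p n ⊓ (F.fil (p + 1 - r) (n - 1)).map (K.d (n - 1) n).hom

/-- The submodule whose classes vanish in `E_r`. -/
def denominator (r p n : ℕ) : Submodule R (K.X n) :=
  F.approxCycles (r - 1) (p + 1) n ⊔ F.approxBoundaries r p n

variable {F}

lemma mem_approxCycles {r p n : ℕ} {x : K.X n} :
    x ∈ F.approxCycles r p n ↔ x ∈ F.fil p n ∧ K.d n (n + 1) x ∈ F.fil (p + r) (n + 1) :=
  Iff.rfl

lemma mem_approxBoundaries {r p n : ℕ} {x : K.X n} :
    x ∈ F.approxBoundaries r p n ↔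
      x ∈ F.fil p n ∧ ∃ m, ∃ y ∈ F.fil (p + 1 - r) m, K.d m n y = x := by
  refine and_congr_right fun hx => ⟨fun ⟨y, hy, h⟩ => ⟨_, y, hy, h⟩, ?_⟩
  rintro ⟨m, y, hy, h⟩
  by_cases hm : m + 1 = n
  · subst hm
    exact ⟨y, hy, h⟩
  · rw [K.shape _ _ hm] at h
    exact ⟨0, zero_mem _, (map_zero (K.d (n - 1) n).hom).trans h⟩

lemma mem_denominator {r p n : ℕ} {x : K.X n} :
    x ∈ F.denominator r p n ↔ ∃ a ∈ F.approxCycles (r - 1) (p + 1) n, ∃ m,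
      ∃ y ∈ F.fil (p + 1 - r) m, K.d m n y ∈ F.fil p n ∧ x = a + K.d m n y := by
  refine Submodule.mem_sup.trans ⟨?_, ?_⟩
  · rintro ⟨a, ha, b, hb, rfl⟩
    obtain ⟨hb', m, y, hy, rfl⟩ := mem_approxBoundaries.1 hb
    exact ⟨a, ha, m, y, hy, hb', rfl⟩
  · rintro ⟨a, ha, m, y, hy, hb, rfl⟩
    exact ⟨a, ha, _, mem_approxBoundaries.2 ⟨hb, m, y, hy, rfl⟩, rfl⟩

lemma d_d (l m n : ℕ) (x : K.X l) : (K.d m n).hom ((K.d l m).hom x) = 0 := K.d_d_apply x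

lemma fil_le {p p' n : ℕ} (h : p ≤ p') {x : K.X n} (hx : x ∈ F.fil p' n) : x ∈ F.fil p n :=
  F.anti n h hx

variable (F) in
lemma mem_fil_zero {p n : ℕ} (hp : p = 0) (x : K.X n) : x ∈ F.fil p n := by
  rw [hp, F.fil_zero]
  trivial

lemma eq_zero_of_mem_fil {p n : ℕ} (h : n < p) {x : K.X n} (hx : x ∈ F.fil p n) : x = 0 := by
  rw [F.fil_eq_bot p n h] at hx
  exact hx

variable (F) in
/-- The module `E_r^{p,q}`, with `n = p + q`. -/
abbrev Page (r p n : ℕ) : Type u :=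
  F.approxCycles r p n ⧸ (F.denominator r p n).submoduleOf (F.approxCycles r p n)

/-- The class in `E_r` of an approximate cycle. -/
def pageMk {r p n : ℕ} (x : K.X n) (hx : x ∈ F.approxCycles r p n) : F.Page r p n :=
  Submodule.Quotient.mk ⟨x, hx⟩

lemma pageMk_eq_zero_iff {r p n : ℕ} {x : K.X n} (hx : x ∈ F.approxCycles r p n) :
    pageMk x hx = 0 ↔ x ∈ F.denominator r p n :=
  Submodule.Quotient.mk_eq_zero _

lemma exists_pageMk {r p n : ℕ} (y : F.Page r p n) :
    ∃ (x : K.X n) (hx : x ∈ F.approxCycles r p n), y = pageMk x hx := by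
  obtain ⟨⟨x, hx⟩, rfl⟩ := Submodule.Quotient.mk_surjective _ y
  exact ⟨x, hx, rfl⟩

lemma d_mem_approxCycles {r p p' n n' : ℕ} (hp : p + r = p') (hn : n + 1 = n') {x : K.X n}
    (hx : x ∈ F.approxCycles r p n) : K.d n n' x ∈ F.approxCycles r p' n' := by
  subst hp hn
  refine ⟨hx.2, ?_⟩
  change (K.d _ (n + 1 + 1)).hom ((K.d _ (n + 1)).hom x) ∈ F.fil _ _
  rw [d_d]
  exact zero_mem _

lemma d_mem_denominator {r p p' n n' : ℕ} (hr : 1 ≤ r) (hp : p + r = p') (hn : n + 1 = n')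
    {x : K.X n} (hx : x ∈ F.denominator r p n) : K.d n n' x ∈ F.denominator r p' n' := by
  obtain ⟨a, ha, m, y, hy, hb, rfl⟩ := mem_denominator.1 hx
  have h : K.d n n' (a + K.d m n y) = K.d n n' a := by
    change (K.d _ _).hom (a + (K.d _ _).hom y) = (K.d _ _).hom a
    rw [map_add, d_d, add_zero]
  rw [h]
  subst hn
  refine mem_denominator.2 ⟨0, zero_mem _, n, a, fil_le (by lia) ha.1, fil_le (by lia) ha.2,
    (zero_add _).symm⟩

/-- A cycle of `E_r` is represented by an approximate cycle of order `r + 1`. -/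
lemma exists_sub_mem_approxCycles_succ {r p p' n n' : ℕ} (hr : 1 ≤ r) (hp : p + r = p')
    (hn : n + 1 = n') {x : K.X n} (hx : x ∈ F.approxCycles r p n)
    (h : K.d n n' x ∈ F.denominator r p' n') :
    ∃ z ∈ F.denominator r p n, x - z ∈ F.approxCycles (r + 1) p n := by
  subst hp hn
  obtain ⟨b, hb, m, z, hz, hdz, h4⟩ := mem_denominator.1 h
  -- the correction `z` may be taken in degree `n`
  obtain ⟨z, hz, hdz, h4⟩ : ∃ z ∈ F.fil (p + 1) n, K.d n (n + 1) z ∈ F.fil (p + r) (n + 1) ∧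
      K.d n (n + 1) x = b + K.d n (n + 1) z := by
    by_cases hm : m = n
    · subst hm
      exact ⟨z, fil_le (by lia) hz, hdz, h4⟩
    · have h0 : K.d m (n + 1) z = (K.d n (n + 1)).hom 0 := by
        rw [K.shape m _ (by simpa using hm), map_zero]
        rfl
      rw [h0] at h4 hdz
      exact ⟨0, zero_mem _, hdz, h4⟩
  refine ⟨z, Submodule.mem_sup_left ⟨hz, fil_le (by lia) hdz⟩,
    sub_mem hx.1 (fil_le (by lia) hz), ?_⟩
  have h5 : (K.d n (n + 1)).hom (x - z) = b := by
    rw [map_sub]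
    exact sub_eq_of_eq_add h4
  change (K.d n (n + 1)).hom (x - z) ∈ F.fil _ _
  rw [h5]
  exact fil_le (by lia) hb.1

/-- An approximate cycle of order `r + 1` in the denominator of `E_{r+1}` represents zero or a
boundary of `E_r`. -/
lemma mem_denominator_of_mem_succ {r p n : ℕ} {x : K.X n}
    (hx : x ∈ F.denominator (r + 1) p n) (hx' : x ∈ F.approxCycles (r + 1) p n) :
    x ∈ F.denominator r p n ∨ ∃ p₀ n₀, p₀ + r = p ∧ n₀ + 1 = n ∧
      ∃ w ∈ F.approxCycles r p₀ n₀, x - K.d n₀ n w ∈ F.denominator r p n := by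
  obtain ⟨a, ha, m, w, hw, hdw, h⟩ := mem_denominator.1 hx
  have ha' : a ∈ F.approxCycles (r - 1) (p + 1) n := ⟨ha.1, fil_le (by lia) ha.2⟩
  by_cases hm : m + 1 = n
  · by_cases hp : r ≤ p
    · refine Or.inr ⟨p - r, m, by lia, hm, w, ⟨fil_le (by lia) hw, ?_⟩, ?_⟩
      · subst hm
        exact fil_le (by lia) hdw
      · rw [h]
        have : a + K.d m n w - K.d m n w = a := add_sub_cancel_right _ _
        rw [this]
        exact Submodule.mem_sup_left ha'
    · exact Or.inl (mem_denominator.2 ⟨a, ha', m, w, mem_fil_zero F (by lia) _, hdw, h⟩)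
  · refine Or.inl ?_
    rw [K.shape _ _ hm] at h
    have : x = a := h.trans (add_zero a)
    rw [this]
    exact Submodule.mem_sup_left ha'

lemma mem_denominator_succ_of_mem {r p n : ℕ} {x : K.X n}
    (hx : x ∈ F.denominator r p n) (hx' : x ∈ F.approxCycles (r + 1) p n) :
    x ∈ F.denominator (r + 1) p n := by
  obtain ⟨a, ha, m, w, hw, hdw, h⟩ := mem_denominator.1 hx
  refine mem_denominator.2 ⟨a, ⟨ha.1, ?_⟩, m, w, fil_le (by lia) hw, hdw, h⟩
  have h1 : (K.d n (n + 1)).hom a = (K.d n (n + 1)).hom x := by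
    rw [h, map_add]
    refine (add_zero _).symm.trans (congrArg _ (d_d m n _ w).symm)
  change (K.d n (n + 1)).hom a ∈ F.fil _ _
  rw [h1]
  exact fil_le (by lia) hx'.2

/-- An approximate cycle of order `r + 1` that represents a boundary of `E_r` is in the denominator
of `E_{r+1}`. -/
lemma mem_denominator_succ_of_sub_mem {r p p₀ n₀ n : ℕ} (hp : p₀ + r = p)
    (hn : n₀ + 1 = n) {x : K.X n} {w : K.X n₀} (hw : w ∈ F.approxCycles r p₀ n₀)
    (hx : x - K.d n₀ n w ∈ F.denominator r p n) (hx' : x ∈ F.approxCycles (r + 1) p n) :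
    x ∈ F.denominator (r + 1) p n := by
  have h1 : K.d n₀ n w ∈ F.approxCycles (r + 1) p n := by
    subst hp hn
    refine ⟨hw.2, ?_⟩
    change (K.d _ (n₀ + 1 + 1)).hom ((K.d _ (n₀ + 1)).hom w) ∈ F.fil _ _
    rw [d_d]
    exact zero_mem _
  have h2 := add_mem (mem_denominator_succ_of_mem hx (sub_mem hx' h1)) (Submodule.mem_sup_right
    (mem_approxBoundaries.2 ⟨h1.1, n₀, w, fil_le (by lia) hw.1, rfl⟩))
  rwa [sub_add_cancel] at h2

/-- Elements of order `r + 1` represent cycles of `E_r`. -/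
lemma d_mem_denominator_of_mem_succ {r p p' n n' : ℕ} (hp : p + r = p') (hn : n + 1 = n')
    {x : K.X n} (hx : x ∈ F.approxCycles (r + 1) p n) : K.d n n' x ∈ F.denominator r p' n' := by
  subst hp hn
  refine Submodule.mem_sup_left ⟨fil_le (by lia) hx.2, ?_⟩
  change (K.d _ (n + 1 + 1)).hom ((K.d _ _).hom x) ∈ F.fil _ _
  rw [d_d]
  exact zero_mem _

variable (F) in
/-- The differential `E_r^{p,q} → E_r^{p+r,q+1-r}`. -/
def pageD {r p p' n n' : ℕ} (hr : 1 ≤ r) (hp : p + r = p') (hn : n + 1 = n') :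
    F.Page r p n →ₗ[R] F.Page r p' n' :=
  Submodule.mapQ _ _ ((K.d n n').hom.restrict fun _ hx => d_mem_approxCycles hp hn hx)
    fun _ hx => d_mem_denominator hr hp hn hx

variable (F) in
open Classical in
/-- The complex `E_r`. A differential is nonzero only if its degree condition makes sense in `ℕ`. -/
noncomputable def pageComplex (r : ℤ) (hr : 2 ≤ r) :
    HomologicalComplex (ModuleCat.{u} R) (ComplexShape.spectralSequenceNat ⟨r, 1 - r⟩) where
  X a := ModuleCat.of R (F.Page r.toNat a.1 (a.1 + a.2))
  d a b := if h : a.1 + r.toNat = b.1 ∧ a.1 + a.2 + 1 = b.1 + b.2 then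
      ModuleCat.ofHom (F.pageD (by lia) h.1 h.2) else 0
  shape a b h := by
    rw [dif_neg]
    rintro ⟨h1, h2⟩
    exact h ⟨by dsimp only; lia, by dsimp only; lia⟩
  d_comp_d' a b c h h' := by
    obtain ⟨h1, h2⟩ := h
    obtain ⟨h3, h4⟩ := h'
    dsimp only at h1 h2 h3 h4
    rw [dif_pos ⟨by lia, by lia⟩, dif_pos ⟨by lia, by lia⟩]
    refine ModuleCat.hom_ext (LinearMap.ext fun y => ?_)
    obtain ⟨x, hx, rfl⟩ := exists_pageMk (F := F) y
    refine (pageMk_eq_zero_iff _).2 ?_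
    change (K.d _ _).hom ((K.d _ _).hom x) ∈ F.denominator _ _ _
    rw [d_d]
    exact zero_mem _

lemma pageComplex_d {r : ℤ} (hr : 2 ≤ r) {a b : ℕ × ℕ} (h₁ : a.1 + r.toNat = b.1)
    (h₂ : a.1 + a.2 + 1 = b.1 + b.2) {x : K.X (a.1 + a.2)}
    (hx : x ∈ F.approxCycles r.toNat a.1 (a.1 + a.2)) :
    (F.pageComplex r hr).d a b (pageMk x hx) =
      (pageMk (K.d _ _ x) (d_mem_approxCycles h₁ h₂ hx) :
        F.Page r.toNat b.1 (b.1 + b.2)) := by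
  have h : (F.pageComplex r hr).d a b = ModuleCat.ofHom (F.pageD (by lia) h₁ h₂) :=
    dif_pos ⟨h₁, h₂⟩
  rw [h]
  rfl

lemma pageComplex_d_eq_zero {r : ℤ} (hr : 2 ≤ r) {a b : ℕ × ℕ}
    (h : ¬ (a.1 + r.toNat = b.1 ∧ a.1 + a.2 + 1 = b.1 + b.2)) :
    (F.pageComplex r hr).d a b = 0 :=
  dif_neg h

lemma approxCycles_succ_le (r p n : ℕ) : F.approxCycles (r + 1) p n ≤ F.approxCycles r p n :=
  fun _ hx => ⟨hx.1, fil_le (by lia) hx.2⟩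

/-- The passage from `E_r` to `E_{r+1}`: an approximate cycle of order `r + 1` gives a cycle of
`E_r`. -/
lemma nonempty_page_succ_equiv_homology (r : ℤ) (hr : 2 ≤ r) (a : ℕ × ℕ) :
    Nonempty (F.Page (r.toNat + 1) a.1 (a.1 + a.2) ≃ₗ[R] (F.pageComplex r hr).homology a) := by
  have hr1 : 1 ≤ r.toNat := by lia
  let f : F.approxCycles (r.toNat + 1) a.1 (a.1 + a.2) →ₗ[R] (F.pageComplex r hr).X a :=
    Submodule.mkQ _ ∘ₗ Submodule.inclusion (approxCycles_succ_le _ _ _)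
  have hf : ∀ m, f m = (pageMk m.1 (approxCycles_succ_le _ _ _ m.2) :
    F.Page r.toNat a.1 (a.1 + a.2)) := fun _ => rfl
  refine (F.pageComplex r hr).nonempty_quotient_equiv_homology f _ ?_ ?_ ?_
  · rintro ⟨x, hx⟩ b
    by_cases h : a.1 + r.toNat = b.1 ∧ a.1 + a.2 + 1 = b.1 + b.2
    · refine (pageComplex_d hr h.1 h.2 _).trans ((pageMk_eq_zero_iff _).2
        (d_mem_denominator_of_mem_succ h.1 h.2 hx))
    · rw [pageComplex_d_eq_zero hr h]
      rfl
  · intro y hy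
    obtain ⟨x, hx, rfl⟩ := exists_pageMk (F := F) y
    obtain ⟨z, hz, hxz⟩ : ∃ z ∈ F.denominator r.toNat a.1 (a.1 + a.2),
        x - z ∈ F.approxCycles (r.toNat + 1) a.1 (a.1 + a.2) := by
      by_cases h : r.toNat ≤ a.2 + 1
      · have h2 : a.1 + a.2 + 1 = (a.1 + r.toNat) + (a.2 + 1 - r.toNat) := by lia
        exact exists_sub_mem_approxCycles_succ hr1 rfl h2 hx ((pageMk_eq_zero_iff _).1
          ((pageComplex_d (b := (a.1 + r.toNat, a.2 + 1 - r.toNat)) hr rfl h2 hx).symm.trans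
            (hy _)))
      · refine ⟨0, zero_mem _, ?_⟩
        rw [sub_zero]
        refine ⟨hx.1, ?_⟩
        have h1 := eq_zero_of_mem_fil (by lia) hx.2
        change (K.d _ (a.1 + a.2 + 1)).hom x = 0 at h1
        change (K.d _ (a.1 + a.2 + 1)).hom x ∈ F.fil _ _
        rw [h1]
        exact zero_mem _
    refine ⟨⟨x - z, hxz⟩, a, 0, ?_⟩
    have h0 : (F.pageComplex r hr).d a a 0 = 0 := map_zero ((F.pageComplex r hr).d a a).hom
    rw [h0, add_zero]
    refine sub_eq_zero.1 ((pageMk_eq_zero_iff (F := F)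
      (sub_mem hx (approxCycles_succ_le _ _ _ hxz))).2 ?_)
    rwa [sub_sub_cancel]
  · rintro ⟨x, hx⟩
    refine Iff.trans (b := x ∈ F.denominator (r.toNat + 1) a.1 (a.1 + a.2)) Iff.rfl ⟨?_, ?_⟩
    · intro h
      rcases mem_denominator_of_mem_succ h hx with h | ⟨p₀, n₀, hp, hn, w, hw, h⟩
      · exact ⟨a, 0, (map_zero ((F.pageComplex r hr).d a a).hom).trans
          ((pageMk_eq_zero_iff (approxCycles_succ_le _ _ _ hx)).2 h).symm⟩
      · obtain ⟨q₀, rfl⟩ : ∃ q₀, n₀ = p₀ + q₀ := ⟨n₀ - p₀, by lia⟩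
        refine ⟨(p₀, q₀), (pageMk w hw : F.Page r.toNat p₀ (p₀ + q₀)), ?_⟩
        refine (pageComplex_d (a := (p₀, q₀)) hr hp hn hw).trans (sub_eq_zero.1 ?_).symm
        exact (pageMk_eq_zero_iff (F := F) (sub_mem (approxCycles_succ_le _ _ _ hx)
          (d_mem_approxCycles hp hn hw))).2 h
    · rintro ⟨b, y, hy⟩
      by_cases h : b.1 + r.toNat = a.1 ∧ b.1 + b.2 + 1 = a.1 + a.2
      · obtain ⟨w, hw, rfl⟩ := exists_pageMk (F := F) y
        have h1 := sub_eq_zero.2 ((hf ⟨x, hx⟩).symm.trans (hy.symm.trans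
          (pageComplex_d hr h.1 h.2 hw)))
        exact mem_denominator_succ_of_sub_mem h.1 h.2 hw ((pageMk_eq_zero_iff (F := F)
          (sub_mem (approxCycles_succ_le _ _ _ hx) (d_mem_approxCycles h.1 h.2 hw))).1 h1) hx
      · rw [pageComplex_d_eq_zero hr h] at hy
        exact mem_denominator_succ_of_mem ((pageMk_eq_zero_iff
          (approxCycles_succ_le _ _ _ hx)).1 hy.symm) hx

variable (F) in
/-- The spectral sequence of a filtered complex, from the second page on. -/
noncomputable def spectralSequence : E₂CohomologicalSpectralSequenceNat (ModuleCat.{u} R) where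
  page r hr := F.pageComplex r hr
  iso r r' a hrr' hr := (Classical.choice (by
    subst hrr'
    have h : (r + 1).toNat = r.toNat + 1 := by lia
    obtain ⟨e⟩ := F.nonempty_page_succ_equiv_homology r hr a
    refine ⟨LinearEquiv.toModuleIso ?_⟩
    change _ ≃ₗ[R] F.Page (r + 1).toNat a.1 (a.1 + a.2)
    rw [h]
    exact e.symm))

/-- For `n + 2 ≤ r` the approximate cycles in degree `n` are cycles. -/
lemma mem_stable {r p n : ℕ} (hr : n + 2 ≤ r) {x : K.X n} :
    x ∈ F.approxCycles r p n ↔ x ∈ F.fil p n ∧ K.d n (n + 1) x = 0 := by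
  rw [mem_approxCycles, F.fil_eq_bot (p + r) (n + 1) (by lia)]
  rfl

variable (F) in
/-- The filtration of the homology induced by that of a complex, transported along a map from the
cycles which is surjective with kernel the boundaries. -/
lemma convergesTo {H : ℕ → ModuleCat.{u} R} (π : ∀ n, K.cycleSubmodule n →ₗ[R] H n)
    (hπ : ∀ n, Function.Surjective (π n))
    (hπ' : ∀ n x, π n x = 0 ↔ ∃ m y, K.d m n y = x) : ConvergesTo F.spectralSequence H := by
  refine ⟨fun n p => ((F.fil p n).submoduleOf (K.cycleSubmodule n)).map (π n),
    fun n => ⟨fun p p' h => Submodule.map_mono fun x hx => F.anti n h hx, ?_, ?_⟩, fun p q => ?_⟩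
  · refine eq_top_iff.2 fun y _ => ?_
    obtain ⟨x, rfl⟩ := hπ n y
    exact ⟨x, mem_fil_zero F rfl _, rfl⟩
  · refine eq_bot_iff.2 ?_
    rintro _ ⟨x, hx, rfl⟩
    have hx0 : x = 0 := Subtype.ext (eq_zero_of_mem_fil (Nat.lt_succ_self n) hx)
    rw [hx0, map_zero]
    exact zero_mem _
  · refine ⟨p + q + 3, fun r hr hr0 => ⟨fun a => ⟨pageComplex_d_eq_zero hr fun h => ?_,
      pageComplex_d_eq_zero hr fun h => ?_⟩, ?_⟩⟩
    · dsimp only at h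
      lia
    · dsimp only at h
      lia
    obtain ⟨s, hs⟩ : ∃ s, s = r.toNat := ⟨_, rfl⟩
    change Nonempty (F.Page r.toNat p (p + q) ≃ₗ[R] _)
    rw [← hs]
    have hZ : ∀ {x}, x ∈ F.approxCycles s p (p + q) → x ∈ K.cycleSubmodule (p + q) :=
      fun hx => CochainComplex.mem_cycleSubmodule_iff.2 ((mem_stable (by lia)).1 hx).2
    let g : F.approxCycles s p (p + q) →ₗ[R]
        ((F.fil p (p + q)).submoduleOf (K.cycleSubmodule (p + q))).map (π (p + q)) :=
      (π (p + q) ∘ₗ Submodule.inclusion fun _ => hZ).codRestrict _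
        fun x => ⟨⟨x.1, hZ x.2⟩, x.2.1, rfl⟩
    let g' := Submodule.mkQ ((((F.fil (p + 1) (p + q)).submoduleOf
      (K.cycleSubmodule (p + q))).map (π (p + q))).submoduleOf
        (((F.fil p (p + q)).submoduleOf (K.cycleSubmodule (p + q))).map (π (p + q)))) ∘ₗ g
    have hs' : Function.Surjective g' := by
      refine (Submodule.mkQ_surjective _).comp ?_
      rintro ⟨_, x, hx, rfl⟩
      exact ⟨⟨x.1, (mem_stable (by lia)).2
        ⟨hx, CochainComplex.mem_cycleSubmodule_iff.1 x.2⟩⟩, rfl⟩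
    have hk : LinearMap.ker g' =
        (F.denominator s p (p + q)).submoduleOf (F.approxCycles s p (p + q)) := by
      ext ⟨x, hx⟩
      have h1 : (⟨x, hx⟩ : F.approxCycles s p (p + q)) ∈ LinearMap.ker g' ↔ π (p + q) ⟨x, hZ hx⟩ ∈
          ((F.fil (p + 1) (p + q)).submoduleOf (K.cycleSubmodule (p + q))).map (π (p + q)) :=
        Submodule.Quotient.mk_eq_zero _
      refine h1.trans (Iff.trans ?_ (mem_denominator (x := x)).symm)
      constructor
      · rintro ⟨a, ha, hax⟩
        have h2 : π (p + q) (⟨x, hZ hx⟩ - a) = 0 := by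
          rw [map_sub, hax, sub_self]
        obtain ⟨m, y, hy⟩ := (hπ' _ _).1 h2
        refine ⟨a, (mem_stable (by lia)).2 ⟨ha, CochainComplex.mem_cycleSubmodule_iff.1 a.2⟩, m, y,
          mem_fil_zero F (by lia) _, ?_, ?_⟩
        · rw [hy]
          exact sub_mem hx.1 (fil_le (by lia) ha)
        · rw [hy]
          exact (add_sub_cancel a.1 x).symm
      · rintro ⟨a, ha, m, y, -, -, rfl⟩
        refine ⟨⟨a, CochainComplex.mem_cycleSubmodule_iff.2 ((mem_stable (by lia)).1 ha).2⟩,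
          ha.1, ?_⟩
        rw [← sub_eq_zero, ← map_sub, hπ']
        refine ⟨m, -y, ?_⟩
        change (K.d m (p + q)).hom (-y) = a - (a + (K.d m (p + q)).hom y)
        rw [map_neg]
        abel
    exact ⟨(Submodule.quotEquivOfEq _ _ hk.symm).trans (g'.quotKerEquivOfSurjective hs')⟩

end CanonicallyBoundedFiltration

/-! ### Cochains of a sheaf in terms of faces -/

namespace CategoryTheory.ComposableArrows

variable {C : Type*} [Category C] {n : ℕ}

/-- The chain obtained from `σ` by omitting the `k`-th vertex. -/
abbrev face (σ : ComposableArrows C (n + 1)) (k : Fin (n + 2)) : ComposableArrows C n :=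
  k.succAboveOrderEmb.monotone.functor ⋙ σ

/-- The arrow from the first vertex of `σ` to the first vertex of its `k`-th face. -/
abbrev faceArrow (σ : ComposableArrows C (n + 1)) (k : Fin (n + 2)) :
    σ.obj 0 ⟶ (σ.face k).obj 0 :=
  σ.map (homOfLE (Fin.zero_le (k.succAboveOrderEmb 0)))

end CategoryTheory.ComposableArrows

namespace Sh

variable {R : Type u} [CommRing R]

/-- The module of `n`-cochains. -/
abbrev Cochain (X : Sh R) (n : ℕ) : Type u :=
  ∀ σ : ComposableArrows X.cat n, X.sheaf.obj (op (σ.obj 0))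

/-- The differential of cochains. -/
def diff (X : Sh R) (n : ℕ) : X.Cochain n →ₗ[R] X.Cochain (n + 1) :=
  LinearMap.pi fun σ => ∑ k : Fin (n + 2),
    (-1 : R) ^ (k : ℕ) • (X.sheaf.map (σ.faceArrow k).op).hom ∘ₗ LinearMap.proj (σ.face k)

lemma diff_apply (X : Sh R) (n : ℕ) (u : X.Cochain n) (σ : ComposableArrows X.cat (n + 1)) :
    X.diff n u σ =
      ∑ k : Fin (n + 2), (-1 : R) ^ (k : ℕ) • X.sheaf.map (σ.faceArrow k).op (u (σ.face k)) := by
  refine (LinearMap.sum_apply _ _ _).trans ?_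
  rfl

lemma cochainComplex_d (X : Sh R) (n : ℕ) :
    (cochainComplex.obj X).d n (n + 1) = ModuleCat.ofHom (X.diff n) := by
  refine (CochainComplex.of_d (fun n => X.cosimplicial.obj (SimplexCategory.mk n))
    (AlgebraicTopology.AlternatingCofaceMapComplex.objD X.cosimplicial) n).trans ?_
  ext u
  funext σ
  refine Eq.trans ?_ (X.diff_apply n u σ).symm
  rw [AlgebraicTopology.AlternatingCofaceMapComplex.objD, ModuleCat.hom_sum, LinearMap.sum_apply]
  refine (Finset.sum_apply _ _ _).trans (Finset.sum_congr rfl fun k _ => ?_)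
  rw [← Int.cast_smul_eq_zsmul R]
  push_cast
  rfl

lemma cochainComplex_d_apply (X : Sh R) (n : ℕ) (u : X.Cochain n) :
    (cochainComplex.obj X).d n (n + 1) u = X.diff n u := by
  rw [cochainComplex_d]
  rfl

end Sh

namespace SheafBundle

variable {R : Type u} [CommRing R] {B : Type u} [SmallCategory B] (ξ : SheafBundle R B)

/-! ### The bicomplex of a bundle and its filtration -/

lemma dVert_apply (p q : ℕ) (u : ξ.bicomplex p q) (σ : ComposableArrows B p) :
    (ξ.dVert p q u : (ξ.row (q + 1)).Cochain p) σ =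
      (ξ.obj (op (σ.obj 0))).diff q ((u : (ξ.row q).Cochain p) σ) :=
  Sh.cochainComplex_d_apply _ _ _

lemma dHor_apply (p q : ℕ) (u : ξ.bicomplex p q) : ξ.dHor p q u = (ξ.row q).diff p u :=
  Sh.cochainComplex_d_apply _ _ _

lemma totalComplex_d (n : ℕ) : ξ.totalComplex.d n (n + 1) = ModuleCat.ofHom (ξ.totD n) :=
  CochainComplex.of_d (fun n => ModuleCat.of R (ξ.TotObj n)) (fun n => ModuleCat.ofHom (ξ.totD n)) n

lemma totD_apply (n p q : ℕ) (h : p + q = n + 1) (u : ξ.TotObj n) :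
    ξ.totD n u ⟨(p, q), h⟩ = ξ.totHor n p q h u + (-1 : R) ^ (p + q) • ξ.totVert n p q h u :=
  rfl

/-- The elements of `T^n` whose components in `K^{i,j}` vanish for `i < p`. -/
def filtration (p n : ℕ) : Submodule R (ξ.TotObj n) where
  carrier := {u | ∀ a, a.1.1 < p → u a = 0}
  add_mem' {u v} hu hv a ha := by
    change u a + v a = 0
    rw [hu a ha, hv a ha, add_zero]
  zero_mem' _ _ := rfl
  smul_mem' r u hu a ha := by
    change r • u a = 0
    rw [hu a ha, smul_zero]

variable {ξ}

lemma totHor_eq_zero {p n : ℕ} {u : ξ.TotObj n} (hu : u ∈ ξ.filtration p n) {i j : ℕ}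
    (h : i + j = n + 1) (hi : i ≤ p) : ξ.totHor n i j h u = 0 := by
  cases i with
  | zero => rfl
  | succ i =>
    change (ξ.dHor i j).hom (u ⟨(i, j), _⟩) = 0
    rw [hu ⟨(i, j), by lia⟩ hi, map_zero]

lemma totVert_eq_zero {p n : ℕ} {u : ξ.TotObj n} (hu : u ∈ ξ.filtration p n) {i j : ℕ}
    (h : i + j = n + 1) (hi : i < p) : ξ.totVert n i j h u = 0 := by
  cases j with
  | zero => rfl
  | succ j =>
    change (ξ.dVert i j).hom (u ⟨(i, j), _⟩) = 0
    rw [hu ⟨(i, j), by lia⟩ hi, map_zero]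

variable (ξ)

lemma totD_mem_filtration {p n : ℕ} {u : ξ.TotObj n} (hu : u ∈ ξ.filtration p n) :
    ξ.totD n u ∈ ξ.filtration p (n + 1) := by
  rintro ⟨⟨i, j⟩, h⟩ hi
  rw [totD_apply, totHor_eq_zero hu h hi.le, totVert_eq_zero hu h hi, smul_zero, add_zero]

/-- The filtration of the total complex by the degree in the base. -/
def baseFiltration : CanonicallyBoundedFiltration ξ.totalComplex where
  fil p n := ξ.filtration p n
  anti n p p' h u hu a ha := hu a (ha.trans_le h)
  fil_zero n := eq_top_iff.2 fun u _ a ha => absurd ha (Nat.not_lt_zero _)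
  fil_eq_bot p n h := eq_bot_iff.2 fun u hu => funext fun a => hu a (by have := a.2; lia)
  d_mem p n m u hu := by
    by_cases hm : n + 1 = m
    · subst hm
      rw [totalComplex_d]
      exact ξ.totD_mem_filtration hu
    · rw [ξ.totalComplex.shape _ _ hm]
      exact zero_mem (ξ.filtration p m)

/-- The image of the vertical differential in `K^{p,q}`. -/
def vertBoundaries : ∀ p q : ℕ, Submodule R (ξ.bicomplex p q)
  | _, 0 => ⊥
  | p, q + 1 => LinearMap.range (ξ.dVert p q).hom

lemma totVert_mem_vertBoundaries (n p q : ℕ) (h : p + q = n + 1) (u : ξ.TotObj n) :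
    ξ.totVert n p q h u ∈ ξ.vertBoundaries p q := by
  cases q with
  | zero => exact zero_mem _
  | succ q => exact ⟨_, rfl⟩

/-- The element of `T^n` with a single nonzero component `w` in `K^{p,q}`. -/
noncomputable def totSingle (n p q : ℕ) (h : p + q = n) (w : ξ.bicomplex p q) : ξ.TotObj n :=
  open Classical in Pi.single ⟨(p, q), h⟩ w

lemma totSingle_same (n p q : ℕ) (h : p + q = n) (w : ξ.bicomplex p q) :
    ξ.totSingle n p q h w ⟨(p, q), h⟩ = w := by
  classical
  exact Pi.single_eq_same _ _

lemma totSingle_of_ne (n p q : ℕ) (h : p + q = n) (w : ξ.bicomplex p q) {i j : ℕ}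
    (h' : i + j = n) (hi : i ≠ p) : ξ.totSingle n p q h w ⟨(i, j), h'⟩ = 0 := by
  classical
  exact Pi.single_eq_of_ne (fun e => hi (congrArg (fun a => a.1.1) e)) _

lemma totSingle_mem (n p q : ℕ) (h : p + q = n) (w : ξ.bicomplex p q) :
    ξ.totSingle n p q h w ∈ ξ.filtration p n := by
  rintro ⟨⟨i, j⟩, hij⟩ hi
  exact ξ.totSingle_of_ne n p q h w hij hi.ne

lemma totHor_totSingle (n p q : ℕ) (h : p + q = n) (w : ξ.bicomplex p q) (h' : p + 1 + q = n + 1) :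
    ξ.totHor n (p + 1) q h' (ξ.totSingle n p q h w) = ξ.dHor p q w := by
  change (ξ.dHor p q).hom (ξ.totSingle n p q h w ⟨(p, q), _⟩) = _
  rw [totSingle_same]

lemma exists_totVert_eq {n p q : ℕ} (h : p + q = n + 1) {b : ξ.bicomplex p q}
    (hb : b ∈ ξ.vertBoundaries p q) : ∃ v ∈ ξ.filtration p n, ξ.totVert n p q h v = b := by
  cases q with
  | zero => exact ⟨0, zero_mem _, hb.symm⟩
  | succ q =>
    obtain ⟨w, rfl⟩ := hb
    refine ⟨ξ.totSingle n p q (by lia) w, totSingle_mem _ _ _ _ _ _, ?_⟩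
    change (ξ.dVert p q).hom (ξ.totSingle n p q _ w ⟨(p, q), _⟩) = _
    rw [totSingle_same]

end SheafBundle

namespace SheafBundle

variable {R : Type u} [CommRing R] {B : Type u} [SmallCategory B] (ξ : SheafBundle R B)

/-! ### The second page -/

/-- The pair `(B, H^q_fib)`. -/
noncomputable abbrev fibreCohomologySh (q : ℕ) : Sh R where
  cat := B
  sheaf := ξ.fibreCohomology q

/-- The elements of `K^{p,q}` with zero vertical differential. -/
abbrev vertCycles (p q : ℕ) : Submodule R (ξ.bicomplex p q) := LinearMap.ker (ξ.dVert p q).hom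

/-- The cochain complex of the fibre at `x`. -/
abbrev fibreComplex (x : B) : CochainComplex (ModuleCat.{u} R) ℕ :=
  Sh.cochainComplex.obj (ξ.obj (op x))

/-- The component of an element of `K^{p,q}` at a chain of the base. -/
def atChain {p q : ℕ} (σ : ComposableArrows B p) :
    ξ.bicomplex p q →ₗ[R] (ξ.fibreComplex (σ.obj 0)).X q where
  toFun u := (u : (ξ.row q).Cochain p) σ
  map_add' _ _ := rfl
  map_smul' _ _ := rfl

variable {ξ} in
lemma bicomplex_ext {p q : ℕ} {u v : ξ.bicomplex p q}
    (h : ∀ σ : ComposableArrows B p, ξ.atChain σ u = ξ.atChain σ v) : u = v :=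
  funext h

lemma atChain_dVert {p q : ℕ} (σ : ComposableArrows B p) (u : ξ.bicomplex p q) :
    ξ.atChain σ (ξ.dVert p q u) = (ξ.fibreComplex (σ.obj 0)).d q (q + 1) (ξ.atChain σ u) :=
  rfl

lemma atChain_dHor {p q : ℕ} (σ : ComposableArrows B (p + 1)) (u : ξ.bicomplex p q) :
    ξ.atChain σ (ξ.dHor p q u) = ∑ k : Fin (p + 2), (-1 : R) ^ (k : ℕ) •
      (Sh.cochainComplex.map (ξ.map (σ.faceArrow k).op)).f q (ξ.atChain (σ.face k) u) :=
  (congrFun (ξ.dHor_apply p q u) σ).trans (Sh.diff_apply _ _ _ _)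

lemma mem_vertCycles_iff {p q : ℕ} {u : ξ.bicomplex p q} : u ∈ ξ.vertCycles p q ↔
    ∀ σ : ComposableArrows B p, ξ.atChain σ u ∈ (ξ.fibreComplex (σ.obj 0)).cycleSubmodule q := by
  simp only [CochainComplex.mem_cycleSubmodule_iff, ← atChain_dVert]
  refine ⟨fun h σ => ?_, fun h => bicomplex_ext fun σ => (h σ).trans (map_zero (ξ.atChain σ)).symm⟩
  rw [LinearMap.mem_ker] at h
  change ξ.atChain σ ((ξ.dVert p q).hom u) = 0
  rw [h, map_zero]

/-- The fibre cohomology classes given by an element of `K^{p,q}` with zero vertical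
differential. -/
noncomputable def vertClass (p q : ℕ) : ξ.vertCycles p q →ₗ[R]
    ∀ σ : ComposableArrows B p, (ξ.fibreComplex (σ.obj 0)).homology q :=
  LinearMap.pi fun σ => (ξ.fibreComplex (σ.obj 0)).homologyClass q ∘ₗ
    (ξ.atChain σ ∘ₗ Submodule.subtype _).codRestrict _ fun w => ξ.mem_vertCycles_iff.1 w.2 σ

lemma vertClass_apply {p q : ℕ} (w : ξ.vertCycles p q) (σ : ComposableArrows B p) :
    ξ.vertClass p q w σ = (ξ.fibreComplex (σ.obj 0)).homologyClass q
      ⟨ξ.atChain σ w.1, ξ.mem_vertCycles_iff.1 w.2 σ⟩ :=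
  rfl

lemma vertClass_surjective (p q : ℕ) : Function.Surjective (ξ.vertClass p q) := by
  intro c
  choose w hw using fun σ : ComposableArrows B p =>
    (ξ.fibreComplex (σ.obj 0)).homologyClass_surjective q (c σ)
  exact ⟨⟨fun σ => (w σ).1, ξ.mem_vertCycles_iff.2 fun σ => (w σ).2⟩, funext hw⟩

lemma vertClass_eq_zero_iff {p q : ℕ} (w : ξ.vertCycles p q) :
    ξ.vertClass p q w = 0 ↔ w.1 ∈ ξ.vertBoundaries p q := by
  rw [funext_iff]
  simp only [vertClass_apply]
  cases q with
  | zero =>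
    refine Iff.trans (b := w.1 = 0) ⟨fun h => bicomplex_ext fun σ => ?_, fun h σ => ?_⟩ Iff.rfl
    · rw [map_zero]
      exact congrArg Subtype.val
        (CochainComplex.homologyClass_zero_injective ((h σ).trans (map_zero _).symm))
    · refine (congrArg _ (Subtype.ext ?_)).trans (map_zero _)
      change ξ.atChain σ w.1 = 0
      rw [h, map_zero]
  | succ q =>
    simp only [Pi.zero_apply, CochainComplex.homologyClass_succ_eq_zero_iff]
    constructor
    · intro h
      choose v hv using h
      exact ⟨v, bicomplex_ext hv⟩
    · rintro ⟨v, hv⟩ σ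
      exact ⟨ξ.atChain σ v, congrArg (ξ.atChain σ) hv⟩

lemma dHor_mem_vertCycles {p q : ℕ} (w : ξ.vertCycles p q) :
    ξ.dHor p q w.1 ∈ ξ.vertCycles (p + 1) q := by
  refine (ConcreteCategory.congr_hom (ξ.dHor_dVert p q) w.1).trans ?_
  change (ξ.dHor p (q + 1)).hom ((ξ.dVert p q).hom w.1) = 0
  rw [LinearMap.mem_ker.1 w.2, map_zero]

lemma vertClass_dHor {p q : ℕ} (w : ξ.vertCycles p q) :
    ξ.vertClass (p + 1) q ⟨_, ξ.dHor_mem_vertCycles w⟩ =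
      (ξ.fibreCohomologySh q).diff p (ξ.vertClass p q w) := by
  refine funext fun σ => Eq.trans ?_
    (Sh.diff_apply (ξ.fibreCohomologySh q) p (ξ.vertClass p q w) σ).symm
  have h : ∀ k,
      (ξ.fibreCohomologySh q).sheaf.map (σ.faceArrow k).op (ξ.vertClass p q w (σ.face k)) =
      (ξ.fibreComplex (σ.obj 0)).homologyClass q ⟨_,
        HomologicalComplex.map_mem_cycleSubmodule (Sh.cochainComplex.map (ξ.map (σ.faceArrow k).op))
          (ξ.mem_vertCycles_iff.1 w.2 (σ.face k))⟩ :=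
    fun k => (HomologicalComplex.homologyMap_homologyClass _
      (Sh.cochainComplex.map (ξ.map (σ.faceArrow k).op)) q _ :)
  simp only [h]
  refine Eq.trans ?_ (Finset.sum_congr rfl fun k _ =>
    map_smul ((ξ.fibreComplex (σ.obj 0)).homologyClass q) _ _)
  refine (congrArg _ (Subtype.ext ?_)).trans
    (map_sum ((ξ.fibreComplex (σ.obj 0)).homologyClass q) _ _)
  rw [AddSubmonoidClass.coe_finsetSum]
  exact ξ.atChain_dHor σ w.1

lemma neg_one_pow_smul_smul {M : Type*} [AddCommGroup M] [Module R M] (n : ℕ) (x : M) :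
    (-1 : R) ^ n • (-1 : R) ^ n • x = x := by
  rw [smul_smul, ← mul_pow, neg_mul_neg, one_mul, one_pow, one_smul]

/-- The component in `K^{p,q}` of an element of order `2` has zero vertical differential. -/
lemma apply_mem_vertCycles {p q n : ℕ} (h : p + q = n) {x : ξ.TotObj n} (hx : x ∈ ξ.filtration p n)
    (hdx : ξ.totD n x ∈ ξ.filtration (p + 1) (n + 1)) : x ⟨(p, q), h⟩ ∈ ξ.vertCycles p q := by
  have h1 := hdx ⟨(p, q + 1), by lia⟩ (Nat.lt_succ_self p)
  rw [totD_apply, totHor_eq_zero hx _ le_rfl, zero_add] at h1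
  have h2 := congrArg (fun y => (-1 : R) ^ (p + (q + 1)) • y) h1
  rw [neg_one_pow_smul_smul, smul_zero] at h2
  exact h2

lemma totD_mem_of_mem {r p n : ℕ} {x : ξ.TotObj n}
    (hx : x ∈ ξ.baseFiltration.approxCycles r p n) : ξ.totD n x ∈ ξ.filtration (p + r) (n + 1) := by
  have h := hx.2
  rwa [totalComplex_d] at h

lemma mem_approxCycles_of {r p n : ℕ} {x : ξ.TotObj n} (hx : x ∈ ξ.filtration p n)
    (hdx : ξ.totD n x ∈ ξ.filtration (p + r) (n + 1)) :
    x ∈ ξ.baseFiltration.approxCycles r p n := by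
  refine ⟨hx, ?_⟩
  rw [totalComplex_d]
  exact hdx

lemma filtration_le {p p' n : ℕ} (h : p ≤ p') {x : ξ.TotObj n} (hx : x ∈ ξ.filtration p' n) :
    x ∈ ξ.filtration p n :=
  fun a ha => hx a (ha.trans_le h)

/-- The map from the elements of order `2` to the cochains of the fibre cohomology. -/
noncomputable def toFibreCochain (p q : ℕ) :
    ξ.baseFiltration.approxCycles 2 p (p + q) →ₗ[R] (ξ.fibreCohomologySh q).Cochain p :=
  ξ.vertClass p q ∘ₗ
    { toFun := fun x => ⟨ξ.totProj (p + q) p q rfl x.1, ξ.apply_mem_vertCycles rfl x.2.1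
        (ξ.filtration_le (Nat.le_succ (p + 1)) (ξ.totD_mem_of_mem x.2))⟩
      map_add' := fun _ _ => rfl
      map_smul' := fun _ _ => rfl }

lemma diff_toFibreCochain {p q : ℕ} (x : ξ.baseFiltration.approxCycles 2 p (p + q)) :
    (ξ.fibreCohomologySh q).diff p (ξ.toFibreCochain p q x) = 0 := by
  refine (ξ.vertClass_dHor _).symm.trans ((ξ.vertClass_eq_zero_iff _).2 ?_)
  have hpq : p + 1 + q = p + q + 1 := by lia
  have h0 := ξ.totD_mem_of_mem x.2 ⟨(p + 1, q), hpq⟩ (Nat.lt_succ_self _)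
  have h1 := eq_neg_of_add_eq_zero_left ((ξ.totD_apply _ _ _ hpq _).symm.trans h0)
  have h2 := neg_mem (Submodule.smul_mem _ ((-1 : R) ^ (p + 1 + q))
    (ξ.totVert_mem_vertBoundaries _ _ _ hpq x.1))
  rw [← h1] at h2
  exact h2

lemma totVert_succ_totSingle {n p q : ℕ} (h : p + q = n) (w : ξ.bicomplex p q)
    (h' : p + 1 + q = n + 1) : ξ.totVert n (p + 1) q h' (ξ.totSingle n p q h w) = 0 := by
  cases q with
  | zero => rfl
  | succ q =>
    change (ξ.dVert (p + 1) q).hom (ξ.totSingle _ p _ h w ⟨(p + 1, q), _⟩) = 0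
    rw [totSingle_of_ne _ _ _ _ _ _ _ (by simp), map_zero]

/-- A cocycle of the fibre cohomology is represented by an element of order `2`. -/
lemma exists_toFibreCochain_eq {p q : ℕ} (c : (ξ.fibreCohomologySh q).Cochain p)
    (hc : (ξ.fibreCohomologySh q).diff p c = 0) : ∃ x, ξ.toFibreCochain p q x = c := by
  obtain ⟨w, rfl⟩ := ξ.vertClass_surjective p q c
  have h1 := (ξ.vertClass_eq_zero_iff _).1 ((ξ.vertClass_dHor w).trans hc)
  have hpq : p + 1 + q = p + q + 1 := by lia
  obtain ⟨v, hv, hv'⟩ := ξ.exists_totVert_eq hpq h1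
  set x : ξ.TotObj (p + q) :=
    ξ.totSingle (p + q) p q rfl w.1 - (-1 : R) ^ (p + 1 + q) • v with hx
  have hxp : x ⟨(p, q), rfl⟩ = w.1 := by
    have h2 : v ⟨(p, q), rfl⟩ = 0 := hv _ (Nat.lt_succ_self p)
    change ξ.totSingle (p + q) p q rfl w.1 ⟨(p, q), rfl⟩ -
      (-1 : R) ^ (p + 1 + q) • v ⟨(p, q), rfl⟩ = _
    rw [totSingle_same, h2, smul_zero, sub_zero]
  have hxf : x ∈ ξ.filtration p (p + q) :=
    sub_mem (ξ.totSingle_mem _ _ _ _ _)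
      (Submodule.smul_mem _ _ (ξ.baseFiltration.anti _ (Nat.le_succ p) hv))
  have hdx : ξ.totD (p + q) x ∈ ξ.filtration (p + 2) (p + q + 1) := by
    rintro ⟨⟨i, j⟩, hij⟩ hi
    rw [totD_apply]
    dsimp only at hi hij
    rcases lt_or_ge i p with h | h
    · rw [totHor_eq_zero hxf hij h.le, totVert_eq_zero hxf hij h, smul_zero, add_zero]
    · obtain rfl | rfl : i = p ∨ i = p + 1 := by lia
      · obtain rfl : j = q + 1 := by lia
        rw [totHor_eq_zero hxf hij le_rfl]
        change 0 + _ • (ξ.dVert i q).hom (x ⟨(i, q), rfl⟩) = 0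
        rw [hxp, LinearMap.mem_ker.1 w.2, smul_zero, add_zero]
      · obtain rfl : j = q := by lia
        have h3 : ξ.totHor (p + j) (p + 1) j hij x = ξ.dHor p j w.1 := by
          change (ξ.dHor p j).hom (x ⟨(p, j), rfl⟩) = _
          rw [hxp]
        rw [h3, hx, map_sub, map_smul, totVert_succ_totSingle, zero_sub, smul_neg,
          neg_one_pow_smul_smul, hv', add_neg_cancel]
  refine ⟨⟨x, ξ.mem_approxCycles_of hxf hdx⟩, ?_⟩
  exact congrArg (ξ.vertClass p q) (Subtype.ext hxp)

lemma toFibreCochain_eq_zero_iff {p q : ℕ} (x : ξ.baseFiltration.approxCycles 2 p (p + q)) :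
    ξ.toFibreCochain p q x = 0 ↔
      (x.1 : ξ.TotObj (p + q)) ⟨(p, q), rfl⟩ ∈ ξ.vertBoundaries p q :=
  ξ.vertClass_eq_zero_iff ⟨_, _⟩

lemma totalComplex_d_apply {m n : ℕ} (e : m + 1 = n) (y : ξ.TotObj m) {i j : ℕ} (h : i + j = n) :
    (ξ.totalComplex.d m n y : ξ.TotObj n) ⟨(i, j), h⟩ = ξ.totD m y ⟨(i, j), h.trans e.symm⟩ := by
  subst e
  rw [totalComplex_d]
  rfl

lemma mem_denominator_of_apply_eq_zero {p q : ℕ} {x : ξ.TotObj (p + q)}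
    (hx : x ∈ ξ.baseFiltration.approxCycles 2 p (p + q)) (h0 : x ⟨(p, q), rfl⟩ = 0) :
    x ∈ ξ.baseFiltration.denominator 2 p (p + q) := by
  refine (le_sup_left : ξ.baseFiltration.approxCycles (2 - 1) (p + 1) (p + q) ≤ _) ⟨?_, hx.2⟩
  rintro ⟨⟨i, j⟩, hij⟩ hi
  dsimp only at hi hij
  rcases lt_or_ge i p with h | h
  · exact hx.1 _ h
  · obtain rfl : i = p := by lia
    obtain rfl : j = q := by lia
    exact h0

/-- An element of order `2` vanishes in `E_2` if its component in `K^{p,q}` is the horizontal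
differential of some `y` up to a vertical boundary. -/
lemma mem_denominator_of_apply_mem {p q : ℕ} {x : ξ.TotObj (p + q)}
    (hx : x ∈ ξ.baseFiltration.approxCycles 2 p (p + q)) {m : ℕ} (hm : m + 1 = p + q)
    {y : ξ.TotObj m} (hy : y ∈ ξ.filtration (p + 1 - 2) m)
    (hdy : ∀ i j h, i < p → ξ.totD m y ⟨(i, j), h⟩ = 0)
    (hvy : ∀ h, ξ.totVert m p q h y = 0)
    (hxy : ∀ h, x ⟨(p, q), rfl⟩ - ξ.totHor m p q h y ∈ ξ.vertBoundaries p q) :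
    x ∈ ξ.baseFiltration.denominator 2 p (p + q) := by
  -- the difference of `x` and the differential of `y` is corrected by a vertical boundary
  obtain ⟨v, hv, hv'⟩ := ξ.exists_totVert_eq hm.symm (hxy hm.symm)
  let y' : ξ.TotObj m := y + (-1 : R) ^ (p + q) • v
  let z : ξ.TotObj (p + q) := ξ.totalComplex.d m (p + q) y'
  have hz : ∀ i j (h : i + j = p + q), z ⟨(i, j), h⟩ =
      ξ.totD m y ⟨(i, j), h.trans hm.symm⟩ +
        (-1 : R) ^ (p + q) • ξ.totD m v ⟨(i, j), h.trans hm.symm⟩ := by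
    intro i j h
    refine (ξ.totalComplex_d_apply hm y' h).trans ?_
    change ξ.totD m (y + (-1 : R) ^ (p + q) • v) _ = _
    rw [map_add, map_smul]
    rfl
  have hz0 : ∀ i j (h : i + j = p + q), i < p → z ⟨(i, j), h⟩ = 0 := by
    intro i j h hi
    have h1 := ξ.totD_mem_filtration hv ⟨(i, j), h.trans hm.symm⟩ hi
    rw [hz, hdy _ _ _ hi, h1, smul_zero, add_zero]
  have hzpq : z ⟨(p, q), rfl⟩ = x ⟨(p, q), rfl⟩ := by
    rw [hz, totD_apply, totD_apply, hvy, totHor_eq_zero hv _ le_rfl, hv', zero_add,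
      neg_one_pow_smul_smul, smul_zero, add_zero, add_sub_cancel]
  have hzf : z ∈ ξ.filtration p (p + q) := fun a ha => hz0 _ _ a.2 ha
  have hz' : z ∈ ξ.baseFiltration.approxBoundaries 2 p (p + q) :=
    CanonicallyBoundedFiltration.mem_approxBoundaries.2 ⟨hzf, m, y', add_mem hy
      (Submodule.smul_mem _ _ (ξ.filtration_le (by lia) hv)), rfl⟩
  have hdz : (ξ.totalComplex.d (p + q) (p + q + 1)).hom z = 0 :=
    ξ.totalComplex.d_d_apply (i := m) (j := p + q) y'
  have hxz : x - z ∈ ξ.baseFiltration.denominator 2 p (p + q) := by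
    refine ξ.mem_denominator_of_apply_eq_zero ⟨sub_mem hx.1 hzf, ?_⟩ ?_
    · have h1 : (ξ.totalComplex.d (p + q) (p + q + 1)).hom (x - z) =
          (ξ.totalComplex.d (p + q) (p + q + 1)).hom x := by
        refine (map_sub (ξ.totalComplex.d (p + q) (p + q + 1)).hom _ _).trans ?_
        rw [hdz, sub_zero]
      change (ξ.totalComplex.d (p + q) (p + q + 1)).hom (x - z) ∈
        ξ.baseFiltration.fil (p + 2) (p + q + 1)
      rw [h1]
      exact hx.2
    · exact sub_eq_zero.2 hzpq.symm
  have h2 := add_mem hxz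
    ((le_sup_right : ξ.baseFiltration.approxBoundaries 2 p (p + q) ≤ _) hz')
  exact (sub_add_cancel x z) ▸ h2

lemma toFibreCochain_mem_boundaries {p q : ℕ} (x : ξ.baseFiltration.approxCycles 2 p (p + q))
    (hx : x.1 ∈ ξ.baseFiltration.denominator 2 p (p + q)) :
    ∃ j y, (Sh.cochainComplex.obj (ξ.fibreCohomologySh q)).d j p y = ξ.toFibreCochain p q x := by
  obtain ⟨a, ha, m, y, hy, hdy, hxy⟩ := CanonicallyBoundedFiltration.mem_denominator.1 hx
  have ha0 : (a : ξ.TotObj (p + q)) ⟨(p, q), rfl⟩ = 0 := ha.1 _ (Nat.lt_succ_self p)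
  have hx0 : (x.1 : ξ.TotObj (p + q)) ⟨(p, q), rfl⟩ =
      (ξ.totalComplex.d m (p + q) y : ξ.TotObj (p + q)) ⟨(p, q), rfl⟩ := by
    rw [hxy]
    change (a : ξ.TotObj (p + q)) ⟨(p, q), rfl⟩ + _ = _
    rw [ha0, zero_add]
  have hzero : (x.1 : ξ.TotObj (p + q)) ⟨(p, q), rfl⟩ ∈ ξ.vertBoundaries p q →
      ∃ j y, (Sh.cochainComplex.obj (ξ.fibreCohomologySh q)).d j p y = ξ.toFibreCochain p q x :=
    fun h => ⟨p, 0, (map_zero ((Sh.cochainComplex.obj (ξ.fibreCohomologySh q)).d p p).hom).trans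
      ((ξ.toFibreCochain_eq_zero_iff x).2 h).symm⟩
  by_cases hm : m + 1 = p + q
  · have hx1 := hx0.trans ((ξ.totalComplex_d_apply hm y rfl).trans (ξ.totD_apply m p q hm.symm y))
    have hb := Submodule.smul_mem _ ((-1 : R) ^ (p + q))
      (ξ.totVert_mem_vertBoundaries m p q hm.symm y)
    cases p with
    | zero =>
      refine hzero ?_
      rw [hx1]
      exact (zero_add ((-1 : R) ^ (0 + q) • ξ.totVert m 0 q hm.symm y)).symm ▸ hb
    | succ p =>
      have hm' : p + q = m := by lia
      have hw := ξ.apply_mem_vertCycles hm' hy fun b hb =>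
        (ξ.totalComplex_d_apply hm y (b.2.trans hm)).symm.trans (hdy ⟨b.1, b.2.trans hm⟩ hb)
      refine ⟨p, ξ.vertClass p q ⟨_, hw⟩, (Sh.cochainComplex_d_apply _ p _).trans ?_⟩
      refine (ξ.vertClass_dHor ⟨_, hw⟩).symm.trans (sub_eq_zero.1 ?_).symm
      refine (map_sub (ξ.vertClass (p + 1) q) _ _).symm.trans
        ((ξ.vertClass_eq_zero_iff _).2 ?_)
      change (x.1 : ξ.TotObj _) ⟨(p + 1, q), rfl⟩ - ξ.dHor p q _ ∈ _
      rw [hx1]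
      refine (add_sub_cancel_left (ξ.totHor m (p + 1) q hm.symm y) _).symm ▸ hb
  · refine hzero ?_
    rw [hx0, ξ.totalComplex.shape _ _ hm]
    exact zero_mem (ξ.vertBoundaries p q)

lemma mem_denominator_of_toFibreCochain {p q : ℕ} (x : ξ.baseFiltration.approxCycles 2 p (p + q))
    {j : ℕ} (y : (Sh.cochainComplex.obj (ξ.fibreCohomologySh q)).X j)
    (hy : (Sh.cochainComplex.obj (ξ.fibreCohomologySh q)).d j p y = ξ.toFibreCochain p q x) :
    x.1 ∈ ξ.baseFiltration.denominator 2 p (p + q) := by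
  by_cases hj : j + 1 = p
  · subst hj
    obtain ⟨w, hw⟩ := ξ.vertClass_surjective j q y
    have hm : j + q + 1 = j + 1 + q := by lia
    have hf := ξ.totSingle_mem (j + q) j q rfl w.1
    refine ξ.mem_denominator_of_apply_mem x.2 hm hf ?_ ?_ ?_
    · intro i k h hi
      rw [totD_apply, totHor_eq_zero hf h (by lia), zero_add]
      rcases lt_or_ge i j with h' | h'
      · rw [totVert_eq_zero hf h h', smul_zero]
      · obtain rfl : i = j := by lia
        obtain rfl : k = q + 1 := by lia
        change _ • (ξ.dVert i q).hom (ξ.totSingle _ i q rfl w.1 ⟨(i, q), rfl⟩) = 0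
        rw [totSingle_same, LinearMap.mem_ker.1 w.2, smul_zero]
    · exact fun h => ξ.totVert_succ_totSingle rfl w.1 h
    · intro h
      rw [totHor_totSingle]
      refine (ξ.vertClass_eq_zero_iff (⟨_, ξ.apply_mem_vertCycles rfl x.2.1
        (ξ.filtration_le (Nat.le_succ _) (ξ.totD_mem_of_mem x.2))⟩ -
          ⟨_, ξ.dHor_mem_vertCycles w⟩)).1 ?_
      rw [map_sub, sub_eq_zero]
      refine hy.symm.trans ((Sh.cochainComplex_d_apply _ j y).trans ?_)
      rw [← hw]
      exact (ξ.vertClass_dHor w).symm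
  · rw [HomologicalComplex.shape _ _ _ hj] at hy
    have hx := (ξ.toFibreCochain_eq_zero_iff x).1 hy.symm
    rcases Nat.eq_zero_or_pos (p + q) with h | h
    · obtain ⟨rfl, rfl⟩ : p = 0 ∧ q = 0 := by lia
      exact ξ.mem_denominator_of_apply_eq_zero x.2 hx
    · refine ξ.mem_denominator_of_apply_mem x.2 (Nat.sub_add_cancel h) (zero_mem _) ?_ ?_ ?_
      · intro i k h hi
        rw [map_zero]
        rfl
      · intro h
        rw [map_zero]
      · intro h
        rw [map_zero, sub_zero]
        exact hx

/-- The second page is the cohomology of the base with coefficients in the fibre cohomology. -/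
lemma nonempty_page_two_equiv (p q : ℕ) : Nonempty (ξ.baseFiltration.Page 2 p (p + q) ≃ₗ[R]
    (Sh.cochainComplex.obj (ξ.fibreCohomologySh q)).homology p) := by
  refine (Sh.cochainComplex.obj (ξ.fibreCohomologySh q)).nonempty_quotient_equiv_homology
    (ξ.toFibreCochain p q) _ ?_ ?_ ?_
  · intro x j
    refine HomologicalComplex.mem_cycleSubmodule.1 (CochainComplex.mem_cycleSubmodule_iff.2 ?_) j
    exact (Sh.cochainComplex_d_apply _ _ _).trans (ξ.diff_toFibreCochain x)
  · intro c hc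
    obtain ⟨x, hx⟩ := ξ.exists_toFibreCochain_eq c
      ((Sh.cochainComplex_d_apply _ _ _).symm.trans (hc (p + 1)))
    refine ⟨x, p, 0, ?_⟩
    have h0 : (Sh.cochainComplex.obj (ξ.fibreCohomologySh q)).d p p 0 = 0 :=
      map_zero ((Sh.cochainComplex.obj (ξ.fibreCohomologySh q)).d p p).hom
    rw [h0, add_zero]
    exact hx.symm
  · exact fun x => ⟨ξ.toFibreCochain_mem_boundaries x,
      fun ⟨j, y, hy⟩ => ξ.mem_denominator_of_toFibreCochain x y hy⟩

end SheafBundle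

/-! ### Coinduced sheaves are acyclic -/

namespace CategoryTheory.ComposableArrows

variable {C : Type*} [Category C] {n : ℕ}

lemma precomp_map_zero_succ (σ : ComposableArrows C n) {x : C} (f : x ⟶ σ.obj 0) (i : Fin (n + 1)) :
    (σ.precomp f).map (homOfLE (Fin.zero_le i.succ)) =
      (f ≫ σ.map (homOfLE (Fin.zero_le i)) : x ⟶ σ.obj i) := by
  obtain ⟨i, hi⟩ := i
  cases i with
  | zero =>
    refine (Category.comp_id f).symm.trans (congrArg (f ≫ ·) ?_)
    exact (σ.map_id 0).symm
  | succ i => rfl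

lemma precomp_face_succ (σ : ComposableArrows C (n + 1)) {x : C} (f : x ⟶ σ.obj 0)
    (k : Fin (n + 2)) :
    (σ.precomp f).face k.succ = (σ.face k).precomp (f ≫ σ.faceArrow k) := by
  let θ : Fin (n + 2) →o Fin (n + 3) :=
    ⟨Fin.cases 0 fun i => (k.succAbove i).succ, fun i j h => by
      induction i using Fin.cases with
      | zero => exact Fin.zero_le _
      | succ i =>
        induction j using Fin.cases with
        | zero => simp at h
        | succ j =>
          exact Fin.succ_le_succ_iff.2 ((Fin.strictMono_succAbove k).monotone
            (Fin.succ_le_succ_iff.1 h))⟩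
  have hθ : k.succ.succAboveOrderEmb.toOrderHom = θ := by
    refine OrderHom.ext _ _ (funext fun i => ?_)
    induction i using Fin.cases with
    | zero => exact Fin.succ_succAbove_zero k
    | succ i => exact Fin.succ_succAbove_succ k i
  change k.succ.succAboveOrderEmb.toOrderHom.monotone.functor ⋙ _ = _
  rw [hθ]
  refine ext_succ rfl rfl ?_
  refine (σ.precomp_map_zero_succ f (k.succAbove 0)).trans ?_
  exact (Category.comp_id _).symm.trans (Category.id_comp _).symm

lemma precomp_faceArrow_succ (σ : ComposableArrows C (n + 1)) {x : C} (f : x ⟶ σ.obj 0)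
    (k : Fin (n + 2)) :
    (σ.precomp f).faceArrow k.succ =
      eqToHom (Functor.congr_obj (σ.precomp_face_succ f k).symm 0) := by
  have h : ∀ (i : Fin (n + 3)) (hi : i = 0),
      (σ.precomp f).map (homOfLE (Fin.zero_le i)) = eqToHom (by rw [hi]) := by
    rintro _ rfl
    exact (σ.precomp f).map_id 0
  exact h _ (Fin.succ_succAbove_zero k)

end CategoryTheory.ComposableArrows

namespace Sh

variable {R : Type u} [CommRing R]

lemma map_apply_congr (X : Sh R) {n : ℕ} (u : X.Cochain n) {σ τ : ComposableArrows X.cat n}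
    (h : σ = τ) {y : X.cat} (f : y ⟶ σ.obj 0) (g : y ⟶ τ.obj 0)
    (hfg : f ≫ eqToHom (Functor.congr_obj h 0) = g) :
    X.sheaf.map f.op (u σ) = X.sheaf.map g.op (u τ) := by
  subst h hfg
  simp

lemma map_map_apply (X : Sh R) {a b c : X.cat} (f : a ⟶ b) (g : b ⟶ c)
    (v : X.sheaf.obj (op c)) :
    X.sheaf.map f.op (X.sheaf.map g.op v) = X.sheaf.map (f ≫ g).op v :=
  (X.sheaf_map_comp _ f g rfl v).symm

/-- A sheaf is coinduced if it has linear maps `ev j` from its values at objects `w j` such that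
an element `v` over `y` amounts to a family of elements, namely the values of `ev j` at the
restrictions of `v` along the arrows `w j ⟶ y`. -/
structure Coinduced (X : Sh R) where
  ι : Type u
  w : ι → X.cat
  A : ι → ModuleCat.{u} R
  ev (j : ι) : X.sheaf.obj (op (w j)) ⟶ A j
  injective (y : X.cat) (v v' : X.sheaf.obj (op y))
    (h : ∀ j (k : w j ⟶ y), ev j (X.sheaf.map k.op v) = ev j (X.sheaf.map k.op v')) : v = v'
  surjective (y : X.cat) (a : ∀ j, (w j ⟶ y) → A j) :
    ∃ v : X.sheaf.obj (op y), ∀ j (k : w j ⟶ y), ev j (X.sheaf.map k.op v) = a j k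

/-- A cocycle `u` of positive degree of a coinduced sheaf is the differential of the cochain whose
value at `σ` is given by the values of `u` at the chains obtained by putting `w j` in front
of `σ`. -/
lemma Coinduced.exists_diff_eq {X : Sh R} (c : X.Coinduced) {n : ℕ} (u : X.Cochain (n + 1))
    (hu : X.diff (n + 1) u = 0) : ∃ v, X.diff n v = u := by
  choose v hv using fun σ : ComposableArrows X.cat n =>
    c.surjective (σ.obj 0) fun j k => c.ev j (u (σ.precomp k))
  refine ⟨v, funext fun σ => c.injective _ _ _ fun j k => ?_⟩
  let g (i : Fin (n + 3)) : X.sheaf.obj (op (c.w j)) :=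
    X.sheaf.map ((σ.precomp k).faceArrow i).op (u ((σ.precomp k).face i))
  have h1 : (c.ev j).hom (∑ i : Fin (n + 3), (-1 : R) ^ (i : ℕ) • g i) = 0 := by
    have h0 : ∑ i : Fin (n + 3), (-1 : R) ^ (i : ℕ) • g i = 0 :=
      (X.diff_apply (n + 1) u (σ.precomp k)).symm.trans (congrFun hu _)
    rw [h0, map_zero]
  rw [diff_apply]
  have h2 : ∀ i : Fin (n + 2), c.ev j (g i.succ) =
      c.ev j (X.sheaf.map k.op (X.sheaf.map (σ.faceArrow i).op (v (σ.face i)))) := by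
    intro i
    rw [map_map_apply, hv]
    refine congrArg (c.ev j) ?_
    refine (X.map_apply_congr u (σ.precomp_face_succ k i) _ (𝟙 _) ?_).trans ?_
    · rw [ComposableArrows.precomp_faceArrow_succ, eqToHom_trans, eqToHom_refl]
    · exact ConcreteCategory.congr_hom (X.sheaf.map_id _) _
  have h3 : g 0 = X.sheaf.map k.op (u σ) :=
    X.map_apply_congr u rfl _ _ ((Category.comp_id _).trans
      ((σ.precomp_map_zero_succ k 0).trans ((congrArg (k ≫ ·) (σ.map_id 0)).trans
        (Category.comp_id k))))
  have h4 : (c.ev j).hom (X.sheaf.map k.op (u σ)) = ∑ i : Fin (n + 2), (-1 : R) ^ (i : ℕ) •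
      (c.ev j).hom (X.sheaf.map k.op (X.sheaf.map (σ.faceArrow i).op (v (σ.face i)))) := by
    rw [map_sum, Fin.sum_univ_succ, h3] at h1
    simp only [Fin.val_zero, pow_zero, one_smul, Fin.val_succ, pow_succ, mul_neg,
      mul_one, neg_smul] at h1
    refine (eq_neg_of_add_eq_zero_left h1).trans ?_
    rw [← Finset.sum_neg_distrib]
    refine Finset.sum_congr rfl fun i _ => ?_
    rw [← map_neg, neg_neg, map_smul]
    exact congrArg _ (h2 i)
  refine Eq.trans ?_ h4.symm
  change (c.ev j).hom ((X.sheaf.map k.op).hom _) = _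
  rw [map_sum, map_sum]
  refine Finset.sum_congr rfl fun i _ => ?_
  rw [map_smul]
  exact map_smul (c.ev j).hom _ _

lemma Coinduced.exactAt {X : Sh R} (c : X.Coinduced) (n : ℕ) :
    (cochainComplex.obj X).ExactAt (n + 1) := by
  rw [HomologicalComplex.exactAt_iff_isZero_homology, ModuleCat.isZero_iff_subsingleton]
  refine ⟨fun a b => ?_⟩
  suffices h : ∀ a : (cochainComplex.obj X).homology (n + 1), a = 0 from (h a).trans (h b).symm
  intro a
  obtain ⟨x, rfl⟩ := HomologicalComplex.homologyClass_surjective _ _ a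
  refine (CochainComplex.homologyClass_succ_eq_zero_iff x).2 ?_
  obtain ⟨v, hv⟩ := c.exists_diff_eq x.1
    ((cochainComplex_d_apply _ _ _).symm.trans (CochainComplex.mem_cycleSubmodule_iff.1 x.2))
  exact ⟨v, (cochainComplex_d_apply _ _ _).trans hv⟩

end Sh

/-! ### Arrows of the total category -/

namespace SheafBundle

variable {R : Type u} [CommRing R] {B : Type u} [SmallCategory B] (ξ : SheafBundle R B)

/-- A pair of an arrow `f` of the base and an arrow of the fibre from the image under `ξ₁(f)`; each
arrow of the total category is the composite of an arrow of type b and an arrow of type a for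
exactly one such pair. -/
abbrev NormalForm (a b : ξ.Obj) : Type u :=
  Σ f : a.pt ⟶ b.pt, (ξ.push f).obj a.val ⟶ b.val

namespace NormalForm

variable {ξ}

lemma ext' {a b : ξ.Obj} {s t : ξ.NormalForm a b} (h : s.1 = t.1)
    (h' : s.2 = eqToHom (by rw [h]) ≫ t.2) : s = t := by
  obtain ⟨f, k⟩ := s
  obtain ⟨g, l⟩ := t
  obtain rfl : f = g := h
  obtain rfl : k = l := h'.trans (Category.id_comp l)
  rfl

/-- The composite of a normal form with a simple arrow. -/
def compSimple {a : ξ.Obj} {b c : ξ.Obj} (s : ξ.NormalForm a b) (e : ξ.Simple b c) :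
    ξ.NormalForm a c :=
  match b, c, e, s with
  | _, _, .fib k, s => ⟨s.1, s.2 ≫ k⟩
  | _, _, .lift f _ _ h, s => ⟨s.1 ≫ f,
      eqToHom (Functor.congr_obj (ξ.push_comp s.1 f _ rfl) a.val).symm ≫
        (ξ.push f).map s.2 ≫ eqToHom h⟩

/-- The normal form of the identity arrow. -/
def id (a : ξ.Obj) : ξ.NormalForm a a :=
  ⟨𝟙 a.pt, eqToHom (Functor.congr_obj (ξ.push_id a.pt) a.val)⟩

lemma compSimple_fib_comp {a : ξ.Obj} {x : B} {y₁ y₂ y₃ : ξ.Fib x} (s : ξ.NormalForm a ⟨x, y₁⟩)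
    (k : y₁ ⟶ y₂) (l : y₂ ⟶ y₃) :
    (s.compSimple (.fib k)).compSimple (.fib l) = s.compSimple (.fib (k ≫ l)) :=
  congrArg (Sigma.mk s.1) (Category.assoc s.2 k l)

lemma compSimple_fib_id {a : ξ.Obj} {x : B} {y : ξ.Fib x} (s : ξ.NormalForm a ⟨x, y⟩) :
    s.compSimple (.fib (𝟙 y)) = s :=
  congrArg (Sigma.mk s.1) (Category.comp_id s.2)

lemma compSimple_lift_id {a : ξ.Obj} {x : B} {y : ξ.Fib x} (h : (ξ.push (𝟙 x)).obj y = y)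
    (s : ξ.NormalForm a ⟨x, y⟩) : s.compSimple (.lift (𝟙 x) y y h) = s := by
  obtain ⟨f, k⟩ := s
  refine ext' (Category.comp_id f) ?_
  dsimp only [compSimple] at f k ⊢
  rw [Functor.congr_hom (ξ.push_id x) k]
  simp

lemma compSimple_lift_comp {a : ξ.Obj} {x₁ x₂ x₃ : B} (f : x₁ ⟶ x₂) (g : x₂ ⟶ x₃) (y₁ : ξ.Fib x₁)
    (y₂ : ξ.Fib x₂) (y₃ : ξ.Fib x₃) (h₁ : (ξ.push f).obj y₁ = y₂) (h₂ : (ξ.push g).obj y₂ = y₃)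
    (h₃ : (ξ.push (f ≫ g)).obj y₁ = y₃) (s : ξ.NormalForm a ⟨x₁, y₁⟩) :
    (s.compSimple (.lift f y₁ y₂ h₁)).compSimple (.lift g y₂ y₃ h₂) =
      s.compSimple (.lift (f ≫ g) y₁ y₃ h₃) := by
  obtain ⟨s, k⟩ := s
  refine ext' (Category.assoc s f g) ?_
  dsimp only [compSimple] at s k ⊢
  have h1 := Functor.congr_hom (ξ.push_comp f g _ rfl) k
  rw [Functor.comp_map] at h1
  rw [Functor.map_comp, Functor.map_comp, eqToHom_map, eqToHom_map, h1]
  simp only [Category.assoc, eqToHom_trans, eqToHom_trans_assoc]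
  exact (eqToHom_trans_assoc _ _ _).trans (eqToHom_trans_assoc _ _ _).symm

lemma compSimple_square {a : ξ.Obj} {x₁ x₂ : B} (f : x₁ ⟶ x₂) {y₁ y₂ : ξ.Fib x₁} (k : y₁ ⟶ y₂)
    (s : ξ.NormalForm a ⟨x₁, y₁⟩) :
    (s.compSimple (.fib k)).compSimple (.lift f y₂ _ rfl) =
      (s.compSimple (.lift f y₁ _ rfl)).compSimple (.fib ((ξ.push f).map k)) := by
  obtain ⟨s, l⟩ := s
  refine ext' rfl ?_
  dsimp only [compSimple] at s l ⊢
  simp only [Functor.map_comp, eqToHom_refl, Category.comp_id, Category.assoc]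
  exact (Category.id_comp _).symm

end NormalForm

/-- The functor that sends `b` to the normal forms with source `a` and target `b`. -/
def normalFormOnSimple (a : ξ.Obj) : ξ.Obj ⥤q Type u where
  obj b := ξ.NormalForm a b
  map e := TypeCat.ofHom fun s => s.compSimple e

lemma normalFormOnSimple_rel (a : ξ.Obj) {b c : Paths ξ.Obj} (p q : b ⟶ c) (h : ξ.Rel p q) :
    (Paths.lift (ξ.normalFormOnSimple a)).map p = (Paths.lift (ξ.normalFormOnSimple a)).map q := by
  refine ConcreteCategory.hom_ext _ _ fun s => ?_
  cases h with
  | fib_id y => exact NormalForm.compSimple_fib_id s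
  | fib_comp k l => exact NormalForm.compSimple_fib_comp s k l
  | lift_id y h => exact NormalForm.compSimple_lift_id h s
  | lift_comp f g y₁ y₂ y₃ h₁ h₂ h₃ => exact NormalForm.compSimple_lift_comp f g y₁ y₂ y₃ h₁ h₂ h₃ s
  | square f k => exact NormalForm.compSimple_square f k s

/-- The action of the arrows of the total category on normal forms by composition. -/
def normalFormFunctor (a : ξ.Obj) : ξ.Total ⥤ Type u :=
  CategoryTheory.Quotient.lift ξ.Rel (Paths.lift (ξ.normalFormOnSimple a))
    (fun _ _ p q h => ξ.normalFormOnSimple_rel a p q h)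

lemma total_hom_induction {a : ξ.Obj} (P : ∀ {b : ξ.Obj}, ((⟨a⟩ : ξ.Total) ⟶ ⟨b⟩) → Prop)
    (id : P (𝟙 _))
    (fib : ∀ {x : B} {y₁ y₂ : ξ.Fib x} (g : (⟨a⟩ : ξ.Total) ⟶ ⟨⟨x, y₁⟩⟩) (k : y₁ ⟶ y₂), P g →
      P (g ≫ ξ.fibArrow k))
    (lift : ∀ {x₁ x₂ : B} (f : x₁ ⟶ x₂) (y₁ : ξ.Fib x₁) (g : (⟨a⟩ : ξ.Total) ⟶ ⟨⟨x₁, y₁⟩⟩), P g →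
      P (g ≫ ξ.liftArrow f y₁ _ rfl))
    {b : ξ.Obj} (g : (⟨a⟩ : ξ.Total) ⟶ ⟨b⟩) : P g := by
  suffices h : ∀ p : Quiver.Path a b, P ((CategoryTheory.Quotient.functor ξ.Rel).map
      (X := a) (Y := b) p) by
    obtain ⟨p, rfl⟩ := (CategoryTheory.Quotient.functor ξ.Rel).map_surjective g
    exact h p
  clear g
  intro p
  induction p with
  | nil => exact id
  | @cons c d p e ih =>
    change ξ.Simple c d at e
    cases e with
    | fib k => exact fib _ k ih
    | lift f y₁ y₂ h =>
      subst h
      exact lift f y₁ _ ih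

namespace NormalForm

variable {ξ}

/-- The arrow of the total category with a given normal form. -/
def arrow {a b : ξ.Obj} (s : ξ.NormalForm a b) : (⟨a⟩ : ξ.Total) ⟶ ⟨b⟩ :=
  ξ.liftArrow s.1 a.val _ rfl ≫ ξ.fibArrow s.2

end NormalForm

/-- The normal form of an arrow of the total category. -/
def normalForm {a b : ξ.Obj} (g : (⟨a⟩ : ξ.Total) ⟶ ⟨b⟩) : ξ.NormalForm a b :=
  (ξ.normalFormFunctor a).map g (NormalForm.id a)

lemma normalForm_comp_fibArrow {a : ξ.Obj} {x : B} {y₁ y₂ : ξ.Fib x}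
    (g : (⟨a⟩ : ξ.Total) ⟶ ⟨⟨x, y₁⟩⟩) (k : y₁ ⟶ y₂) :
    ξ.normalForm (g ≫ ξ.fibArrow k) = ⟨(ξ.normalForm g).1, (ξ.normalForm g).2 ≫ k⟩ := by
  refine (ConcreteCategory.congr_hom ((ξ.normalFormFunctor a).map_comp g _) _).trans ?_
  rfl

lemma normalForm_comp_liftArrow {a : ξ.Obj} {x₁ x₂ : B} (f : x₁ ⟶ x₂) (y₁ : ξ.Fib x₁)
    (y₂ : ξ.Fib x₂) (h : (ξ.push f).obj y₁ = y₂) (g : (⟨a⟩ : ξ.Total) ⟶ ⟨⟨x₁, y₁⟩⟩) :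
    ξ.normalForm (g ≫ ξ.liftArrow f y₁ y₂ h) =
      (ξ.normalForm g).compSimple (Simple.lift f y₁ y₂ h) := by
  refine (ConcreteCategory.congr_hom ((ξ.normalFormFunctor a).map_comp g _) _).trans ?_
  rfl

lemma normalForm_liftArrow {a : ξ.Obj} {x : B} (f : a.pt ⟶ x) :
    ξ.normalForm (ξ.liftArrow f a.val _ rfl) = ⟨f, 𝟙 _⟩ := by
  have h : (NormalForm.id a).compSimple (Simple.lift f a.val _ rfl) = ⟨f, 𝟙 _⟩ := by
    refine NormalForm.ext' (Category.id_comp f) ?_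
    dsimp only [NormalForm.compSimple, NormalForm.id]
    rw [eqToHom_map]
    simp only [eqToHom_refl, Category.comp_id]
    exact eqToHom_trans _ _
  exact h

lemma normalForm_arrow {a b : ξ.Obj} (s : ξ.NormalForm a b) : ξ.normalForm s.arrow = s := by
  refine (ξ.normalForm_comp_fibArrow _ s.2).trans ?_
  rw [normalForm_liftArrow]
  exact congrArg (Sigma.mk s.1) (Category.id_comp s.2)

lemma liftArrow_fibArrow_eqToHom {x₁ x₂ : B} (f : x₁ ⟶ x₂) (y₁ : ξ.Fib x₁) {y₂ y₃ : ξ.Fib x₂}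
    (h : (ξ.push f).obj y₁ = y₂) (h' : y₂ = y₃) :
    ξ.liftArrow f y₁ y₂ h ≫ ξ.fibArrow (eqToHom h') = ξ.liftArrow f y₁ y₃ (h.trans h') := by
  subst h'
  exact (congrArg (_ ≫ ·) (ξ.fibArrow_id _)).trans (Category.comp_id _)

lemma fibArrow_comp_liftArrow {x₁ x₂ : B} (f : x₁ ⟶ x₂) {y₁ y₂ : ξ.Fib x₁} (k : y₁ ⟶ y₂) :
    ξ.fibArrow k ≫ ξ.liftArrow f y₂ _ rfl =
      ξ.liftArrow f y₁ _ rfl ≫ ξ.fibArrow ((ξ.push f).map k) :=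
  CategoryTheory.Quotient.sound _ (Rel.square f k)

variable {ξ} in
lemma NormalForm.arrow_compSimple_lift {a : ξ.Obj} {x₁ x₂ : B} (f : x₁ ⟶ x₂) (y₁ : ξ.Fib x₁)
    (s : ξ.NormalForm a ⟨x₁, y₁⟩) :
    (s.compSimple (.lift f y₁ _ rfl)).arrow = s.arrow ≫ ξ.liftArrow f y₁ _ rfl := by
  obtain ⟨s, k⟩ := s
  dsimp only at s k
  have h := Functor.congr_obj (ξ.push_comp s f _ rfl) a.val
  have h1 : ξ.fibArrow (eqToHom h.symm ≫ (ξ.push f).map k ≫ 𝟙 _) =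
      ξ.fibArrow (eqToHom h.symm) ≫ ξ.fibArrow ((ξ.push f).map k) := by
    rw [Category.comp_id, fibArrow_comp]
  refine (congrArg (ξ.liftArrow (s ≫ f) a.val _ rfl ≫ ·) h1).trans ?_
  refine (Category.assoc _ _ _).symm.trans ?_
  rw [liftArrow_fibArrow_eqToHom]
  refine (congrArg (· ≫ _) (ξ.liftArrow_comp s f a.val _ _ rfl rfl _)).trans ?_
  refine (Category.assoc _ _ _).trans (Eq.trans ?_ (Category.assoc _ _ _).symm)
  exact congrArg (_ ≫ ·) (ξ.fibArrow_comp_liftArrow f k).symm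

lemma arrow_normalForm {a b : ξ.Obj} (g : (⟨a⟩ : ξ.Total) ⟶ ⟨b⟩) : (ξ.normalForm g).arrow = g := by
  induction g using ξ.total_hom_induction with
  | id =>
    exact (ξ.liftArrow_fibArrow_eqToHom (𝟙 _) a.val rfl
      (Functor.congr_obj (ξ.push_id a.pt) a.val)).trans (ξ.liftArrow_id _ _)
  | fib g k ih =>
    rw [normalForm_comp_fibArrow]
    refine (congrArg (_ ≫ ·) (ξ.fibArrow_comp _ _)).trans ?_
    refine (Category.assoc _ _ _).symm.trans ?_
    exact congrArg (· ≫ _) ih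
  | lift f y₁ g ih =>
    rw [normalForm_comp_liftArrow, NormalForm.arrow_compSimple_lift, ih]

end SheafBundle

/-! ### Signed sums over grid paths -/

namespace GridPath

/-- The paths of `n` unit steps in `ℕ × ℕ` from `(0, 0)` to `(p, q)`. -/
def paths (n p q : ℕ) : Set (Fin (n + 1) → ℕ × ℕ) :=
  {f | f 0 = (0, 0) ∧ f (Fin.last n) = (p, q) ∧ ∀ k : Fin n,
    ((f k.succ).1 = (f k.castSucc).1 + 1 ∧ (f k.succ).2 = (f k.castSucc).2) ∨
      ((f k.succ).1 = (f k.castSucc).1 ∧ (f k.succ).2 = (f k.castSucc).2 + 1)}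

/-- The sum of `p - i` over the vertical steps `(i, j) ⟶ (i, j + 1)` of a path. -/
def weight (p : ℕ) {n : ℕ} (f : Fin (n + 1) → ℕ × ℕ) : ℕ :=
  ∑ k : Fin n, if (f k.castSucc).2 < (f k.succ).2 then p - (f k.castSucc).1 else 0

lemma monotone_of_mem_paths {n p q : ℕ} {f : Fin (n + 1) → ℕ × ℕ} (hf : f ∈ paths n p q) :
    Monotone f := by
  rw [Fin.monotone_iff_le_succ]
  intro k
  have := hf.2.2 k
  exact ⟨by lia, by lia⟩

lemma le_of_mem_paths {n p q : ℕ} {f : Fin (n + 1) → ℕ × ℕ} (hf : f ∈ paths n p q)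
    (k : Fin (n + 1)) : f k ≤ (p, q) :=
  hf.2.1 ▸ monotone_of_mem_paths hf (Fin.le_last k)

/-- The path in `ℕ × ℕ` underlying a traversal. -/
def ofTraversal {n p q : ℕ} (z : GridTraversal n p q) (k : Fin (n + 1)) : ℕ × ℕ :=
  (z.i k, z.j k)

lemma ofTraversal_injective (n p q : ℕ) :
    Function.Injective (ofTraversal : GridTraversal n p q → _) := by
  intro z z' h
  refine GridTraversal.ext ?_ ?_
  · exact OrderHom.ext _ _ (funext fun k => Fin.ext (congrArg Prod.fst (congrFun h k)))
  · exact OrderHom.ext _ _ (funext fun k => Fin.ext (congrArg Prod.snd (congrFun h k)))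

lemma range_ofTraversal (n p q : ℕ) :
    Set.range (ofTraversal : GridTraversal n p q → _) = paths n p q := by
  ext f
  constructor
  · rintro ⟨z, rfl⟩
    refine ⟨?_, ?_, fun k => ?_⟩
    · simp [ofTraversal, z.start.1, z.start.2]
    · simp [ofTraversal, z.finish.1, z.finish.2]
    · have := z.step k
      simpa only [ofTraversal, Fin.ext_iff] using this
  · intro hf
    have h := le_of_mem_paths hf
    refine ⟨⟨⟨fun k => ⟨(f k).1, Nat.lt_succ_of_le (h k).1⟩,
      fun k l e => (monotone_of_mem_paths hf e).1⟩,
      ⟨fun k => ⟨(f k).2, Nat.lt_succ_of_le (h k).2⟩,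
      fun k l e => (monotone_of_mem_paths hf e).2⟩, ?_, ?_, ?_⟩, rfl⟩
    · exact ⟨Fin.ext (congrArg Prod.fst hf.1), Fin.ext (congrArg Prod.snd hf.1)⟩
    · exact ⟨Fin.ext (congrArg Prod.fst hf.2.1), Fin.ext (congrArg Prod.snd hf.2.1)⟩
    · intro k
      exact (hf.2.2 k).imp (fun h => ⟨h.1, Fin.ext h.2⟩) (fun h => ⟨Fin.ext h.1, h.2⟩)

lemma finite_paths (n p q : ℕ) : (paths n p q).Finite :=
  range_ofTraversal n p q ▸ Set.finite_range _

/-- The number of vertical steps of a path from `(0, 0)` to `(p, q)` is `q`. -/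
lemma sum_vertical {n p q : ℕ} {f : Fin (n + 1) → ℕ × ℕ} (hf : f ∈ paths n p q) :
    (∑ k : Fin n, if (f k.castSucc).2 < (f k.succ).2 then 1 else 0) = q := by
  have h : ∀ k : Fin n, (if (f k.castSucc).2 < (f k.succ).2 then 1 else 0) + (f k.castSucc).2 =
      (f k.succ).2 := by
    intro k
    have := hf.2.2 k
    split_ifs <;> lia
  have h1 := Fin.sum_univ_succ fun k => (f k).2
  rw [Fin.sum_univ_castSucc, ← Finset.sum_congr rfl fun k _ => h k, Finset.sum_add_distrib,
    hf.1, hf.2.1] at h1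
  simp only at h1
  lia

section Snoc

variable {n : ℕ} (f : Fin (n + 1) → ℕ × ℕ) (v : ℕ × ℕ)

lemma snoc_castSucc' (k : Fin (n + 1)) :
    (Fin.snoc f v : Fin (n + 2) → ℕ × ℕ) k.castSucc = f k :=
  Fin.snoc_castSucc (α := fun _ => ℕ × ℕ) _ _ _

lemma snoc_last' : (Fin.snoc f v : Fin (n + 2) → ℕ × ℕ) (Fin.last (n + 1)) = v :=
  Fin.snoc_last (α := fun _ => ℕ × ℕ) _ _

lemma snoc_injective : Function.Injective
    fun f : Fin (n + 1) → ℕ × ℕ => (Fin.snoc f v : Fin (n + 2) → ℕ × ℕ) := by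
  intro f g h
  funext k
  have := congrFun h k.castSucc
  simpa only [snoc_castSucc'] using this

lemma snoc_mem_paths_iff {p q : ℕ} :
    (Fin.snoc f v : Fin (n + 2) → ℕ × ℕ) ∈ paths (n + 1) p q ↔
      v = (p, q) ∧
        ((∃ p', p = p' + 1 ∧ f ∈ paths n p' q) ∨ ∃ q', q = q' + 1 ∧ f ∈ paths n p q') := by
  have h0 : (0 : Fin (n + 2)) = Fin.castSucc 0 := rfl
  simp only [paths, Set.mem_ofPred_eq, Fin.forall_fin_succ', snoc_last', h0, snoc_castSucc',
    Fin.succ_last, Fin.succ_castSucc]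
  constructor
  · rintro ⟨h1, rfl, h2, h3⟩
    refine ⟨rfl, ?_⟩
    rcases h3 with h3 | h3
    · exact Or.inl ⟨_, h3.1, h1, Prod.ext rfl h3.2.symm, h2⟩
    · exact Or.inr ⟨_, h3.2, h1, Prod.ext h3.1.symm rfl, h2⟩
  · rintro ⟨rfl, ⟨p', rfl, h1, h2, h3⟩ | ⟨q', rfl, h1, h2, h3⟩⟩
    · exact ⟨h1, rfl, h3, Or.inl ⟨by rw [h2], by rw [h2]⟩⟩
    · exact ⟨h1, rfl, h3, Or.inr ⟨by rw [h2], by rw [h2]⟩⟩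

lemma weight_snoc (p : ℕ) : weight p (Fin.snoc f v : Fin (n + 2) → ℕ × ℕ) =
    weight p f + if (f (Fin.last n)).2 < v.2 then p - (f (Fin.last n)).1 else 0 := by
  rw [weight, Fin.sum_univ_castSucc]
  simp only [snoc_last', snoc_castSucc', Fin.succ_last, Fin.succ_castSucc, weight]

end Snoc

lemma weight_succ {n p q : ℕ} {f : Fin (n + 1) → ℕ × ℕ} (hf : f ∈ paths n p q) :
    weight (p + 1) f = weight p f + q := by
  refine Eq.trans ?_ (congrArg (weight p f + ·) (sum_vertical hf))
  rw [weight, weight, ← Finset.sum_add_distrib]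
  refine Finset.sum_congr rfl fun k _ => ?_
  have := (le_of_mem_paths hf k.castSucc).1
  simp only at this
  split_ifs <;> lia

variable {R : Type*} [CommRing R] {M : Type*} [AddCommGroup M] [Module R M]

variable (R) in
/-- The sum of `(-1)^m w(f)` over the paths `f` of `n` steps from `(0, 0)` to `(p - 1, q - 1)`,
where `m` is the weight of `f`, given by recursion over the last step. The indices are shifted so
that the recursion needs no separate cases on the axes. -/
def signedSum : ∀ n : ℕ, ℕ → ℕ → ((Fin (n + 1) → ℕ × ℕ) → M) → M
  | 0, 1, 1, w => w fun _ => (0, 0)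
  | n + 1, p + 1, q + 1, w =>
    (-1 : R) ^ q • signedSum n p (q + 1) (fun f => w (Fin.snoc f (p, q))) +
      signedSum n (p + 1) q (fun f => w (Fin.snoc f (p, q)))
  | _, _, _, _ => 0

lemma signedSum_succ (n p q : ℕ) (w : (Fin (n + 2) → ℕ × ℕ) → M) :
    signedSum R (n + 1) (p + 1) (q + 1) w =
      (-1 : R) ^ q • signedSum R n p (q + 1) (fun f => w (Fin.snoc f (p, q))) +
        signedSum R n (p + 1) q (fun f => w (Fin.snoc f (p, q))) :=
  rfl

lemma signedSum_zero_left (n q : ℕ) (w : (Fin (n + 1) → ℕ × ℕ) → M) :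
    signedSum R n 0 q w = 0 := by
  cases n <;> rfl

lemma signedSum_zero_right (n p : ℕ) (w : (Fin (n + 1) → ℕ × ℕ) → M) :
    signedSum R n p 0 w = 0 := by
  cases n
  · match p with
    | 0 => rfl
    | 1 => rfl
    | p + 2 => rfl
  · cases p <;> rfl

lemma sum_paths (n p q : ℕ) (w : (Fin (n + 1) → ℕ × ℕ) → M) :
    ∑ᶠ f ∈ paths n p q, (-1 : R) ^ weight p f • w f = signedSum R n (p + 1) (q + 1) w := by
  induction n generalizing p q with
  | zero =>
    have h : ∀ f : Fin 1 → ℕ × ℕ, f ∈ paths 0 p q ↔ f = (fun _ => (0, 0)) ∧ (p, q) = (0, 0) := by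
      intro f
      refine ⟨fun h => ⟨funext fun k => by rw [Subsingleton.elim k 0, h.1], h.2.1.symm.trans h.1⟩,
        fun h => ⟨by rw [h.1], by rw [h.1, h.2], fun k => k.elim0⟩⟩
    by_cases hpq : (p, q) = (0, 0)
    · obtain ⟨rfl, rfl⟩ := Prod.ext_iff.1 hpq
      have h2 : paths 0 0 0 = {fun _ => (0, 0)} := Set.ext fun f => by simp [h]
      rw [h2, finsum_mem_singleton]
      simp [weight, signedSum]
    · have h2 : paths 0 p q = ∅ := Set.ext fun f => by simp [h, hpq]
      rw [h2, finsum_mem_empty]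
      match p, q with
      | 0, 0 => simp at hpq
      | p + 1, _ => rfl
      | 0, q + 1 => rfl
  | succ n ih =>
    let s : (Fin (n + 1) → ℕ × ℕ) → Fin (n + 2) → ℕ × ℕ := fun f => Fin.snoc f (p, q)
    let A : Set (Fin (n + 1) → ℕ × ℕ) := {f | ∃ p', p = p' + 1 ∧ f ∈ paths n p' q}
    let A' : Set (Fin (n + 1) → ℕ × ℕ) := {f | ∃ q', q = q' + 1 ∧ f ∈ paths n p q'}
    have hA : ∑ᶠ f ∈ A, (-1 : R) ^ weight p (s f) • w (s f) =
        (-1 : R) ^ q • signedSum R n p (q + 1) fun f => w (s f) := by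
      cases p with
      | zero =>
        have : A = ∅ := by simp [A]
        rw [this, finsum_mem_empty, signedSum_zero_left, smul_zero]
      | succ p =>
        have : A = paths n p q := by simp [A]
        rw [this, ← ih]
        refine Eq.trans ?_ ((DistribSMul.toAddMonoidHom M ((-1 : R) ^ q)).map_finsum_mem
          (fun f => (-1 : R) ^ weight p f • w (s f)) (finite_paths n p q)).symm
        refine finsum_mem_congr rfl fun f hf => ?_
        change _ = (-1 : R) ^ q • (-1 : R) ^ weight p f • w (s f)
        rw [smul_smul, ← pow_add, weight_snoc, weight_succ hf, hf.2.1, if_neg (lt_irrefl _),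
          add_zero, add_comm q]
    have hA' : ∑ᶠ f ∈ A', (-1 : R) ^ weight p (s f) • w (s f) =
        signedSum R n (p + 1) q fun f => w (s f) := by
      cases q with
      | zero =>
        have : A' = ∅ := by simp [A']
        rw [this, finsum_mem_empty, signedSum_zero_right]
      | succ q =>
        have : A' = paths n p q := by simp [A']
        rw [this, ← ih]
        refine finsum_mem_congr rfl fun f hf => ?_
        rw [weight_snoc, hf.2.1]
        simp
    have hfin : A.Finite ∧ A'.Finite := by
      constructor
      · cases p with
        | zero => simp [A]
        | succ p => simpa [A] using finite_paths n p q
      · cases q with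
        | zero => simp [A']
        | succ q => simpa [A'] using finite_paths n p q
    have hdisj : Disjoint A A' := by
      rw [Set.disjoint_left]
      rintro f ⟨p', rfl, h1⟩ ⟨q', -, h2⟩
      have := h1.2.1.symm.trans h2.2.1
      simp at this
    have hpaths : paths (n + 1) p q = s '' (A ∪ A') := by
      ext f
      constructor
      · intro hf
        have hs : s (Fin.init f) = f := by
          have := Fin.snoc_init_self f
          rwa [hf.2.1] at this
        rw [← hs] at hf
        exact ⟨Fin.init f, ((snoc_mem_paths_iff _ _).1 hf).2, hs⟩
      · rintro ⟨f, hf, rfl⟩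
        exact (snoc_mem_paths_iff _ _).2 ⟨rfl, hf⟩
    rw [hpaths, finsum_mem_image (snoc_injective (p, q)).injOn,
      finsum_mem_union hdisj hfin.1 hfin.2, hA, hA', signedSum_succ]

lemma sum_gridTraversal (n p q : ℕ) (w : (Fin (n + 1) → ℕ × ℕ) → M) :
    ∑ z : GridTraversal n p q, (-1 : R) ^ z.weight • w (ofTraversal z) =
      signedSum R n (p + 1) (q + 1) w := by
  rw [← sum_paths, ← range_ofTraversal, finsum_mem_range (ofTraversal_injective n p q),
    finsum_eq_sum_of_fintype]
  rfl

lemma signedSum_congr (n p q : ℕ) {w w' : (Fin (n + 1) → ℕ × ℕ) → M}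
    (h : ∀ f, (∀ k, (f k).1 < p ∧ (f k).2 < q) → w f = w' f) :
    signedSum R n p q w = signedSum R n p q w' := by
  induction n generalizing p q with
  | zero =>
    match p, q with
    | 0, _ => rfl
    | _, 0 => rw [signedSum_zero_right, signedSum_zero_right]
    | 1, 1 => exact h _ fun k => ⟨Nat.one_pos, Nat.one_pos⟩
    | p + 2, _ => rfl
    | 1, q + 2 => rfl
  | succ n ih =>
    match p, q with
    | 0, _ => rfl
    | _ + 1, 0 => rfl
    | p + 1, q + 1 =>
      rw [signedSum_succ, signedSum_succ]
      refine congrArg₂ _ (congrArg _ (ih p (q + 1) fun f hf => h _ fun k => ?_))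
        (ih (p + 1) q fun f hf => h _ fun k => ?_)
      · induction k using Fin.lastCases with
        | last => rw [snoc_last']; exact ⟨p.lt_succ_self, q.lt_succ_self⟩
        | cast k => rw [snoc_castSucc']; have := hf k; lia
      · induction k using Fin.lastCases with
        | last => rw [snoc_last']; exact ⟨p.lt_succ_self, q.lt_succ_self⟩
        | cast k => rw [snoc_castSucc']; have := hf k; lia

lemma signedSum_add (n p q : ℕ) (w w' : (Fin (n + 1) → ℕ × ℕ) → M) :
    signedSum R n p q (fun f => w f + w' f) = signedSum R n p q w + signedSum R n p q w' := by
  induction n generalizing p q with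
  | zero =>
    match p, q with
    | 0, _ => exact (add_zero _).symm
    | _, 0 => simp only [signedSum_zero_right, add_zero]
    | 1, 1 => rfl
    | p + 2, _ => exact (add_zero _).symm
    | 1, q + 2 => exact (add_zero _).symm
  | succ n ih =>
    match p, q with
    | 0, _ => exact (add_zero _).symm
    | _ + 1, 0 => exact (add_zero _).symm
    | p + 1, q + 1 =>
      rw [signedSum_succ, ih, ih, signedSum_succ, signedSum_succ]
      module

lemma signedSum_smul (n p q : ℕ) (r : R) (w : (Fin (n + 1) → ℕ × ℕ) → M) :
    signedSum R n p q (fun f => r • w f) = r • signedSum R n p q w := by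
  induction n generalizing p q with
  | zero =>
    match p, q with
    | 0, _ => exact (smul_zero _).symm
    | _, 0 => simp only [signedSum_zero_right, smul_zero]
    | 1, 1 => rfl
    | p + 2, _ => exact (smul_zero _).symm
    | 1, q + 2 => exact (smul_zero _).symm
  | succ n ih =>
    match p, q with
    | 0, _ => exact (smul_zero _).symm
    | _ + 1, 0 => exact (smul_zero _).symm
    | p + 1, q + 1 =>
      rw [signedSum_succ, ih, ih, signedSum_succ]
      module

/-- The increasing function `ℕ → ℕ` that omits the value `i`. -/
def skip (i x : ℕ) : ℕ := if x < i then x else x + 1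

/-- The alternating sum of the values of `w` at the faces of `f`. -/
def boundary (R : Type*) [CommRing R] [Module R M] {n : ℕ} (w : (Fin (n + 1) → ℕ × ℕ) → M)
    (f : Fin (n + 2) → ℕ × ℕ) : M :=
  ∑ k : Fin (n + 2), (-1 : R) ^ (k : ℕ) • w fun l => f (k.succAbove l)

lemma boundary_snoc {n : ℕ} (w : (Fin (n + 2) → ℕ × ℕ) → M) (f : Fin (n + 2) → ℕ × ℕ)
    (v : ℕ × ℕ) : boundary R w (Fin.snoc f v) =
      boundary R (fun f => w (Fin.snoc f v)) f + (-1 : R) ^ n • w f := by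
  rw [boundary, boundary, Fin.sum_univ_castSucc]
  refine congrArg₂ _ (Finset.sum_congr rfl fun k _ => ?_) ?_
  · refine congrArg _ (congrArg w (funext fun l => ?_))
    induction l using Fin.lastCases with
    | last => rw [Fin.succAbove_ne_last_last (Fin.castSucc_lt_last k).ne, snoc_last', snoc_last']
    | cast l => rw [Fin.castSucc_succAbove_castSucc, snoc_castSucc', snoc_castSucc']
  · rw [Fin.val_last, pow_add, neg_one_sq, mul_one]
    refine congrArg _ (congrArg w (funext fun l => ?_))
    rw [Fin.succAbove_last, snoc_castSucc']

lemma skip_lt {i x : ℕ} (h : x < i) : skip i x = x := if_pos h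

lemma skip_ge {i x : ℕ} (h : i ≤ x) : skip i x = x + 1 := if_neg (Nat.not_lt.2 h)

/-- The path with the first coordinates moved by `skip i`. -/
def skipFst {n : ℕ} (i : ℕ) (f : Fin n → ℕ × ℕ) (k : Fin n) : ℕ × ℕ := (skip i (f k).1, (f k).2)

/-- The path with the second coordinates moved by `skip j`. -/
def skipSnd {n : ℕ} (j : ℕ) (f : Fin n → ℕ × ℕ) (k : Fin n) : ℕ × ℕ := ((f k).1, skip j (f k).2)

lemma skipFst_snoc {n : ℕ} (i : ℕ) (f : Fin (n + 1) → ℕ × ℕ) (v : ℕ × ℕ) :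
    skipFst i (Fin.snoc f v : Fin (n + 2) → ℕ × ℕ) = Fin.snoc (skipFst i f) (skip i v.1, v.2) := by
  funext k
  induction k using Fin.lastCases with
  | last => rw [skipFst, snoc_last', snoc_last']
  | cast k => rw [skipFst, snoc_castSucc', snoc_castSucc', skipFst]

lemma skipSnd_snoc {n : ℕ} (j : ℕ) (f : Fin (n + 1) → ℕ × ℕ) (v : ℕ × ℕ) :
    skipSnd j (Fin.snoc f v : Fin (n + 2) → ℕ × ℕ) = Fin.snoc (skipSnd j f) (v.1, skip j v.2) := by
  funext k
  induction k using Fin.lastCases with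
  | last => rw [skipSnd, snoc_last', snoc_last']
  | cast k => rw [skipSnd, snoc_castSucc', snoc_castSucc', skipSnd]

lemma signedSum_skipFst_self (n p q : ℕ) (w : (Fin (n + 1) → ℕ × ℕ) → M) :
    signedSum R n p q (fun f => w (skipFst p f)) = signedSum R n p q w :=
  signedSum_congr n p q fun _ hf => congrArg w (funext fun k => Prod.ext (skip_lt (hf k).1) rfl)

lemma signedSum_skipSnd_self (n p q : ℕ) (w : (Fin (n + 1) → ℕ × ℕ) → M) :
    signedSum R n p q (fun f => w (skipSnd q f)) = signedSum R n p q w :=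
  signedSum_congr n p q fun _ hf => congrArg w (funext fun k => Prod.ext rfl (skip_lt (hf k).2))

/-- The alternating sum over the faces in the first direction. -/
def sumFst (R : Type*) [CommRing R] [Module R M] (n p q : ℕ) (w : (Fin (n + 1) → ℕ × ℕ) → M) : M :=
  ∑ i ∈ Finset.range (p + 1), (-1 : R) ^ i • signedSum R n p q fun f => w (skipFst i f)

/-- The alternating sum over the faces in the second direction. -/
def sumSnd (R : Type*) [CommRing R] [Module R M] (n p q : ℕ) (w : (Fin (n + 1) → ℕ × ℕ) → M) : M :=
  ∑ j ∈ Finset.range (q + 1), (-1 : R) ^ j • signedSum R n p q fun f => w (skipSnd j f)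

lemma sumFst_zero (n q : ℕ) (w : (Fin (n + 1) → ℕ × ℕ) → M) : sumFst R n 0 q w = 0 := by
  simp [sumFst, signedSum_zero_left]

lemma sumSnd_zero (n p : ℕ) (w : (Fin (n + 1) → ℕ × ℕ) → M) : sumSnd R n p 0 w = 0 := by
  simp [sumSnd, signedSum_zero_right]

lemma sumFst_zero_right (n p : ℕ) (w : (Fin (n + 1) → ℕ × ℕ) → M) : sumFst R n p 0 w = 0 := by
  simp [sumFst, signedSum_zero_right]

lemma sumSnd_zero_left (n q : ℕ) (w : (Fin (n + 1) → ℕ × ℕ) → M) : sumSnd R n 0 q w = 0 := by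
  simp [sumSnd, signedSum_zero_left]

lemma sumFst_succ (n p q : ℕ) (w : (Fin (n + 2) → ℕ × ℕ) → M) :
    sumFst R (n + 1) (p + 1) (q + 1) w =
      (-1 : R) ^ q • sumFst R n p (q + 1) (fun f => w (Fin.snoc f (p + 1, q))) +
      sumFst R n (p + 1) q (fun f => w (Fin.snoc f (p + 1, q))) -
      (-1 : R) ^ (p + 1) • signedSum R n (p + 1) q (fun f => w (Fin.snoc f (p + 1, q))) +
      (-1 : R) ^ (p + 1) • signedSum R (n + 1) (p + 1) (q + 1) w := by
  have h : ∀ i ∈ Finset.range (p + 1),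
      (-1 : R) ^ i • signedSum R (n + 1) (p + 1) (q + 1) (fun f => w (skipFst i f)) =
      (-1 : R) ^ q • (-1 : R) ^ i • signedSum R n p (q + 1)
        (fun f => w (Fin.snoc (skipFst i f) (p + 1, q))) +
      (-1 : R) ^ i • signedSum R n (p + 1) q
        (fun f => w (Fin.snoc (skipFst i f) (p + 1, q))) := by
    intro i hi
    rw [signedSum_succ]
    simp only [skipFst_snoc, skip_ge (Nat.lt_succ_iff.1 (Finset.mem_range.1 hi))]
    module
  rw [sumFst, Finset.sum_range_succ, signedSum_skipFst_self, Finset.sum_congr rfl h,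
    Finset.sum_add_distrib, ← Finset.smul_sum]
  rw [sumFst, sumFst, Finset.sum_range_succ _ (p + 1),
    signedSum_skipFst_self n (p + 1) q (fun f => w (Fin.snoc f (p + 1, q)))]
  module

lemma sumSnd_succ (n p q : ℕ) (w : (Fin (n + 2) → ℕ × ℕ) → M) :
    sumSnd R (n + 1) (p + 1) (q + 1) w =
      (-1 : R) ^ q • (sumSnd R n p (q + 1) (fun f => w (Fin.snoc f (p, q + 1))) -
        (-1 : R) ^ (q + 1) • signedSum R n p (q + 1) (fun f => w (Fin.snoc f (p, q + 1)))) +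
      sumSnd R n (p + 1) q (fun f => w (Fin.snoc f (p, q + 1))) +
      (-1 : R) ^ (q + 1) • signedSum R (n + 1) (p + 1) (q + 1) w := by
  have h : ∀ j ∈ Finset.range (q + 1),
      (-1 : R) ^ j • signedSum R (n + 1) (p + 1) (q + 1) (fun f => w (skipSnd j f)) =
      (-1 : R) ^ q • (-1 : R) ^ j • signedSum R n p (q + 1)
        (fun f => w (Fin.snoc (skipSnd j f) (p, q + 1))) +
      (-1 : R) ^ j • signedSum R n (p + 1) q
        (fun f => w (Fin.snoc (skipSnd j f) (p, q + 1))) := by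
    intro j hj
    rw [signedSum_succ]
    simp only [skipSnd_snoc, skip_ge (Nat.lt_succ_iff.1 (Finset.mem_range.1 hj))]
    module
  rw [sumSnd, Finset.sum_range_succ, signedSum_skipSnd_self, Finset.sum_congr rfl h,
    Finset.sum_add_distrib, ← Finset.smul_sum]
  rw [sumSnd, sumSnd, Finset.sum_range_succ _ (q + 1),
    signedSum_skipSnd_self n p (q + 1) (fun f => w (Fin.snoc f (p, q + 1)))]
  module

lemma signedSum_one_one (w : (Fin 1 → ℕ × ℕ) → M) :
    signedSum R 0 1 1 w = w fun _ => (0, 0) :=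
  rfl

lemma skipFst_const {n : ℕ} (i : ℕ) (v : ℕ × ℕ) :
    skipFst i (fun _ : Fin n => v) = fun _ => (skip i v.1, v.2) :=
  rfl

lemma skipSnd_const {n : ℕ} (j : ℕ) (v : ℕ × ℕ) :
    skipSnd j (fun _ : Fin n => v) = fun _ => (v.1, skip j v.2) :=
  rfl

lemma boundary_zero (w : (Fin 1 → ℕ × ℕ) → M) (f : Fin 2 → ℕ × ℕ) :
    boundary R w f = w (fun _ => f 1) - w (fun _ => f 0) := by
  have h : ∀ g : Fin 1 → ℕ × ℕ, w g = w fun _ => g 0 := fun g =>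
    congrArg w (funext fun k => congrArg g (Subsingleton.elim _ _))
  rw [boundary, Fin.sum_univ_two, h, h fun l => f (Fin.succAbove 1 l)]
  simp [sub_eq_add_neg]

/-- The signed sum over the grid paths turns the boundary of paths into the boundaries of the two
sides of the grid. Omitting a vertex at which a path turns gives a term that cancels with that of
the path turning the other way there. The induction on the last step needs no explicit matching of
these terms. -/
lemma signedSum_boundary (n p q : ℕ) (hpq : p + q = n + 1) (w : (Fin (n + 1) → ℕ × ℕ) → M) :
    signedSum R (n + 1) (p + 1) (q + 1) (boundary R w) =
      sumFst R n p (q + 1) w + (-1 : R) ^ p • sumSnd R n (p + 1) q w := by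
  induction n generalizing p q with
  | zero =>
    match p, q with
    | 0, 0 => simp at hpq
    | 0, 1 =>
      refine Eq.trans (b := w (fun _ => (0, 1)) - w (fun _ => (0, 0))) ?_ ?_
      · refine Eq.trans ?_ (boundary_zero (R := R) w (Fin.snoc (fun _ => (0, 0)) (0, 1)))
        rw [signedSum_succ, signedSum_zero_left, smul_zero, zero_add]
        rfl
      · simp only [sumFst_zero, sumSnd, Finset.sum_range_succ, Finset.sum_range_zero, zero_add,
          signedSum_one_one, skipSnd_const, skip]
        simp [sub_eq_add_neg]
    | 1, 0 =>
      refine Eq.trans (b := w (fun _ => (1, 0)) - w (fun _ => (0, 0))) ?_ ?_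
      · refine Eq.trans ?_ (boundary_zero (R := R) w (Fin.snoc (fun _ => (0, 0)) (1, 0)))
        rw [signedSum_succ, signedSum_zero_right, pow_zero, one_smul, add_zero]
        rfl
      · simp only [sumSnd_zero, sumFst, Finset.sum_range_succ, Finset.sum_range_zero, zero_add,
          signedSum_one_one, skipFst_const, skip]
        simp [sub_eq_add_neg]
    | p + 2, _ => lia
    | _, q + 2 => lia
    | 1, 1 => lia
  | succ n ih =>
    have h1 (f : Fin (n + 2) → ℕ × ℕ) : boundary R w (Fin.snoc f (p, q)) = _ :=
      boundary_snoc w f (p, q)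
    rw [signedSum_succ]
    simp only [h1, signedSum_add, signedSum_smul]
    match p, q with
    | 0, 0 => simp at hpq
    | 0, q + 1 =>
      obtain rfl : q = n + 1 := by lia
      rw [ih 0 (n + 1) (by lia), sumSnd_succ]
      simp only [signedSum_zero_left, sumFst_zero, sumSnd_zero_left]
      rcases neg_one_pow_eq_or R n with hn | hn <;>
      · simp only [pow_succ, pow_zero, hn]
        module
    | p + 1, 0 =>
      obtain rfl : p = n + 1 := by lia
      rw [ih (n + 1) 0 (by lia), sumFst_succ]
      simp only [signedSum_zero_right, sumSnd_zero, sumFst_zero_right]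
      rcases neg_one_pow_eq_or R n with hn | hn <;>
      · simp only [pow_succ, pow_zero, hn]
        module
    | p + 1, q + 1 =>
      obtain rfl : p + q = n := by lia
      rw [ih p (q + 1) (by lia), ih (p + 1) q (by lia), sumFst_succ, sumSnd_succ]
      rcases neg_one_pow_eq_or R p with hp | hp <;> rcases neg_one_pow_eq_or R q with hq | hq <;>
      · simp only [pow_succ, pow_add, hp, hq]
        module

end GridPath

namespace GridPath

variable {R : Type*} [CommRing R] {M : Type*} [AddCommGroup M] [Module R M]

/-- A function on the paths in the `p × q` grid, given by their two coordinates, extended by zero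
to all maps to `ℕ × ℕ`. -/
noncomputable def extend {n p q : ℕ}
    (w : (Fin (n + 1) →o Fin (p + 1)) → (Fin (n + 1) →o Fin (q + 1)) → M)
    (f : Fin (n + 1) → ℕ × ℕ) : M :=
  open Classical in
  if h : Monotone f ∧ ∀ k, f k ≤ (p, q) then
    w ⟨fun k => ⟨(f k).1, Nat.lt_succ_of_le (h.2 k).1⟩, fun _ _ e => (h.1 e).1⟩
      ⟨fun k => ⟨(f k).2, Nat.lt_succ_of_le (h.2 k).2⟩, fun _ _ e => (h.1 e).2⟩
  else 0

lemma extend_apply {n p q : ℕ}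
    (w : (Fin (n + 1) →o Fin (p + 1)) → (Fin (n + 1) →o Fin (q + 1)) → M)
    (i : Fin (n + 1) →o Fin (p + 1)) (j : Fin (n + 1) →o Fin (q + 1)) (f : Fin (n + 1) → ℕ × ℕ)
    (hi : ∀ k, (f k).1 = i k) (hj : ∀ k, (f k).2 = j k) : extend w f = w i j := by
  obtain rfl : f = fun k => ((i k : ℕ), (j k : ℕ)) := funext fun k => Prod.ext (hi k) (hj k)
  exact dif_pos ⟨fun k l e => ⟨i.monotone e, j.monotone e⟩,
    fun k => ⟨Nat.le_of_lt_succ (i k).2, Nat.le_of_lt_succ (j k).2⟩⟩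

lemma succAbove_eq_skip {n : ℕ} (i : Fin (n + 1)) (x : Fin n) : (i.succAbove x : ℕ) = skip i x := by
  by_cases h : x.castSucc < i
  · rw [Fin.succAbove_of_castSucc_lt _ _ h, skip_lt (show (x : ℕ) < i from h)]
    rfl
  · rw [Fin.succAbove_of_le_castSucc _ _ (not_lt.1 h), skip_ge (show (i : ℕ) ≤ x from not_lt.1 h)]
    rfl

/-- The sum of `(-1)^{m(z)} w(z)` over the traversals `z` of the `p × q` grid. -/
noncomputable def traversalSum (R : Type*) [CommRing R] [Module R M] {n p q : ℕ}
    (w : (Fin (n + 1) →o Fin (p + 1)) → (Fin (n + 1) →o Fin (q + 1)) → M) : M :=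
  ∑ z : GridTraversal n p q, (-1 : R) ^ z.weight • w z.i z.j

lemma map_smul_traversalSum {N : Type*} [AddCommGroup N] [Module R N] (φ : M →ₗ[R] N) {n p q : ℕ}
    (w : (Fin (n + 1) →o Fin (p + 1)) → (Fin (n + 1) →o Fin (q + 1)) → M)
    (w' : (Fin (n + 1) →o Fin (p + 1)) → (Fin (n + 1) →o Fin (q + 1)) → N)
    (h : ∀ f g, φ (w f g) = w' f g) (r : R) :
    φ (r • traversalSum R w) = r • traversalSum R w' := by
  simp only [traversalSum, map_smul, map_sum, h]

lemma traversalSum_eq {n p q : ℕ}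
    (w : (Fin (n + 1) →o Fin (p + 1)) → (Fin (n + 1) →o Fin (q + 1)) → M)
    (w' : (Fin (n + 1) → ℕ × ℕ) → M)
    (h : ∀ z : GridTraversal n p q, w z.i z.j = w' (ofTraversal z)) :
    traversalSum R w = signedSum R n (p + 1) (q + 1) w' := by
  rw [← sum_gridTraversal]
  exact Finset.sum_congr rfl fun z _ => congrArg _ (h z)

lemma sumFst_extend {n p q : ℕ}
    (w : (Fin (n + 1) →o Fin (p + 2)) → (Fin (n + 1) →o Fin (q + 1)) → M) :
    sumFst R n (p + 1) (q + 1) (extend w) = ∑ i : Fin (p + 2), (-1 : R) ^ (i : ℕ) •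
      traversalSum R fun f g => w (i.succAboveOrderEmb.toOrderHom.comp f) g := by
  rw [sumFst, Finset.sum_range]
  refine Finset.sum_congr rfl fun i _ => congrArg _ (traversalSum_eq _ _ fun z => ?_).symm
  exact (extend_apply w _ _ _ (fun k => (succAbove_eq_skip i (z.i k)).symm) fun k => rfl).symm

lemma sumSnd_extend {n p q : ℕ}
    (w : (Fin (n + 1) →o Fin (p + 1)) → (Fin (n + 1) →o Fin (q + 2)) → M) :
    sumSnd R n (p + 1) (q + 1) (extend w) = ∑ j : Fin (q + 2), (-1 : R) ^ (j : ℕ) •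
      traversalSum R fun f g => w f (j.succAboveOrderEmb.toOrderHom.comp g) := by
  rw [sumSnd, Finset.sum_range]
  refine Finset.sum_congr rfl fun j _ => congrArg _ (traversalSum_eq _ _ fun z => ?_).symm
  exact (extend_apply w _ _ _ (fun k => rfl) (fun k => (succAbove_eq_skip j (z.j k)).symm)).symm

/-- `signedSum_boundary` for functions on the coordinates of grid paths. -/
lemma traversalSum_boundary {n p q : ℕ} (hpq : p + q = n + 1)
    (w : (Fin (n + 1) →o Fin (p + 1)) → (Fin (n + 1) →o Fin (q + 1)) → M) :
    (traversalSum R fun (f : Fin (n + 2) →o Fin (p + 1)) (g : Fin (n + 2) →o Fin (q + 1)) =>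
      ∑ k : Fin (n + 2), (-1 : R) ^ (k : ℕ) • w (f.comp k.succAboveOrderEmb.toOrderHom)
        (g.comp k.succAboveOrderEmb.toOrderHom)) =
      sumFst R n p (q + 1) (extend w) + (-1 : R) ^ p • sumSnd R n (p + 1) q (extend w) := by
  rw [← signedSum_boundary n p q hpq]
  refine traversalSum_eq _ _ fun z => Finset.sum_congr rfl fun k _ => congrArg _ ?_
  exact (extend_apply w _ _ _ (fun k => rfl) fun k => rfl).symm

end GridPath

namespace Sh

variable {R : Type u} [CommRing R]

lemma Hom.ext' {X Y : Sh R} {γ δ : X ⟶ Y} (h : γ.base = δ.base)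
    (h' : ∀ y : Y.cat, γ.map.app (op y) =
      X.sheaf.map (eqToHom (Functor.congr_obj h y).symm).op ≫ δ.map.app (op y)) : γ = δ := by
  obtain ⟨b, m⟩ := γ
  obtain ⟨b', m'⟩ := δ
  obtain rfl : b = b' := h
  refine congrArg (Hom.mk b) (NatTrans.ext (funext fun y => (h' y.unop).trans ?_))
  exact (congrArg (· ≫ _) (X.sheaf.map_id _)).trans (Category.id_comp _)

end Sh

namespace SheafBundle

variable {R : Type u} [CommRing R] {B : Type u} [SmallCategory B] (ξ : SheafBundle R B)

/-! ### Sheaves on the total category as bundles -/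

/-- The inclusion of a fibre in the total category. -/
def fibInclusion (x : B) : ξ.Fib x ⥤ ξ.Total where
  obj y := ⟨⟨x, y⟩⟩
  map k := ξ.fibArrow k
  map_id y := ξ.fibArrow_id y
  map_comp k l := ξ.fibArrow_comp k l

lemma liftArrow_id_eq_fibArrow {x : B} (y : ξ.Fib x) (h : y = (ξ.push (𝟙 x)).obj y) :
    ξ.liftArrow (𝟙 x) y _ rfl = ξ.fibArrow (eqToHom h) := by
  rw [← ξ.liftArrow_fibArrow_eqToHom (𝟙 x) y h.symm h, liftArrow_id, Category.id_comp]

lemma liftArrow_comp_eq {x₁ x₂ x₃ : B} (f : x₁ ⟶ x₂) (g : x₂ ⟶ x₃) (y : ξ.Fib x₁)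
    (h : (ξ.push g).obj ((ξ.push f).obj y) = (ξ.push (f ≫ g)).obj y) :
    ξ.liftArrow (f ≫ g) y _ rfl =
      (ξ.liftArrow f y _ rfl ≫ ξ.liftArrow g _ _ rfl) ≫ ξ.fibArrow (eqToHom h) := by
  rw [← ξ.liftArrow_fibArrow_eqToHom (f ≫ g) y h.symm h, ← liftArrow_comp]

lemma liftArrow_eqToHom {x₁ x₂ : B} (f : x₁ ⟶ x₂) (y₁ : ξ.Fib x₁) (y₂ y₃ : ξ.Fib x₂)
    (h : (ξ.push f).obj y₁ = y₂) (h' : (ξ.push f).obj y₁ = y₃)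
    (e : (⟨⟨x₂, y₂⟩⟩ : ξ.Total) = ⟨⟨x₂, y₃⟩⟩) :
    ξ.liftArrow f y₁ y₂ h ≫ eqToHom e = ξ.liftArrow f y₁ y₃ h' := by
  subst h
  subst h'
  exact Category.comp_id _

lemma fibArrow_liftArrow_congr {E : Type*} [Category E] {x₁ x₂ : B} (s : x₁ ⟶ x₂)
    {Φ₁ Φ₁' : E ⥤ ξ.Fib x₁} (h₁ : Φ₁ = Φ₁') {Φ₂ Φ₂' : E ⥤ ξ.Fib x₂} (h₂ : Φ₂ = Φ₂') {d d' : E}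
    (t : d ⟶ d') (h : (ξ.push s).obj (Φ₁.obj d') = Φ₂.obj d')
    (h' : (ξ.push s).obj (Φ₁'.obj d') = Φ₂'.obj d') :
    ξ.fibArrow (Φ₁.map t) ≫ ξ.liftArrow s _ _ h =
      eqToHom (by rw [h₁]) ≫ (ξ.fibArrow (Φ₁'.map t) ≫ ξ.liftArrow s _ _ h') ≫
        eqToHom (by rw [h₂]) := by
  subst h₁ h₂
  simp

variable (G : ξ.Totalᵒᵖ ⥤ ModuleCat.{u} R)

/-- The bundle with the fibre categories of `ξ` and the restrictions to them of a sheaf `G` on the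
total category. -/
def restrict : SheafBundle R B where
  obj x := { cat := ξ.Fib x.unop, sheaf := (ξ.fibInclusion x.unop).op ⋙ G }
  map {x x'} f :=
    { base := (ξ.map f).base
      map :=
        { app := fun y => G.map (ξ.liftArrow f.unop y.unop _ rfl).op
          naturality := fun y y' k =>
            (G.map_comp _ _).symm.trans ((congrArg (fun h => G.map (Quiver.Hom.op h))
              (ξ.fibArrow_comp_liftArrow f.unop k.unop).symm).trans (G.map_comp _ _)) } }
  map_id x := by
    refine Sh.Hom.ext' (ξ.push_id x.unop) fun y => ?_
    refine Eq.trans ?_ (Category.comp_id _).symm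
    refine congrArg (fun h => G.map (Quiver.Hom.op h)) ?_
    exact ξ.liftArrow_id_eq_fibArrow _ (Functor.congr_obj (ξ.push_id x.unop) y).symm
  map_comp {x x' x''} f g := by
    have hb : (ξ.map (f ≫ g)).base = (ξ.map g).base ⋙ (ξ.map f).base :=
      congrArg Sh.Hom.base (ξ.map_comp f g)
    refine Sh.Hom.ext' hb fun y => ?_
    refine Eq.trans ?_ (congrArg (_ ≫ ·) (G.map_comp _ _))
    refine Eq.trans ?_ (G.map_comp _ _)
    refine congrArg (fun h => G.map (Quiver.Hom.op h)) ?_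
    exact ξ.liftArrow_comp_eq g.unop f.unop y (Functor.congr_obj hb y).symm

/-- The total category with a sheaf. -/
abbrev totalWith : Sh R where
  cat := ξ.Total
  sheaf := G

section Grid

variable {G} {n p q : ℕ} (σ : ComposableArrows B p) (τ : ComposableArrows (ξ.Fib (σ.obj 0)) q)

/-- The grid of `(σ, τ)` commutes: the arrow from the origin to a vertex may be factored through any
smaller vertex. -/
lemma fromOrigin_comp {i i' : Fin (p + 1)} {j j' : Fin (q + 1)} (hi : i ≤ i') (hj : j ≤ j') :
    ξ.fromOrigin σ τ i j ≫ ξ.gridVert σ τ i hj ≫ ξ.gridHor σ τ hi j' =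
      ξ.fromOrigin σ τ i' j' := by
  have h1 : ξ.liftArrow (σ.map (homOfLE (Fin.zero_le i))) (τ.obj j) _ rfl ≫ ξ.gridVert σ τ i hj =
      ξ.fibArrow (τ.map (homOfLE hj)) ≫ ξ.liftArrow (σ.map (homOfLE (Fin.zero_le i))) _ _ rfl :=
    (ξ.fibArrow_comp_liftArrow _ _).symm
  have h2 : ξ.liftArrow (σ.map (homOfLE (Fin.zero_le i))) (τ.obj j') _ rfl ≫ ξ.gridHor σ τ hi j' =
      ξ.liftArrow (σ.map (homOfLE (Fin.zero_le i'))) _ _ rfl :=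
    ((ξ.liftArrow_congr (σ.map_comp _ (homOfLE hi)) _ _ _).trans
      (ξ.liftArrow_comp _ _ _ _ _ _ _ _)).symm
  rw [fromOrigin, Category.assoc, reassoc_of% h1, h2, ← Category.assoc, ← fibArrow_comp,
    ← Functor.map_comp]
  rfl

/-- The value of a cochain at the chain of the grid of `(σ, τ)` with given coordinates, moved to
the origin of the grid. -/
def gridValue (f : Fin (n + 1) →o Fin (p + 1)) (g : Fin (n + 1) →o Fin (q + 1)) :
    (ξ.totalWith G).Cochain n →ₗ[R] G.obj (op ⟨⟨σ.obj 0, τ.obj 0⟩⟩) :=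
  (G.map (ξ.fromOrigin σ τ (f 0) (g 0)).op).hom ∘ₗ LinearMap.proj (ξ.gridChain σ τ f g)

lemma gridValue_apply (f : Fin (n + 1) →o Fin (p + 1)) (g : Fin (n + 1) →o Fin (q + 1))
    (u : (ξ.totalWith G).Cochain n) : ξ.gridValue σ τ f g u =
      G.map (ξ.fromOrigin σ τ (f 0) (g 0)).op (u (ξ.gridChain σ τ f g)) :=
  rfl

lemma gridValue_diff (f : Fin (n + 2) →o Fin (p + 1)) (g : Fin (n + 2) →o Fin (q + 1))
    (u : (ξ.totalWith G).Cochain n) : ξ.gridValue σ τ f g ((ξ.totalWith G).diff n u) =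
      ∑ k : Fin (n + 2), (-1 : R) ^ (k : ℕ) • ξ.gridValue σ τ
        (f.comp k.succAboveOrderEmb.toOrderHom) (g.comp k.succAboveOrderEmb.toOrderHom) u := by
  rw [gridValue_apply, Sh.diff_apply]
  refine (map_sum (G.map (ξ.fromOrigin σ τ (f 0) (g 0)).op).hom _ _).trans ?_
  refine Finset.sum_congr rfl fun k _ => ?_
  refine (map_smul (G.map (ξ.fromOrigin σ τ (f 0) (g 0)).op).hom _ _).trans (congrArg _ ?_)
  refine ((ξ.totalWith G).map_map_apply _ _ _).trans ?_
  refine (ξ.totalWith G).map_apply_congr u rfl _ _ ?_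
  refine (Category.comp_id _).trans ?_
  exact ξ.fromOrigin_comp σ τ (f.monotone (Fin.zero_le _)) (g.monotone (Fin.zero_le _))

lemma gridValue_face_right (f : Fin (n + 1) →o Fin (p + 1)) (g : Fin (n + 1) →o Fin (q + 1))
    (τ : ComposableArrows (ξ.Fib (σ.obj 0)) (q + 1))
    (j : Fin (q + 2)) (u : (ξ.totalWith G).Cochain n) :
    G.map (ξ.fibArrow (τ.faceArrow j)).op (ξ.gridValue σ (τ.face j) f g u) =
      ξ.gridValue σ τ f (j.succAboveOrderEmb.toOrderHom.comp g) u := by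
  refine ((ξ.totalWith G).map_map_apply _ _ _).trans ?_
  refine (ξ.totalWith G).map_apply_congr u (σ := ξ.gridChain σ (τ.face j) f g)
    (τ := ξ.gridChain σ τ f (j.succAboveOrderEmb.toOrderHom.comp g)) rfl _ _ ?_
  refine (Category.comp_id _).trans ?_
  refine (Category.assoc _ _ _).symm.trans (congrArg (· ≫ _) ?_)
  refine (ξ.fibArrow_comp _ _).symm.trans (congrArg ξ.fibArrow ?_)
  exact (τ.map_comp _ _).symm

lemma gridChain_face_left (f : Fin (n + 1) →o Fin (p + 1)) (g : Fin (n + 1) →o Fin (q + 1))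
    (σ : ComposableArrows B (p + 1)) (τ : ComposableArrows (ξ.Fib (σ.obj 0)) q) (i : Fin (p + 2)) :
    ξ.gridChain (σ.face i) (τ ⋙ ξ.push (σ.faceArrow i)) f g =
      ξ.gridChain σ τ (i.succAboveOrderEmb.toOrderHom.comp f) g := by
  have h (k : Fin (p + 1)) : ξ.push (σ.faceArrow i) ⋙ ξ.pushTo (σ.face i) k =
      ξ.pushTo σ (i.succAboveOrderEmb k) :=
    ξ.push_comp _ _ _ (σ.map_comp _ _).symm
  refine CategoryTheory.Functor.ext (fun k => ?_) fun k l e => ?_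
  · exact congrArg (fun Φ => (⟨⟨_, Φ⟩⟩ : ξ.Total)) (Functor.congr_obj (h (f k)) (τ.obj (g k)))
  · exact ξ.fibArrow_liftArrow_congr _ (h (f k)) (h (f l)) _ _ _

lemma gridValue_face_left (f : Fin (n + 1) →o Fin (p + 1)) (g : Fin (n + 1) →o Fin (q + 1))
    (σ : ComposableArrows B (p + 1)) (τ : ComposableArrows (ξ.Fib (σ.obj 0)) q)
    (i : Fin (p + 2)) (u : (ξ.totalWith G).Cochain n) :
    G.map (ξ.liftArrow (σ.faceArrow i) (τ.obj 0) _ rfl).op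
        (ξ.gridValue (σ.face i) (τ ⋙ ξ.push (σ.faceArrow i)) f g u) =
      ξ.gridValue σ τ (i.succAboveOrderEmb.toOrderHom.comp f) g u := by
  refine ((ξ.totalWith G).map_map_apply _ _ _).trans ?_
  refine (ξ.totalWith G).map_apply_congr u (ξ.gridChain_face_left f g σ τ i) _ _ ?_
  have h1 : ξ.liftArrow (σ.faceArrow i) (τ.obj 0) _ rfl ≫
      ξ.fibArrow ((ξ.push (σ.faceArrow i)).map (τ.map (homOfLE (Fin.zero_le (g 0))))) =
      ξ.fibArrow (τ.map (homOfLE (Fin.zero_le (g 0)))) ≫ ξ.liftArrow (σ.faceArrow i) _ _ rfl :=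
    (ξ.fibArrow_comp_liftArrow _ _).symm
  refine (Category.assoc _ _ _).trans ?_
  refine (congrArg (_ ≫ ·) (Category.assoc _ _ _)).trans ?_
  refine (Category.assoc _ _ _).symm.trans ?_
  refine (congrArg (· ≫ _) h1).trans ?_
  refine (Category.assoc _ _ _).trans (congrArg (_ ≫ ·) ?_)
  refine (Category.assoc _ _ _).symm.trans ?_
  refine (congrArg (· ≫ _) (ξ.liftArrow_comp _ _ _ _ _ rfl rfl
    (Functor.congr_obj (ξ.push_comp _ _ _ rfl) (τ.obj (g 0))).symm).symm).trans ?_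
  refine (ξ.liftArrow_eqToHom _ _ _ _ _
    (congrArg (fun s => (ξ.push s).obj (τ.obj (g 0))) (σ.map_comp _ _).symm) _).trans ?_
  exact ξ.liftArrow_congr (σ.map_comp _ _).symm _ _ _

end Grid

/-- The grid traversal map for a sheaf on the total category; `(q + 1) / 2` is `⌈q / 2⌉`. -/
noncomputable def traversal (n : ℕ) : (ξ.totalWith G).Cochain n →ₗ[R] (ξ.restrict G).TotObj n :=
  LinearMap.pi fun a => LinearMap.pi fun σ => LinearMap.pi fun τ =>
    (-1 : R) ^ ((a.1.2 + 1) / 2) •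
      ∑ z : GridTraversal n a.1.1 a.1.2, (-1 : R) ^ z.weight • ξ.gridValue σ τ z.i z.j

variable {G} in
lemma traversal_apply (n p q : ℕ) (h : p + q = n) (u : (ξ.totalWith G).Cochain n)
    (σ : ComposableArrows B p) (τ : ComposableArrows (ξ.Fib (σ.obj 0)) q) :
    (ξ.traversal G n u ⟨(p, q), h⟩ : ((ξ.restrict G).row q).Cochain p) σ τ =
      (-1 : R) ^ ((q + 1) / 2) • GridPath.traversalSum R fun f g => ξ.gridValue σ τ f g u := by
  have h : (∑ z : GridTraversal n p q, (-1 : R) ^ z.weight • ξ.gridValue σ τ z.i z.j) u =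
      GridPath.traversalSum R fun f g => ξ.gridValue σ τ f g u :=
    LinearMap.sum_apply _ _ _
  exact congrArg ((-1 : R) ^ ((q + 1) / 2) • ·) h

variable {G}

lemma totHor_traversal (n p q : ℕ) (h : p + 1 + q = n + 1) (u : (ξ.totalWith G).Cochain n)
    (σ : ComposableArrows B (p + 1)) (τ : ComposableArrows (ξ.Fib (σ.obj 0)) q) :
    ((ξ.restrict G).totHor n (p + 1) q h (ξ.traversal G n u) :
        ((ξ.restrict G).row q).Cochain (p + 1)) σ τ =
      (-1 : R) ^ ((q + 1) / 2) • ∑ i : Fin (p + 2), (-1 : R) ^ (i : ℕ) •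
        GridPath.traversalSum R fun f g =>
          ξ.gridValue σ τ (i.succAboveOrderEmb.toOrderHom.comp f) g u := by
  refine (congrFun (congrFun ((ξ.restrict G).dHor_apply p q
    (ξ.traversal G n u ⟨(p, q), by lia⟩)) σ) τ).trans ?_
  refine (congrFun (((ξ.restrict G).row q).diff_apply p _ σ) τ).trans ?_
  refine (Finset.sum_apply τ _ _).trans ?_
  rw [Finset.smul_sum]
  refine Finset.sum_congr rfl fun i _ => ?_
  rw [smul_comm]
  refine congrArg (fun v : G.obj (op ⟨⟨σ.obj 0, τ.obj 0⟩⟩) => (-1 : R) ^ (i : ℕ) • v) ?_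
  let F := G.map (ξ.liftArrow (σ.faceArrow i) (τ.obj 0) _ rfl).op
  refine (congrArg F (ξ.traversal_apply n p q (by lia) u (σ.face i)
    (τ ⋙ ξ.push (σ.faceArrow i)))).trans ?_
  exact GridPath.map_smul_traversalSum F.hom _ _
    (fun f g => ξ.gridValue_face_left f g σ τ i u) _

lemma totVert_traversal (n p q : ℕ) (h : p + (q + 1) = n + 1) (u : (ξ.totalWith G).Cochain n)
    (σ : ComposableArrows B p) (τ : ComposableArrows (ξ.Fib (σ.obj 0)) (q + 1)) :
    ((ξ.restrict G).totVert n p (q + 1) h (ξ.traversal G n u) :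
        ((ξ.restrict G).row (q + 1)).Cochain p) σ τ =
      (-1 : R) ^ ((q + 1) / 2) • ∑ j : Fin (q + 2), (-1 : R) ^ (j : ℕ) •
        GridPath.traversalSum R fun f g =>
          ξ.gridValue σ τ f (j.succAboveOrderEmb.toOrderHom.comp g) u := by
  refine (congrFun ((ξ.restrict G).dVert_apply p q
    (ξ.traversal G n u ⟨(p, q), by lia⟩) σ) τ).trans ?_
  refine (((ξ.restrict G).obj (op (σ.obj 0))).diff_apply q _ τ).trans ?_
  rw [Finset.smul_sum]
  refine Finset.sum_congr rfl fun j _ => ?_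
  rw [smul_comm]
  refine congrArg (fun v : G.obj (op ⟨⟨σ.obj 0, τ.obj 0⟩⟩) => (-1 : R) ^ (j : ℕ) • v) ?_
  let F := G.map (ξ.fibArrow (τ.faceArrow j)).op
  refine (congrArg F (ξ.traversal_apply n p q (by lia) u σ (τ.face j))).trans ?_
  exact GridPath.map_smul_traversalSum F.hom _ _
    (fun f g => ξ.gridValue_face_right σ f g τ j u) _

/-- The grid traversal of a differential is a sum over the sides of the grid in the two directions.
For `q = 0` there is no side in the second direction. -/
lemma traversal_diff_apply (n p q : ℕ) (h : p + q = n + 1) (u : (ξ.totalWith G).Cochain n)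
    (σ : ComposableArrows B p) (τ : ComposableArrows (ξ.Fib (σ.obj 0)) q) :
    (ξ.traversal G (n + 1) ((ξ.totalWith G).diff n u) ⟨(p, q), h⟩ :
        ((ξ.restrict G).row q).Cochain p) σ τ =
      (-1 : R) ^ ((q + 1) / 2) •
        GridPath.sumFst R n p (q + 1) (GridPath.extend fun f g => ξ.gridValue σ τ f g u) +
      (-1 : R) ^ (p + q) • if q = 0 then 0 else (-1 : R) ^ (q / 2) •
        GridPath.sumSnd R n (p + 1) q (GridPath.extend fun f g => ξ.gridValue σ τ f g u) := by
  have hb : (GridPath.traversalSum R fun f g => ξ.gridValue σ τ f g ((ξ.totalWith G).diff n u)) =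
      GridPath.sumFst R n p (q + 1) (GridPath.extend fun f g => ξ.gridValue σ τ f g u) +
      (-1 : R) ^ p •
        GridPath.sumSnd R n (p + 1) q (GridPath.extend fun f g => ξ.gridValue σ τ f g u) := by
    simp only [gridValue_diff]
    exact GridPath.traversalSum_boundary h fun f g => ξ.gridValue σ τ f g u
  refine (ξ.traversal_apply (n + 1) p q h _ σ τ).trans ?_
  rw [hb, smul_add, smul_smul]
  refine congrArg₂ (· + ·) rfl ?_
  cases q with
  | zero => rw [GridPath.sumSnd_zero, if_pos rfl, smul_zero, smul_zero]
  | succ q =>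
    rw [if_neg q.succ_ne_zero, smul_smul, ← pow_add, ← pow_add]
    -- the signs agree because `⌈q / 2⌉ + ⌊q / 2⌋ = q`
    refine congrArg (· • _) (neg_one_pow_congr ?_)
    rw [Nat.even_iff, Nat.even_iff]
    lia

lemma totD_traversal (n : ℕ) (u : (ξ.totalWith G).Cochain n) :
    (ξ.restrict G).totD n (ξ.traversal G n u) =
      ξ.traversal G (n + 1) ((ξ.totalWith G).diff n u) := by
  funext ⟨⟨p, q⟩, h⟩
  funext σ τ
  refine Eq.trans ?_ (ξ.traversal_diff_apply n p q h u σ τ).symm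
  refine congrArg₂ (fun a b : G.obj (op ⟨⟨_, τ.obj 0⟩⟩) => a + (-1 : R) ^ (p + q) • b) ?_ ?_
  · cases p with
    | zero =>
      rw [GridPath.sumFst_zero, smul_zero]
      rfl
    | succ p =>
      rw [GridPath.sumFst_extend]
      exact ξ.totHor_traversal n p q h u σ τ
  · cases q with
    | zero => rfl
    | succ q =>
      rw [if_neg q.succ_ne_zero, GridPath.sumSnd_extend]
      exact ξ.totVert_traversal n p q h u σ τ

variable (G) in
/-- The grid traversal map for a sheaf on the total category, as a map of complexes. -/
noncomputable def traversalHom : Sh.cochainComplex.obj (ξ.totalWith G) ⟶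
    (ξ.restrict G).totalComplex where
  f n := ModuleCat.ofHom (ξ.traversal G n)
  comm' i j h := by
    obtain rfl : i + 1 = j := h
    ext u
    rw [totalComplex_d, Sh.cochainComplex_d]
    exact ξ.totD_traversal i u

end SheafBundle

/-! ### Vanishing of the cohomology of a filtered complex -/

namespace CanonicallyBoundedFiltration

variable {R : Type u} [CommRing R] {K : CochainComplex (ModuleCat.{u} R) ℕ}
  (F : CanonicallyBoundedFiltration K)

/-- If `E_2^{p,q}` vanishes for `p + q = n`, then every cycle of degree `n` is a boundary. -/
lemma exists_d_eq_of_subsingleton_page {n : ℕ} (h : ∀ p ≤ n, Subsingleton (F.Page 2 p n))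
    (x : K.X n) (hx : K.d n (n + 1) x = 0) : ∃ m y, K.d m n y = x := by
  -- modulo boundaries, `x` can be moved step by step to the end of the filtration
  have key : ∀ p ≤ n + 1, ∃ a ∈ F.fil p n, K.d n (n + 1) a = 0 ∧ ∃ y, x = a + K.d (n - 1) n y := by
    intro p hp
    induction p with
    | zero => exact ⟨x, F.mem_fil_zero rfl x, hx, 0, by rw [map_zero, add_zero]⟩
    | succ p ih =>
      obtain ⟨a, ha, hda, y, hy⟩ := ih (by lia)
      have hac : a ∈ F.approxCycles 2 p n := ⟨ha, by
        change K.d n (n + 1) a ∈ F.fil (p + 2) (n + 1)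
        rw [hda]
        exact zero_mem _⟩
      have := h p (by lia)
      obtain ⟨b, hb, m, z, hz, -, hab⟩ :=
        mem_denominator.1 ((pageMk_eq_zero_iff hac).1 (Subsingleton.elim _ _))
      have hb' : K.d n (n + 1) b = 0 := by
        rw [hab, map_add, K.d_d_apply, add_zero] at hda
        exact hda
      by_cases hm : m + 1 = n
      · obtain rfl : m = n - 1 := by lia
        exact ⟨b, hb.1, hb', z + y, by rw [hy, hab, map_add, add_assoc]⟩
      · have h0 : K.d m n z = 0 := by
          rw [K.shape _ _ hm]
          rfl
        exact ⟨b, hb.1, hb', y, by rw [hy, hab, h0, add_zero]⟩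
  obtain ⟨a, ha, -, y, hy⟩ := key (n + 1) le_rfl
  rw [eq_zero_of_mem_fil (Nat.lt_succ_self n) ha, zero_add] at hy
  exact ⟨_, y, hy.symm⟩

end CanonicallyBoundedFiltration

/-! ### Dimension shifting -/

namespace CochainComplex

open HomologicalComplex

variable {R : Type u} [CommRing R] {K L : CochainComplex (ModuleCat.{u} R) ℕ}

lemma homologyMap_injective_iff (φ : K ⟶ L) (n : ℕ) :
    Function.Injective (homologyMap φ n) ↔ ∀ x : K.X n, K.d n (n + 1) x = 0 →
      (∃ m y, L.d m n y = φ.f n x) → ∃ m y, K.d m n y = x := by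
  refine (injective_iff_map_eq_zero (homologyMap φ n).hom).trans
    ⟨fun h x hx hφ => ?_, fun h a ha => ?_⟩
  · refine (homologyClass_eq_zero_iff ⟨x, mem_cycleSubmodule_iff.2 hx⟩).1 (h _ ?_)
    exact (homologyMap_homologyClass K φ n _).trans ((homologyClass_eq_zero_iff _).2 hφ)
  · obtain ⟨x, rfl⟩ := K.homologyClass_surjective n a
    refine (homologyClass_eq_zero_iff x).2 (h x.1 (mem_cycleSubmodule_iff.1 x.2) ?_)
    exact (homologyClass_eq_zero_iff _).1 ((homologyMap_homologyClass K φ n x).symm.trans ha)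

lemma homologyMap_surjective_iff (φ : K ⟶ L) (n : ℕ) :
    Function.Surjective (homologyMap φ n) ↔ ∀ y : L.X n, L.d n (n + 1) y = 0 →
      ∃ x : K.X n, K.d n (n + 1) x = 0 ∧ ∃ m z, L.d m n z = φ.f n x - y := by
  have key (x : K.cycleSubmodule n) (y : L.cycleSubmodule n) :
      homologyMap φ n (K.homologyClass n x) = L.homologyClass n y ↔
        ∃ m z, L.d m n z = φ.f n x.1 - y.1 := by
    rw [homologyMap_homologyClass K φ n x, ← sub_eq_zero, ← map_sub, homologyClass_eq_zero_iff]
    rfl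
  constructor
  · intro h y hy
    obtain ⟨a, ha⟩ := h (L.homologyClass n ⟨y, mem_cycleSubmodule_iff.2 hy⟩)
    obtain ⟨x, rfl⟩ := K.homologyClass_surjective n a
    exact ⟨x.1, mem_cycleSubmodule_iff.1 x.2, (key _ _).1 ha⟩
  · intro h b
    obtain ⟨y, rfl⟩ := L.homologyClass_surjective n b
    obtain ⟨x, hx, hxy⟩ := h y.1 (mem_cycleSubmodule_iff.1 y.2)
    exact ⟨K.homologyClass n ⟨x, mem_cycleSubmodule_iff.2 hx⟩, (key _ _).2 hxy⟩

/-- Degreewise short exactness, in terms of elements. -/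
structure IsShortExact {I Q : CochainComplex (ModuleCat.{u} R) ℕ} (f : K ⟶ I) (g : I ⟶ Q) :
    Prop where
  injective (n : ℕ) : Function.Injective (f.f n)
  surjective (n : ℕ) : Function.Surjective (g.f n)
  exact (n : ℕ) (x : I.X n) : g.f n x = 0 ↔ ∃ y, f.f n y = x

variable {K' I I' Q Q' : CochainComplex (ModuleCat.{u} R) ℕ} {f : K ⟶ I} {g : I ⟶ Q}
  {f' : K' ⟶ I'} {g' : I' ⟶ Q'}

lemma comm_apply (φ : K ⟶ L) (m n : ℕ) (x : K.X m) :
    φ.f n (K.d m n x) = L.d m n (φ.f m x) :=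
  (ConcreteCategory.congr_hom (φ.comm m n) x).symm

lemma exists_succ_eq {n : ℕ} {x : K.X (n + 1)} (h : ∃ m y, K.d m (n + 1) y = x) :
    ∃ y, K.d n (n + 1) y = x := by
  obtain ⟨m, y, hy⟩ := h
  by_cases hm : m = n
  · subst hm
    exact ⟨y, hy⟩
  · rw [K.shape _ _ fun e => hm (Nat.succ_injective e)] at hy
    exact ⟨0, (map_zero _).trans hy⟩

/-- The half of the four lemma for long exact sequences that gives surjectivity one degree higher,
where the homology of `I'` vanishes. -/
lemma IsShortExact.homologyMap_succ_surjective (h : IsShortExact f g) (h' : IsShortExact f' g')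
    (a : K ⟶ K') (b : I ⟶ I') (c : Q ⟶ Q') (hab : f ≫ b = a ≫ f') (hbc : g ≫ c = b ≫ g') (n : ℕ)
    (hI' : ∀ x : I'.X (n + 1), I'.d (n + 1) (n + 2) x = 0 → ∃ m y, I'.d m (n + 1) y = x)
    (hc : Function.Surjective (homologyMap c n)) :
    Function.Surjective (homologyMap a (n + 1)) := by
  rw [homologyMap_surjective_iff] at hc ⊢
  have hab' (m : ℕ) (x : K.X m) : b.f m (f.f m x) = f'.f m (a.f m x) :=
    ConcreteCategory.congr_hom (congrArg (fun φ => φ.f m) hab) x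
  have hbc' (m : ℕ) (x : I.X m) : c.f m (g.f m x) = g'.f m (b.f m x) :=
    ConcreteCategory.congr_hom (congrArg (fun φ => φ.f m) hbc) x
  intro y hy
  obtain ⟨w, hw⟩ := exists_succ_eq (hI' (f'.f _ y) (by rw [← comm_apply, hy, map_zero]))
  have hgw : Q'.d n (n + 1) (g'.f n w) = 0 := by
    rw [← comm_apply, hw]
    exact (h'.exact _ _).2 ⟨y, rfl⟩
  obtain ⟨x, hx, m, z, hz⟩ := hc _ hgw
  obtain ⟨x', rfl⟩ := h.surjective n x
  obtain ⟨z', rfl⟩ := h'.surjective m z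
  rw [← comm_apply] at hx
  obtain ⟨k, hk⟩ := (h.exact _ _).1 hx
  have he : g'.f n (b.f n x' - w - I'.d m n z') = 0 := by
    rw [map_sub, map_sub, comm_apply, hz, hbc', sub_self]
  obtain ⟨e, he⟩ := (h'.exact _ _).1 he
  refine ⟨k, h.injective _ ?_, n, e, h'.injective _ ?_⟩
  · rw [comm_apply, hk, d_d_apply, map_zero]
  · rw [comm_apply, he, map_sub, map_sub, d_d_apply, sub_zero, hw, map_sub, ← hab', hk, comm_apply]

/-- The half of the four lemma for long exact sequences that gives injectivity one degree higher,
where the homology of `I` vanishes. -/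
lemma IsShortExact.homologyMap_succ_injective (h : IsShortExact f g) (h' : IsShortExact f' g')
    (a : K ⟶ K') (b : I ⟶ I') (c : Q ⟶ Q') (hab : f ≫ b = a ≫ f') (hbc : g ≫ c = b ≫ g') (n : ℕ)
    (hI : ∀ x : I.X (n + 1), I.d (n + 1) (n + 2) x = 0 → ∃ m y, I.d m (n + 1) y = x)
    (hb : Function.Surjective (homologyMap b n)) (hc : Function.Injective (homologyMap c n)) :
    Function.Injective (homologyMap a (n + 1)) := by
  rw [homologyMap_surjective_iff] at hb
  rw [homologyMap_injective_iff] at hc ⊢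
  have hab' (m : ℕ) (x : K.X m) : b.f m (f.f m x) = f'.f m (a.f m x) :=
    ConcreteCategory.congr_hom (congrArg (fun φ => φ.f m) hab) x
  have hbc' (m : ℕ) (x : I.X m) : c.f m (g.f m x) = g'.f m (b.f m x) :=
    ConcreteCategory.congr_hom (congrArg (fun φ => φ.f m) hbc) x
  intro k hk hak
  obtain ⟨e, he⟩ := exists_succ_eq hak
  obtain ⟨x, hx⟩ := exists_succ_eq (hI (f.f _ k) (by rw [← comm_apply, hk, map_zero]))
  obtain ⟨t, ht, m, z, hz⟩ := hb (b.f n x - f'.f n e) (by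
    rw [map_sub, ← comm_apply, hx, ← comm_apply, he, hab', sub_self])
  have hgx : Q.d n (n + 1) (g.f n (x - t)) = 0 := by
    rw [← comm_apply, map_sub, hx, ht, sub_zero]
    exact (h.exact _ _).2 ⟨k, rfl⟩
  obtain ⟨m', s, hs⟩ := hc _ hgx ⟨m, g'.f m (-z), by
    have h0 : g'.f n (f'.f n e) = 0 := (h'.exact _ _).2 ⟨e, rfl⟩
    rw [← comm_apply, map_neg, hz, hbc', map_sub, map_neg, map_sub, map_sub, map_sub, h0]
    abel⟩
  obtain ⟨s, rfl⟩ := h.surjective m' s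
  have hr : g.f n (x - t - I.d m' n s) = 0 := by
    rw [map_sub, comm_apply, hs, sub_self]
  obtain ⟨r, hr⟩ := (h.exact _ _).1 hr
  refine ⟨n, r, h.injective _ ?_⟩
  rw [comm_apply, hr, map_sub, map_sub, hx, ht, d_d_apply, sub_zero, sub_zero]

end CochainComplex

/-! ### Functoriality of the total complex -/

lemma Sh.Hom.mk_congr {R : Type u} [CommRing R] {X Y : Sh R} (b : Y.cat ⥤ X.cat)
    {m m' : b.op ⋙ X.sheaf ⟶ Y.sheaf} (h : ∀ y, m.app y = m'.app y) :
    (⟨b, m⟩ : Sh.Hom X Y) = ⟨b, m'⟩ :=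
  congrArg (Sh.Hom.mk b) (NatTrans.ext (funext h))

namespace SheafBundle

variable {R : Type u} [CommRing R] {B : Type u} [SmallCategory B] {ζ ξ : SheafBundle R B}
  (ψ : ζ ⟶ ξ)

/-- The map of the cochain sheaves on the base induced by a morphism of bundles. -/
def rowMap (q : ℕ) : ζ.row q ⟶ ξ.row q where
  base := 𝟭 B
  map :=
    { app := fun x => (Sh.cochainComplex.map (ψ.app x)).f q
      naturality := fun _ _ f => (Functor.whiskerRight ψ
        (Sh.cochainComplex ⋙ HomologicalComplex.eval _ _ q)).naturality f }

/-- The map of bicomplexes induced by a morphism of bundles. -/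
def bicomplexMap (p q : ℕ) : ζ.bicomplex p q ⟶ ξ.bicomplex p q :=
  (Sh.cochainComplex.map (rowMap ψ q)).f p

lemma bicomplexMap_dHor (p q : ℕ) :
    bicomplexMap ψ p q ≫ ξ.dHor p q = ζ.dHor p q ≫ bicomplexMap ψ (p + 1) q :=
  (Sh.cochainComplex.map (rowMap ψ q)).comm p (p + 1)

lemma bicomplexMap_dVert (p q : ℕ) :
    bicomplexMap ψ p q ≫ ξ.dVert p q = ζ.dVert p q ≫ bicomplexMap ψ p (q + 1) := by
  ext u
  funext σ
  exact ConcreteCategory.congr_hom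
    ((Sh.cochainComplex.map (ψ.app (op (σ.obj 0)))).comm q (q + 1)) (u σ)

/-- The map of the total complexes in degree `n`. -/
def totMapLinear (n : ℕ) : ζ.TotObj n →ₗ[R] ξ.TotObj n :=
  LinearMap.pi fun a => (bicomplexMap ψ a.1.1 a.1.2).hom ∘ₗ LinearMap.proj a

lemma totMapLinear_totD (n : ℕ) (u : ζ.TotObj n) :
    totMapLinear ψ (n + 1) (ζ.totD n u) = ξ.totD n (totMapLinear ψ n u) := by
  funext ⟨⟨p, q⟩, h⟩
  refine ((bicomplexMap ψ p q).hom.map_add _ _).trans ?_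
  refine congrArg₂ (fun v w : ξ.bicomplex p q => v + w) ?_
    (((bicomplexMap ψ p q).hom.map_smul _ _).trans (congrArg _ ?_))
  · cases p with
    | zero => exact (bicomplexMap ψ 0 q).hom.map_zero
    | succ p => exact (ConcreteCategory.congr_hom (bicomplexMap_dHor ψ p q) _).symm
  · cases q with
    | zero => exact (bicomplexMap ψ p 0).hom.map_zero
    | succ q => exact (ConcreteCategory.congr_hom (bicomplexMap_dVert ψ p q) _).symm

/-- The map of the total complexes induced by a morphism of bundles. -/
def totMap : ζ.totalComplex ⟶ ξ.totalComplex where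
  f n := ModuleCat.ofHom (totMapLinear ψ n)
  comm' i j h := by
    obtain rfl : i + 1 = j := h
    ext u
    rw [totalComplex_d, totalComplex_d]
    exact (totMapLinear_totD ψ i u).symm

variable (ξ)

/-- The morphism from the restriction of the total sheaf of a bundle to the bundle, with identities
as components. -/
def fromRestrictTotal : ξ.restrict ξ.totalSheaf.sheaf ⟶ ξ where
  app x :=
    { base := 𝟭 _
      map :=
        { app := fun y => 𝟙 _
          naturality := fun y y' k => by
            have h : ξ.totalSheaf.sheaf.map (ξ.fibArrow k.unop).op = (ξ.obj x).sheaf.map k :=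
              congrArg Quiver.Hom.unop (ξ.lift_fibPath k.unop)
            exact (Category.comp_id _).trans (h.trans (Category.id_comp _).symm) } }
  naturality x x' f := by
    refine Sh.Hom.mk_congr (ξ.map f).base fun y => ?_
    have h : ξ.totalSheaf.sheaf.map (ξ.liftArrow f.unop y.unop _ rfl).op = (ξ.map f).map.app y := by
      refine (congrArg Quiver.Hom.unop (ξ.lift_liftPath f.unop y.unop _ rfl)).trans ?_
      change (ξ.obj x).sheaf.map (𝟙 _) ≫ (ξ.map f).map.app y = _
      rw [CategoryTheory.Functor.map_id, Category.id_comp]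
    exact (Category.comp_id _).trans (h.trans (Category.id_comp _).symm)

variable {ξ}

/-- The morphism of bundles given by a map of sheaves on the total category. -/
def restrictMap {G G' : ξ.Totalᵒᵖ ⥤ ModuleCat.{u} R} (α : G ⟶ G') :
    ξ.restrict G ⟶ ξ.restrict G' where
  app x :=
    { base := 𝟭 _
      map :=
        { app := fun y => α.app (op ⟨⟨x.unop, y.unop⟩⟩)
          naturality := fun y y' k => α.naturality (ξ.fibArrow k.unop).op } }
  naturality x x' f := by
    refine Sh.Hom.mk_congr (X := (ξ.restrict G).obj x) (Y := (ξ.restrict G').obj x')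
      (ξ.map f).base fun y => ?_
    exact α.naturality (ξ.liftArrow f.unop y.unop _ rfl).op

/-- The morphism of `Sh` given by a map of sheaves on the total category. -/
def totalWithMap {G G' : ξ.Totalᵒᵖ ⥤ ModuleCat.{u} R} (α : G ⟶ G') :
    ξ.totalWith G ⟶ ξ.totalWith G' where
  base := 𝟭 _
  map := { app := fun y => α.app y
           naturality := fun _ _ k => α.naturality k }

lemma traversalHom_naturality {G G' : ξ.Totalᵒᵖ ⥤ ModuleCat.{u} R} (α : G ⟶ G') :
    Sh.cochainComplex.map (totalWithMap α) ≫ ξ.traversalHom G' =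
      ξ.traversalHom G ≫ totMap (restrictMap α) := by
  ext n u
  funext ⟨⟨p, q⟩, h⟩
  funext σ τ
  let F := α.app (op ⟨⟨σ.obj 0, τ.obj 0⟩⟩)
  refine (ξ.traversal_apply n p q h _ σ τ).trans ?_
  refine Eq.trans ?_ (congrArg F (ξ.traversal_apply n p q h u σ τ)).symm
  refine (GridPath.map_smul_traversalSum F.hom _ _ (fun f g => ?_) _).symm
  exact (ConcreteCategory.congr_hom
    (α.naturality (ξ.fromOrigin σ τ (f 0) (g 0)).op) (u (ξ.gridChain σ τ f g)))

end SheafBundle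

/-! ### Embedding a sheaf in a coinduced sheaf -/

section Coinduced

variable {R : Type u} [CommRing R] {C : Type u} [SmallCategory C] (G : Cᵒᵖ ⥤ ModuleCat.{u} R)

/-- The sheaf `y ↦ ∏_{z ⟶ y} G(z)`. -/
def coinducedSheaf : Cᵒᵖ ⥤ ModuleCat.{u} R where
  obj y := ModuleCat.of R (∀ z : C, (z ⟶ y.unop) → G.obj (op z))
  map h := ModuleCat.ofHom
    { toFun := fun v z k => v z (k ≫ h.unop)
      map_add' := fun _ _ => rfl
      map_smul' := fun _ _ => rfl }
  map_id y := by
    ext v z k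
    exact congrArg (v z) (Category.comp_id k)
  map_comp h h' := by
    ext v z k
    exact congrArg (v z) (Category.assoc _ _ _).symm

/-- The embedding of `G` in its coinduced sheaf by restriction along all arrows. -/
def toCoinduced : G ⟶ coinducedSheaf G where
  app y := ModuleCat.ofHom
    { toFun := fun v z k => G.map k.op v
      map_add' := fun v w => funext fun z => funext fun k => map_add (G.map k.op).hom v w
      map_smul' := fun r v => funext fun z => funext fun k => map_smul (G.map k.op).hom r v }
  naturality y y' h := by
    ext v
    funext z k
    exact (ConcreteCategory.congr_hom (G.map_comp h k.op) v).symm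

lemma toCoinduced_injective (y : Cᵒᵖ) : Function.Injective ((toCoinduced G).app y) := by
  intro v w h
  have h1 : G.map (𝟙 y) v = G.map (𝟙 y) w := congrFun (congrFun h y.unop) (𝟙 y.unop)
  rw [G.map_id] at h1
  exact h1

/-- The quotient of the coinduced sheaf of `G` by `G`. -/
def coinducedQuotient : Cᵒᵖ ⥤ ModuleCat.{u} R where
  obj y := ModuleCat.of R ((coinducedSheaf G).obj y ⧸ LinearMap.range ((toCoinduced G).app y).hom)
  map {y y'} h := ModuleCat.ofHom (Submodule.mapQ _ _ ((coinducedSheaf G).map h).hom (by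
    rintro _ ⟨v, rfl⟩
    exact ⟨G.map h v, ConcreteCategory.congr_hom ((toCoinduced G).naturality h) v⟩))
  map_id _ := by
    ext v
    exact congrArg Submodule.Quotient.mk
      (ConcreteCategory.congr_hom ((coinducedSheaf G).map_id _) v)
  map_comp h h' := by
    ext v
    exact congrArg Submodule.Quotient.mk
      (ConcreteCategory.congr_hom ((coinducedSheaf G).map_comp h h') v)

/-- The quotient map. -/
def toCoinducedQuotient : coinducedSheaf G ⟶ coinducedQuotient G where
  app _ := ModuleCat.ofHom (Submodule.mkQ _)
  naturality _ _ _ := rfl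

lemma toCoinducedQuotient_surjective (y : Cᵒᵖ) :
    Function.Surjective ((toCoinducedQuotient G).app y) :=
  Submodule.mkQ_surjective _

lemma toCoinducedQuotient_eq_zero_iff (y : Cᵒᵖ) (v : (coinducedSheaf G).obj y) :
    (toCoinducedQuotient G).app y v = 0 ↔ ∃ w, (toCoinduced G).app y w = v :=
  Submodule.Quotient.mk_eq_zero _

end Coinduced

namespace SheafBundle

variable {R : Type u} [CommRing R] {B : Type u} [SmallCategory B] {ξ : SheafBundle R B}

section ShortExact

variable {G G' G'' : ξ.Totalᵒᵖ ⥤ ModuleCat.{u} R} {α : G ⟶ G'} {β : G' ⟶ G''}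
  (hα : ∀ y, Function.Injective (α.app y)) (hβ : ∀ y, Function.Surjective (β.app y))
  (hαβ : ∀ y v, β.app y v = 0 ↔ ∃ w, α.app y w = v)

include hα hβ hαβ in
lemma isShortExact_cochainComplex_map :
    CochainComplex.IsShortExact (Sh.cochainComplex.map (totalWithMap α))
      (Sh.cochainComplex.map (totalWithMap β)) where
  injective n u v h := funext fun σ => hα _ (congrFun h σ)
  surjective n u := by
    choose v hv using fun σ : ComposableArrows ξ.Total n =>
      hβ (op (σ.obj 0)) ((u : (ξ.totalWith G'').Cochain n) σ)
    exact ⟨v, funext hv⟩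
  exact n u := by
    refine ⟨fun h => ?_, ?_⟩
    · choose v hv using fun σ : ComposableArrows ξ.Total n =>
        (hαβ (op (σ.obj 0)) ((u : (ξ.totalWith G').Cochain n) σ)).1 (congrFun h σ)
      exact ⟨v, funext hv⟩
    · rintro ⟨v, rfl⟩
      exact funext fun σ => (hαβ _ _).2 ⟨_, rfl⟩

include hα hβ hαβ in
lemma isShortExact_totMap :
    CochainComplex.IsShortExact (totMap (restrictMap α)) (totMap (restrictMap β)) where
  injective n u v h := funext fun a => funext fun σ => funext fun τ =>
    hα _ (congrFun (congrFun (congrFun h a) σ) τ)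
  surjective n u := by
    choose v hv using fun (a : {a : ℕ × ℕ // a.1 + a.2 = n}) (σ : ComposableArrows B a.1.1)
      (τ : ComposableArrows (ξ.Fib (σ.obj 0)) a.1.2) => hβ (op ⟨⟨σ.obj 0, τ.obj 0⟩⟩)
        (((u : (ξ.restrict G'').TotObj n) a : ((ξ.restrict G'').row a.1.2).Cochain a.1.1) σ τ)
    exact ⟨v, funext fun a => funext fun σ => funext fun τ => hv a σ τ⟩
  exact n u := by
    refine ⟨fun h => ?_, ?_⟩
    · choose v hv using fun (a : {a : ℕ × ℕ // a.1 + a.2 = n}) (σ : ComposableArrows B a.1.1)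
        (τ : ComposableArrows (ξ.Fib (σ.obj 0)) a.1.2) => (hαβ (op ⟨⟨σ.obj 0, τ.obj 0⟩⟩)
          (((u : (ξ.restrict G').TotObj n) a : ((ξ.restrict G').row a.1.2).Cochain a.1.1) σ τ)).1
          (congrFun (congrFun (congrFun h a) σ) τ)
      exact ⟨v, funext fun a => funext fun σ => funext fun τ => hv a σ τ⟩
    · rintro ⟨v, rfl⟩
      exact funext fun a => funext fun σ => funext fun τ => (hαβ _ _).2 ⟨_, rfl⟩

end ShortExact

end SheafBundle

/-! ### Cocycles of degree zero -/

namespace Sh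

variable {R : Type u} [CommRing R] (X : Sh R)

variable {X} in
/-- The cocycles of degree zero are the compatible families. -/
lemma diff_zero_eq_zero_iff (u : X.Cochain 0) : X.diff 0 u = 0 ↔
    ∀ (σ τ : ComposableArrows X.cat 0) (k : σ.obj 0 ⟶ τ.obj 0), X.sheaf.map k.op (u τ) = u σ := by
  have h : ∀ ρ : ComposableArrows X.cat 1, X.diff 0 u ρ =
      X.sheaf.map (ρ.faceArrow 0).op (u (ρ.face 0)) -
        X.sheaf.map (ρ.faceArrow 1).op (u (ρ.face 1)) := by
    intro ρ
    rw [diff_apply, Fin.sum_univ_two]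
    simp [sub_eq_add_neg]
  have h1 : ∀ (ρ : ComposableArrows X.cat 1), X.sheaf.map (ρ.faceArrow 1).op (u (ρ.face 1)) =
      u (ComposableArrows.mk₀ (ρ.obj 0)) := by
    intro ρ
    refine (X.map_apply_congr u (σ := ρ.face 1) (τ := ComposableArrows.mk₀ (ρ.obj 0))
      (ComposableArrows.ext₀ rfl) _ (𝟙 _) ?_).trans ?_
    · exact (Category.comp_id _).trans (ρ.map_id 0)
    · exact ConcreteCategory.congr_hom (X.sheaf.map_id _) _
  constructor
  · intro hu σ τ k
    obtain ⟨x, rfl⟩ := ComposableArrows.mk₀_surjective σ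
    obtain ⟨y, rfl⟩ := ComposableArrows.mk₀_surjective τ
    have h2 := (h (ComposableArrows.mk₁ k)).symm.trans (congrFun hu _)
    refine Eq.trans ?_ ((sub_eq_zero.1 h2).trans (h1 _))
    exact X.map_apply_congr u (σ := ComposableArrows.mk₀ y)
      (τ := (ComposableArrows.mk₁ k).face 0) (ComposableArrows.ext₀ rfl) _ _ (Category.comp_id _)
  · intro hu
    funext ρ
    refine (h ρ).trans (sub_eq_zero.2 (Eq.trans ?_ (h1 ρ).symm))
    exact hu (ComposableArrows.mk₀ (ρ.obj 0)) _ _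

end Sh

namespace CochainComplex

open HomologicalComplex

variable {R : Type u} [CommRing R] (K : CochainComplex (ModuleCat.{u} R) ℕ)

/-- In degree zero the homology is the module of cycles. -/
noncomputable def cyclesEquivHomologyZero : K.cycleSubmodule 0 ≃ₗ[R] K.homology 0 :=
  LinearEquiv.ofBijective (K.homologyClass 0)
    ⟨homologyClass_zero_injective, K.homologyClass_surjective 0⟩

end CochainComplex

namespace Sh

variable {R : Type u} [CommRing R] (X : Sh R) (y : X.cat)

/-- The value at `y` of a cohomology class of degree zero. -/
noncomputable def valueOfClass :
    (cochainComplex.obj X).homology 0 →ₗ[R] X.sheaf.obj (op y) where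
  toFun v := (((cochainComplex.obj X).cyclesEquivHomologyZero.symm v).1 : X.Cochain 0)
    (ComposableArrows.mk₀ y)
  map_add' v w := by
    rw [map_add]
    rfl
  map_smul' r v := by
    rw [map_smul]
    rfl

lemma valueOfClass_homologyClass (c : (cochainComplex.obj X).cycleSubmodule 0) :
    X.valueOfClass y ((cochainComplex.obj X).homologyClass 0 c) =
      (c.1 : X.Cochain 0) (ComposableArrows.mk₀ y) :=
  congrArg (fun c : (cochainComplex.obj X).cycleSubmodule 0 =>
    (c.1 : X.Cochain 0) (ComposableArrows.mk₀ y))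
    ((cochainComplex.obj X).cyclesEquivHomologyZero.symm_apply_apply c)

end Sh

namespace SheafBundle

variable {R : Type u} [CommRing R] {B : Type u} [SmallCategory B] (ξ : SheafBundle R B)
  (G : ξ.Totalᵒᵖ ⥤ ModuleCat.{u} R)

/-! ### The coinduced sheaf on the fibres and on the base -/

/-- The coinduced sheaf on the total category. -/
def totalCoinduced : (ξ.totalWith (coinducedSheaf G)).Coinduced where
  ι := ξ.Total
  w z := z
  A z := G.obj (op z)
  ev z := ModuleCat.ofHom (LinearMap.proj (𝟙 z) ∘ₗ
    (LinearMap.proj z : (∀ z' : ξ.Total, (z' ⟶ z) → G.obj (op z')) →ₗ[R] _))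
  injective y v v' h := by
    funext z k
    have h1 : (v : ∀ z' : ξ.Total, (z' ⟶ y) → G.obj (op z')) z (𝟙 z ≫ k) =
      (v' : ∀ z' : ξ.Total, (z' ⟶ y) → G.obj (op z')) z (𝟙 z ≫ k) := h z k
    rwa [Category.id_comp] at h1
  surjective y a := ⟨fun z k => a z k, fun z k => congrArg (a z) (Category.id_comp k)⟩

/-- The coinduced sheaf on a fibre: the arrows `z ⟶ y` of the total category to an object `y` of
the fibre at `x` are the pairs of an arrow `f` from the base point of `z` to `x` and an arrow of
the fibre from `ξ₁(f)(z)` to `y`. -/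
def fibreCoinduced (x : B) : ((ξ.restrict (coinducedSheaf G)).obj (op x)).Coinduced where
  ι := Σ z : ξ.Obj, (z.pt ⟶ x)
  w j := (ξ.push j.2).obj j.1.val
  A j := G.obj (op ⟨j.1⟩)
  ev j := ModuleCat.ofHom (LinearMap.proj (ξ.liftArrow j.2 j.1.val _ rfl) ∘ₗ
    (LinearMap.proj ⟨j.1⟩ : (∀ z : ξ.Total, (z ⟶ ⟨⟨x, (ξ.push j.2).obj j.1.val⟩⟩) →
      G.obj (op z)) →ₗ[R] _))
  injective y v v' h := by
    let V : ∀ z : ξ.Total, (z ⟶ ⟨⟨x, y⟩⟩) → G.obj (op z) := v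
    let V' : ∀ z : ξ.Total, (z ⟶ ⟨⟨x, y⟩⟩) → G.obj (op z) := v'
    funext ⟨z⟩ g
    have h1 : V ⟨z⟩ (ξ.normalForm (b := ⟨x, y⟩) g).arrow =
        V' ⟨z⟩ (ξ.normalForm (b := ⟨x, y⟩) g).arrow :=
      h ⟨z, (ξ.normalForm (b := ⟨x, y⟩) g).1⟩ (ξ.normalForm (b := ⟨x, y⟩) g).2
    have e : (ξ.normalForm (b := ⟨x, y⟩) g).arrow = g := ξ.arrow_normalForm g
    exact (congrArg (V ⟨z⟩) e).symm.trans (h1.trans (congrArg (V' ⟨z⟩) e))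
  surjective y a := by
    let a' (z : ξ.Obj) (s : ξ.NormalForm z ⟨x, y⟩) : G.obj (op ⟨z⟩) := a ⟨z, s.1⟩ s.2
    refine ⟨fun z g => a' z.as (ξ.normalForm (b := ⟨x, y⟩) g), fun ⟨z, f⟩ k => ?_⟩
    exact congrArg (a' z) (ξ.normalForm_arrow (b := ⟨x, y⟩) ⟨f, k⟩)

/-- The value at the identity of `z` of a section of the coinduced sheaf over the fibre of `z`. -/
noncomputable def sectionValue (z : ξ.Obj) :
    ((ξ.restrict (coinducedSheaf G)).fibreCohomologySh 0).sheaf.obj (op z.pt) ⟶ G.obj (op ⟨z⟩) :=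
  ModuleCat.ofHom (LinearMap.proj (𝟙 (⟨z⟩ : ξ.Total)) ∘ₗ
    (LinearMap.proj ⟨z⟩ : (∀ z' : ξ.Total, (z' ⟶ ⟨z⟩) → G.obj (op z')) →ₗ[R] _) ∘ₗ
    ((ξ.restrict (coinducedSheaf G)).obj (op z.pt)).valueOfClass z.val)

lemma sectionValue_map_homologyClass {x : B} (z : ξ.Obj) (k : z.pt ⟶ x)
    (c : ((ξ.restrict (coinducedSheaf G)).fibreComplex x).cycleSubmodule 0) :
    ξ.sectionValue G z (((ξ.restrict (coinducedSheaf G)).fibreCohomologySh 0).sheaf.map k.op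
      (((ξ.restrict (coinducedSheaf G)).fibreComplex x).homologyClass 0 c)) =
    ((c.1 : ((ξ.restrict (coinducedSheaf G)).obj (op x)).Cochain 0)
      (ComposableArrows.mk₀ z.val ⋙ ξ.push k) :
        ∀ z' : ξ.Total, (z' ⟶ ⟨⟨x, (ξ.push k).obj z.val⟩⟩) → G.obj (op z'))
      ⟨z⟩ (ξ.liftArrow k z.val _ rfl) := by
  have h := HomologicalComplex.homologyMap_homologyClass _
    (Sh.cochainComplex.map ((ξ.restrict (coinducedSheaf G)).map k.op)) 0 c
  refine (congrArg (ξ.sectionValue G z) h).trans ?_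
  let ev : (∀ z' : ξ.Total, (z' ⟶ ⟨z⟩) → G.obj (op z')) → G.obj (op ⟨z⟩) := fun v => v ⟨z⟩ (𝟙 _)
  refine (congrArg ev (((ξ.restrict (coinducedSheaf G)).obj (op z.pt)).valueOfClass_homologyClass
    z.val _)).trans ?_
  let C := (c.1 : ((ξ.restrict (coinducedSheaf G)).obj (op x)).Cochain 0)
    (ComposableArrows.mk₀ z.val ⋙ ξ.push k)
  exact congrArg ((C : ∀ z' : ξ.Total, (z' ⟶ ⟨⟨x, (ξ.push k).obj z.val⟩⟩) → G.obj (op z')) ⟨z⟩)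
    (Category.id_comp _)

/-- The sheaf on the base formed by the sections of the coinduced sheaf over the fibres. A section
over the fibre at `x` is a function of the arrows to the fibre that is constant along the arrows of
the fibre, so by normal forms a family of elements of `G(z)` indexed by the objects `z` and the
arrows of the base from the base point of `z` to `x`. -/
noncomputable def baseCoinduced :
    ((ξ.restrict (coinducedSheaf G)).fibreCohomologySh 0).Coinduced where
  ι := ξ.Obj
  w z := z.pt
  A z := G.obj (op ⟨z⟩)
  ev z := ξ.sectionValue G z
  injective x v v' h := by
    obtain ⟨c, rfl⟩ := ((ξ.restrict (coinducedSheaf G)).fibreComplex x).homologyClass_surjective 0 v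
    obtain ⟨c', rfl⟩ :=
      ((ξ.restrict (coinducedSheaf G)).fibreComplex x).homologyClass_surjective 0 v'
    refine congrArg _ (Subtype.ext (funext fun τ => ?_))
    have key (c : ((ξ.restrict (coinducedSheaf G)).fibreComplex x).cycleSubmodule 0)
        (z : ξ.Obj) (g : (⟨z⟩ : ξ.Total) ⟶ ⟨⟨x, τ.obj 0⟩⟩) :
        ((c.1 : ((ξ.restrict (coinducedSheaf G)).obj (op x)).Cochain 0) τ :
          ∀ z' : ξ.Total, (z' ⟶ ⟨⟨x, τ.obj 0⟩⟩) → G.obj (op z')) ⟨z⟩ g =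
        ξ.sectionValue G z
          (((ξ.restrict (coinducedSheaf G)).fibreCohomologySh 0).sheaf.map (ξ.normalForm g).1.op
          (((ξ.restrict (coinducedSheaf G)).fibreComplex x).homologyClass 0 c)) := by
      refine Eq.trans ?_ (ξ.sectionValue_map_homologyClass G z _ c).symm
      let C : ∀ z' : ξ.Total, (z' ⟶ ⟨⟨x, τ.obj 0⟩⟩) → G.obj (op z') :=
        (c.1 : ((ξ.restrict (coinducedSheaf G)).obj (op x)).Cochain 0) τ
      refine (congrArg (C ⟨z⟩) (ξ.arrow_normalForm g)).symm.trans ?_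
      have hc := (Sh.diff_zero_eq_zero_iff _).1 ((Sh.cochainComplex_d_apply _ _ _).symm.trans
        (CochainComplex.mem_cycleSubmodule_iff.1 c.2))
        (ComposableArrows.mk₀ z.val ⋙ ξ.push (ξ.normalForm g).1) τ (ξ.normalForm g).2
      exact congrFun (congrFun hc ⟨z⟩) (ξ.liftArrow (ξ.normalForm g).1 z.val _ rfl)
    funext ⟨z⟩ g
    exact (key c z g).trans ((h z (ξ.normalForm g).1).trans (key c' z g).symm)
  surjective x a := by
    let u : ((ξ.restrict (coinducedSheaf G)).obj (op x)).Cochain 0 := fun τ z g =>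
      a z.as (ξ.normalForm (b := ⟨x, τ.obj 0⟩) g).1
    have hu : ((ξ.restrict (coinducedSheaf G)).obj (op x)).diff 0 u = 0 := by
      rw [Sh.diff_zero_eq_zero_iff]
      intro τ τ' k
      funext ⟨z⟩ g
      exact congrArg (fun s : ξ.NormalForm z ⟨x, τ'.obj 0⟩ => a z s.1)
        (ξ.normalForm_comp_fibArrow g k)
    refine ⟨((ξ.restrict (coinducedSheaf G)).fibreComplex x).homologyClass 0 ⟨u, ?_⟩, ?_⟩
    · exact CochainComplex.mem_cycleSubmodule_iff.2 ((Sh.cochainComplex_d_apply _ _ _).trans hu)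
    · intro z k
      refine (ξ.sectionValue_map_homologyClass G z k _).trans ?_
      exact congrArg (fun s : ξ.NormalForm z ⟨x, (ξ.push k).obj z.val⟩ => a z s.1)
        (ξ.normalForm_liftArrow k)

end SheafBundle

/-! ### Vanishing for the coinduced sheaf -/

namespace SheafBundle

variable {R : Type u} [CommRing R] {B : Type u} [SmallCategory B] (ξ : SheafBundle R B)
  (G : ξ.Totalᵒᵖ ⥤ ModuleCat.{u} R)

/-- The second page of the spectral sequence of the coinduced sheaf vanishes outside the origin. -/
lemma subsingleton_page_two_coinduced (p q : ℕ) (h : p + q ≠ 0) :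
    Subsingleton ((ξ.restrict (coinducedSheaf G)).baseFiltration.Page 2 p (p + q)) := by
  obtain ⟨e⟩ := (ξ.restrict (coinducedSheaf G)).nonempty_page_two_equiv p q
  suffices hs : Subsingleton ((Sh.cochainComplex.obj
    ((ξ.restrict (coinducedSheaf G)).fibreCohomologySh q)).homology p) from e.toEquiv.subsingleton
  cases q with
  | zero =>
    obtain ⟨p, rfl⟩ := Nat.exists_eq_succ_of_ne_zero h
    exact CochainComplex.subsingleton_homology_of_exactAt ((ξ.baseCoinduced G).exactAt p)
  | succ q =>
    have hx (x : B) : Subsingleton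
        (((ξ.restrict (coinducedSheaf G)).fibreComplex x).homology (q + 1)) :=
      CochainComplex.subsingleton_homology_of_exactAt ((ξ.fibreCoinduced G x).exactAt q)
    have hc (c : (Sh.cochainComplex.obj
        ((ξ.restrict (coinducedSheaf G)).fibreCohomologySh (q + 1))).X p) : c = 0 :=
      funext fun σ => (hx (σ.obj 0)).elim _ _
    refine ⟨fun a b => ?_⟩
    obtain ⟨c, rfl⟩ := HomologicalComplex.homologyClass_surjective _ _ a
    obtain ⟨c', rfl⟩ := HomologicalComplex.homologyClass_surjective _ _ b
    exact congrArg _ (Subtype.ext ((hc c.1).trans (hc c'.1).symm))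

lemma exists_d_eq_totalComplex_coinduced (n : ℕ)
    (x : (ξ.restrict (coinducedSheaf G)).totalComplex.X (n + 1))
    (hx : (ξ.restrict (coinducedSheaf G)).totalComplex.d (n + 1) (n + 2) x = 0) :
    ∃ m y, (ξ.restrict (coinducedSheaf G)).totalComplex.d m (n + 1) y = x := by
  refine (ξ.restrict (coinducedSheaf G)).baseFiltration.exists_d_eq_of_subsingleton_page
    (fun p hp => ?_) x hx
  obtain ⟨q, hq⟩ := Nat.exists_eq_add_of_le hp
  rw [hq]
  exact ξ.subsingleton_page_two_coinduced G p q (by lia)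

lemma exists_d_eq_cochainComplex_coinduced (n : ℕ)
    (x : (Sh.cochainComplex.obj (ξ.totalWith (coinducedSheaf G))).X (n + 1))
    (hx : (Sh.cochainComplex.obj (ξ.totalWith (coinducedSheaf G))).d (n + 1) (n + 2) x = 0) :
    ∃ m y, (Sh.cochainComplex.obj (ξ.totalWith (coinducedSheaf G))).d m (n + 1) y = x := by
  obtain ⟨y, hy⟩ := (ξ.totalCoinduced G).exists_diff_eq x
    ((Sh.cochainComplex_d_apply _ _ _).symm.trans hx)
  exact ⟨n, y, (Sh.cochainComplex_d_apply _ _ _).trans hy⟩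

/-! ### The grid traversal map is a quasi-isomorphism -/

variable {G}

/-- In degree zero the grid traversal of a cocycle has the same values as the cocycle. -/
lemma traversal_zero_apply (u : (ξ.totalWith G).Cochain 0)
    (hu : (ξ.totalWith G).diff 0 u = 0) (σ : ComposableArrows B 0)
    (τ : ComposableArrows (ξ.Fib (σ.obj 0)) 0) (ρ : ComposableArrows ξ.Total 0)
    (hρ : ρ.obj 0 = ⟨⟨σ.obj 0, τ.obj 0⟩⟩) :
    (ξ.traversal G 0 u ⟨(0, 0), rfl⟩ : ((ξ.restrict G).row 0).Cochain 0) σ τ =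
      G.map (eqToHom hρ.symm).op (u ρ) := by
  let w : (Fin 1 →o Fin 1) → (Fin 1 →o Fin 1) → G.obj (op ⟨⟨σ.obj 0, τ.obj 0⟩⟩) :=
    fun f g => ξ.gridValue σ τ f g u
  have h1 : GridPath.traversalSum R w = w (OrderHom.const _ 0) (OrderHom.const _ 0) := by
    rw [GridPath.traversalSum_eq w (GridPath.extend w) fun z =>
      (GridPath.extend_apply w z.i z.j _ (fun _ => rfl) fun _ => rfl).symm]
    exact GridPath.extend_apply w _ _ _ (fun _ => rfl) fun _ => rfl
  refine (ξ.traversal_apply 0 0 0 rfl u σ τ).trans ((congrArg _ h1).trans ?_)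
  have hc := (Sh.diff_zero_eq_zero_iff u).1 hu (ComposableArrows.mk₀ ⟨⟨σ.obj 0, τ.obj 0⟩⟩)
  refine (congrArg (fun r : R => r • w _ _) (pow_zero (-1))).trans ((one_smul R _).trans ?_)
  exact (hc (ξ.gridChain σ τ (OrderHom.const _ 0) (OrderHom.const _ 0))
    (ξ.fromOrigin σ τ 0 0)).trans (hc ρ (eqToHom hρ.symm)).symm

/-- A cocycle of degree zero of the total complex is a family of elements of the values of `G` that
is compatible with the arrows of both types, hence with all arrows of the total category. -/
lemma exists_traversal_zero_eq (v : (ξ.restrict G).TotObj 0) (hv : (ξ.restrict G).totD 0 v = 0) :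
    ∃ u, (ξ.totalWith G).diff 0 u = 0 ∧ ξ.traversal G 0 u = v := by
  let w : ((ξ.restrict G).row 0).Cochain 0 := v ⟨(0, 0), rfl⟩
  have hHor : ((ξ.restrict G).row 0).diff 0 w = 0 := by
    have h := congrFun hv ⟨(1, 0), rfl⟩
    refine ((ξ.restrict G).dHor_apply 0 0 (v ⟨(0, 0), rfl⟩)).symm.trans (Eq.trans ?_ h)
    refine (add_zero ((ξ.restrict G).dHor 0 0 (v ⟨(0, 0), rfl⟩))).symm.trans ?_
    exact congrArg (fun z => (ξ.restrict G).dHor 0 0 (v ⟨(0, 0), rfl⟩) + z)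
      (smul_zero ((-1 : R) ^ (1 + 0))).symm
  have hVert : (ξ.restrict G).dVert 0 0 (v ⟨(0, 0), rfl⟩) = 0 := by
    have h : 0 + (-1 : R) ^ (0 + 1) • (ξ.restrict G).dVert 0 0 (v ⟨(0, 0), rfl⟩) = 0 :=
      congrFun hv ⟨(0, 1), rfl⟩
    generalize (ξ.restrict G).dVert 0 0 (v ⟨(0, 0), rfl⟩) = V at h ⊢
    simpa using h
  have hfib (x : B) (τ τ' : ComposableArrows (ξ.Fib x) 0) (k : τ.obj 0 ⟶ τ'.obj 0) :
      G.map (ξ.fibArrow k).op (w (ComposableArrows.mk₀ x) τ') = w (ComposableArrows.mk₀ x) τ :=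
    (Sh.diff_zero_eq_zero_iff (X := (ξ.restrict G).obj (op x)) (w (ComposableArrows.mk₀ x))).1
      (((ξ.restrict G).dVert_apply 0 0 _ (ComposableArrows.mk₀ x)).symm.trans
        (congrFun hVert (ComposableArrows.mk₀ x))) τ τ' k
  have hlift {x x' : B} (f : x ⟶ x') (y : ξ.Fib x) :
      G.map (ξ.liftArrow f y _ rfl).op
        (w (ComposableArrows.mk₀ x') (ComposableArrows.mk₀ ((ξ.push f).obj y))) =
      w (ComposableArrows.mk₀ x) (ComposableArrows.mk₀ y) := by
    have h := congrFun ((Sh.diff_zero_eq_zero_iff w).1 hHor (ComposableArrows.mk₀ x)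
      (ComposableArrows.mk₀ x') f) (ComposableArrows.mk₀ y)
    have h' := hfib x' (ComposableArrows.mk₀ ((ξ.push f).obj y)) (ComposableArrows.mk₀ y ⋙ ξ.push f)
      (𝟙 _)
    have h'' : w (ComposableArrows.mk₀ x') (ComposableArrows.mk₀ ((ξ.push f).obj y)) =
        w (ComposableArrows.mk₀ x') (ComposableArrows.mk₀ y ⋙ ξ.push f) :=
      h'.symm.trans ((congrArg (fun g => G.map (Quiver.Hom.op g)
        (w (ComposableArrows.mk₀ x') (ComposableArrows.mk₀ y ⋙ ξ.push f))) (ξ.fibArrow_id _)).trans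
          (ConcreteCategory.congr_hom (G.map_id _) _))
    exact (congrArg (G.map (ξ.liftArrow f y _ rfl).op) h'').trans h
  let s (a : ξ.Obj) : G.obj (op ⟨a⟩) := w (ComposableArrows.mk₀ a.pt) (ComposableArrows.mk₀ a.val)
  have hs {a b : ξ.Obj} (g : (⟨a⟩ : ξ.Total) ⟶ ⟨b⟩) : G.map g.op (s b) = s a := by
    rw [← ξ.arrow_normalForm g]
    refine (ConcreteCategory.congr_hom (G.map_comp _ _) _).trans ?_
    refine (congrArg _ (hfib b.pt (ComposableArrows.mk₀ _) (ComposableArrows.mk₀ b.val)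
      (ξ.normalForm g).2)).trans ?_
    exact hlift (ξ.normalForm g).1 a.val
  let u : (ξ.totalWith G).Cochain 0 := fun ρ => s (ρ.obj 0).as
  have hu : (ξ.totalWith G).diff 0 u = 0 :=
    (Sh.diff_zero_eq_zero_iff u).2 fun ρ ρ' k => hs k
  refine ⟨u, hu, ?_⟩
  funext ⟨⟨p, q⟩, h⟩
  obtain ⟨rfl, rfl⟩ : p = 0 ∧ q = 0 := Nat.add_eq_zero_iff.1 h
  funext σ τ
  obtain ⟨x, rfl⟩ := ComposableArrows.mk₀_surjective σ
  obtain ⟨y, rfl⟩ := ComposableArrows.mk₀_surjective τ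
  refine (ξ.traversal_zero_apply u hu _ _ (ComposableArrows.mk₀ ⟨⟨x, y⟩⟩) rfl).trans ?_
  exact ConcreteCategory.congr_hom (G.map_id _) _

lemma homologyMap_traversalHom_zero_bijective (G : ξ.Totalᵒᵖ ⥤ ModuleCat.{u} R) :
    Function.Bijective (HomologicalComplex.homologyMap (ξ.traversalHom G) 0) := by
  constructor
  · rw [CochainComplex.homologyMap_injective_iff]
    rintro u hu ⟨m, y, hy⟩
    have hu' := (Sh.cochainComplex_d_apply _ _ _).symm.trans hu
    have h0 : ξ.traversal G 0 u = 0 := by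
      rw [(ξ.restrict G).totalComplex.shape m 0 (by simp)] at hy
      exact hy.symm
    refine ⟨0, 0, (map_zero ((Sh.cochainComplex.obj (ξ.totalWith G)).d 0 0).hom).trans ?_⟩
    funext ρ
    have h1 := ξ.traversal_zero_apply u hu' (ComposableArrows.mk₀ (ρ.obj 0).as.pt)
      (ComposableArrows.mk₀ (ρ.obj 0).as.val) ρ rfl
    have h2 : G.map (𝟙 _) (u ρ) = u ρ := ConcreteCategory.congr_hom (G.map_id _) (u ρ)
    refine Eq.trans ?_ (h1.trans h2)
    have h3 : (ξ.traversal G 0 u ⟨(0, 0), rfl⟩ : ((ξ.restrict G).row 0).Cochain 0)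
        (ComposableArrows.mk₀ (ρ.obj 0).as.pt) (ComposableArrows.mk₀ (ρ.obj 0).as.val) = 0 :=
      congrFun (congrFun (congrFun h0 ⟨(0, 0), rfl⟩) (ComposableArrows.mk₀ (ρ.obj 0).as.pt))
        (ComposableArrows.mk₀ (ρ.obj 0).as.val)
    exact h3.symm
  · rw [CochainComplex.homologyMap_surjective_iff]
    intro v hv
    rw [totalComplex_d] at hv
    obtain ⟨u, hu, huv⟩ := ξ.exists_traversal_zero_eq v hv
    refine ⟨u, (Sh.cochainComplex_d_apply _ _ _).trans hu, 0, 0, ?_⟩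
    exact (map_zero ((ξ.restrict G).totalComplex.d 0 0).hom).trans (sub_eq_zero.2 huv).symm

/-- The grid traversal map induces isomorphisms in cohomology: in degree zero both sides are the
compatible families, and the step from `n` to `n + 1` embeds `G` in its coinduced sheaf, for which
both cohomologies vanish in positive degrees. -/
lemma homologyMap_traversalHom_bijective (n : ℕ) (G : ξ.Totalᵒᵖ ⥤ ModuleCat.{u} R) :
    Function.Bijective (HomologicalComplex.homologyMap (ξ.traversalHom G) n) := by
  induction n generalizing G with
  | zero => exact ξ.homologyMap_traversalHom_zero_bijective G
  | succ n ih =>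
    have h := isShortExact_cochainComplex_map (ξ := ξ) (toCoinduced_injective G)
      (toCoinducedQuotient_surjective G) (toCoinducedQuotient_eq_zero_iff G)
    have h' := isShortExact_totMap (ξ := ξ) (toCoinduced_injective G)
      (toCoinducedQuotient_surjective G) (toCoinducedQuotient_eq_zero_iff G)
    exact ⟨h.homologyMap_succ_injective h' _ _ _ (traversalHom_naturality (toCoinduced G))
        (traversalHom_naturality (toCoinducedQuotient G)) n
        (ξ.exists_d_eq_cochainComplex_coinduced G n) (ih _).2 (ih _).1,
      h.homologyMap_succ_surjective h' _ _ _ (traversalHom_naturality (toCoinduced G))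
        (traversalHom_naturality (toCoinducedQuotient G)) n
        (ξ.exists_d_eq_totalComplex_coinduced G n) (ih _).2⟩

instance quasiIso_traversalHom (G : ξ.Totalᵒᵖ ⥤ ModuleCat.{u} R) :
    QuasiIso (ξ.traversalHom G) where
  quasiIsoAt n := by
    rw [quasiIsoAt_iff_isIso_homologyMap]
    exact (ConcreteCategory.isIso_iff_bijective _).2 (ξ.homologyMap_traversalHom_bijective n G)

instance isIso_totMap_fromRestrictTotal : IsIso (totMap ξ.fromRestrictTotal) := by
  have (n : ℕ) : IsIso ((totMap ξ.fromRestrictTotal).f n) := by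
    refine (ConcreteCategory.isIso_iff_bijective _).2 ⟨fun u v h => ?_, fun v => ?_⟩
    · exact funext fun a => funext fun σ => funext fun τ => congrFun (congrFun (congrFun h a) σ) τ
    · exact ⟨v, rfl⟩
  exact HomologicalComplex.Hom.isIso_of_components _

/-- The grid traversal map of a bundle as a map of complexes. -/
noncomputable def totalTraversalHom :
    Sh.cochainComplex.obj ξ.totalSheaf ⟶ ξ.totalComplex :=
  ξ.traversalHom ξ.totalSheaf.sheaf ≫ totMap ξ.fromRestrictTotal

lemma totalTraversalHom_f (n : ℕ) : ξ.totalTraversalHom.f n = ξ.traversalMap n := by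
  rfl

lemma quasiIso_totalTraversalHom : QuasiIso ξ.totalTraversalHom :=
  haveI := ξ.quasiIso_traversalHom ξ.totalSheaf.sheaf
  quasiIso_comp (K := Sh.cochainComplex.obj (ξ.totalWith ξ.totalSheaf.sheaf))
    (ξ.traversalHom ξ.totalSheaf.sheaf) (totMap ξ.fromRestrictTotal)

end SheafBundle

theorem mainTheorem1 {R : Type u} [CommRing R] {B : Type u} [PartialOrder B] [Finite B]
    (hB : RecursivelyAdmissible B) (ξ : SheafBundle R B) :
    (∃ E : E₂CohomologicalSpectralSequenceNat (ModuleCat.{u} R),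
      (∀ p q : ℕ, Nonempty ((E.page 2 le_rfl).X (p, q) ≅
        (Sh.cohomology R p).obj { cat := B, sheaf := ξ.fibreCohomology q })) ∧
      ConvergesTo E fun n => (Sh.cohomology R n).obj ξ.totalSheaf) ∧
    ∃ φ : Sh.cochainComplex.obj ξ.totalSheaf ⟶ ξ.totalComplex,
      (∀ n : ℕ, φ.f n = ξ.traversalMap n) ∧ QuasiIso φ := by
  have hq := ξ.quasiIso_totalTraversalHom
  refine ⟨⟨ξ.baseFiltration.spectralSequence, fun p q => ?_, ?_⟩,
    ξ.totalTraversalHom, ξ.totalTraversalHom_f, hq⟩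
  · obtain ⟨e⟩ := ξ.nonempty_page_two_equiv p q
    exact ⟨e.toModuleIso⟩
  · let e (n : ℕ) : (Sh.cochainComplex.obj ξ.totalSheaf).homology n ≅ ξ.totalComplex.homology n :=
      asIso (HomologicalComplex.homologyMap ξ.totalTraversalHom n)
    refine CanonicallyBoundedFiltration.convergesTo ξ.baseFiltration
      (fun n => (e n).toLinearEquiv.symm.toLinearMap ∘ₗ ξ.totalComplex.homologyClass n)
      (fun n => (e n).toLinearEquiv.symm.surjective.comp
        (ξ.totalComplex.homologyClass_surjective n)) fun n x => ?_
    refine Iff.trans ?_ (HomologicalComplex.homologyClass_eq_zero_iff x)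
    exact (e n).toLinearEquiv.symm.map_eq_zero_iff
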